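/- Let $F$ be a nonreal field (i.e. $-1$ is a sum of squares in $F$; the characteristic is arbitrary), let $K/F$ be a separable quadratic field extension, and let $\alpha\in\mathrm{Br}(K)$ be such that $\mathrm{ind}\,\alpha\le 4$. Then $$u(\alpha/F)\;\le\;\tfrac{63}{32}\,u(F).$$ Here $u(F)\in\mathbb N\cup\{\infty\}$ is the supremum of the dimensions of the anisotropic quadratic forms over $F$. Let $D$ be the central $K$-division algebra with $[D]=\alpha$; $\mathrm{ind}\,\alpha$ is its degree $\sqrt{\dim_K D}$. A $K/F$-unitary involution on $D$ is a ring anti-automorphism $\gamma$ of $D$ with $\gamma^2=\mathrm{id}_D$ and $\{x\in K\mid\gamma(x)=x\}=F$. A hermitian form over $(D,\gamma)$ on a finite-dimensional right $D$-vector space $V$ is a bi-additive map $h\colon V\times V\to D$ with $h(va,wb)=\gamma(a)h(v,w)b$ and $h(w,v)=\gamma(h(v,w))$ for all $v,w\in V$ and $a,b\in D$; it is anisotropic if $h(v,v)\neq0$ for all $v\in V\setminus\{0\}$. If $D$ has a $K/F$-unitary involution $\gamma$, then $u(\alpha/F)\in\mathbb N\cup\{\infty\}$ is the supremum of $\dim_D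 V$ over all anisotropic hermitian forms $(V,h)$ over $(D,\gamma)$ (this does not depend on the choice of $\gamma$); otherwise $u(\alpha/F)=0$. -/

import Mathlib

open scoped ENNReal

universe u v w

/-- The `u`-invariant of a (nonreal) field `F`, in `ℕ ∪ {∞}`: the supremum of the dimensions of the
anisotropic quadratic forms over `F`. -/
noncomputable def fieldUInv (F : Type u) [Field F] : ℕ∞ :=
  sSup {n : ℕ∞ | ∃ (V : Type u) (_ : AddCommGroup V) (_ : Module F V) (_ : FiniteDimensional F V)
    (q : QuadraticForm F V), q.Anisotropic ∧ (Module.finrank F V : ℕ∞) = n}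

/-- An `ε`-hermitian form over a ring with involution `(B, γ)` on the right `B`-module `V`, where
`ε = ±1`. A right `B`-module is a module over `Bᵐᵒᵖ`: `MulOpposite.op a • v` is `v a`. -/
structure EpsHermitianForm {B : Type v} [Ring B] (γ : RingInvo B) (ε : ℤˣ)
    (V : Type w) [AddCommGroup V] [Module Bᵐᵒᵖ V] where
  toFun : V →+ V →+ B
  map_smul_smul : ∀ (x y : V) (a b : B),
    toFun (MulOpposite.op a • x) (MulOpposite.op b • y) = (γ a).unop * toFun x y * b
  symm : ∀ x y : V, toFun y x = (ε : ℤ) • (γ (toFun x y)).unop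

/-- A form is anisotropic if `h(x, x) = 0` only for `x = 0`. -/
def EpsHermitianForm.Anisotropic {B : Type v} [Ring B] {γ : RingInvo B} {ε : ℤˣ}
    {V : Type w} [AddCommGroup V] [Module Bᵐᵒᵖ V] (h : EpsHermitianForm γ ε V) : Prop :=
  ∀ x : V, h.toFun x x = 0 → x = 0

/-- The `ε`-hermitian `u`-invariant `u(B, γ, ε)`: the supremum of the ranks of the anisotropic
`ε`-hermitian forms over `(B, γ)` on finitely generated right `B`-modules. The rank of a module over
a central simple algebra is the number of simple components in a decomposition into simple modules,
that is, its length (over a division algebra: its dimension). -/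
noncomputable def hermitianUInv {B : Type v} [Ring B] (γ : RingInvo B) (ε : ℤˣ) : ℕ∞ :=
  sSup {n : ℕ∞ | ∃ (V : Type v) (_ : AddCommGroup V) (_ : Module Bᵐᵒᵖ V)
    (_ : Module.Finite Bᵐᵒᵖ V) (h : EpsHermitianForm γ ε V),
    h.Anisotropic ∧ Module.length Bᵐᵒᵖ V = n}

/-- For a separable quadratic field extension `K/F` and a `K`-algebra `B` with centre `K`: the
involution `γ` of `B` is `K/F`-unitary, i.e. `F = {x ∈ K | γ(x) = x}`. -/
def IsUnitaryInvo (F : Type u) (K : Type v) [Field F] [Field K] [Algebra F K]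
    {B : Type w} [Ring B] [Algebra K B] (γ : RingInvo B) : Prop :=
  ∀ x : K, (γ (algebraMap K B x)).unop = algebraMap K B x ↔ x ∈ Set.range (algebraMap F K)

/-- The `F`-unitary `u`-invariant `u(B/F)` of a central simple `K`-algebra `B`. The number
`u(B, γ, 1)` is the same for all `K/F`-unitary involutions `γ` of `B`, and the supremum over `γ` is
this common value; it is `0` (the supremum of the empty family) if `B` has no such involution. -/
noncomputable def unitaryUInv (F : Type u) (K : Type v) [Field F] [Field K] [Algebra F K]
    (B : Type w) [Ring B] [Algebra K B] : ℕ∞ :=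
  ⨆ (γ : RingInvo B) (_ : IsUnitaryInvo F K γ), hermitianUInv γ 1

/-- Wedderburn: every Brauer class contains a central division algebra. -/
theorem BrauerGroup.exists_division {K : Type u} [Field K] (α : BrauerGroup.{u, v} K) :
    ∃ D : CSA.{u, v} K, (∀ x : D, x ≠ 0 → IsUnit x) ∧ Quotient.mk (Brauer.CSA_Setoid K) D = α := by
  induction α using Quotient.inductionOn with
  | h A =>
    have : IsArtinianRing A := IsArtinianRing.of_finite K A
    obtain ⟨n, hn, D, _, _, _, ⟨e⟩⟩ := IsSimpleRing.exists_algEquiv_matrix_divisionRing_finite K A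
    have hM : Algebra.IsCentral K (Matrix (Fin n) (Fin n) D) := Algebra.IsCentral.of_algEquiv K A _ e
    have hD : Algebra.IsCentral K D := by
      refine ⟨fun x hx => ?_⟩
      have hx' : Matrix.scalar (Fin n) x ∈ Subalgebra.center K (Matrix (Fin n) (Fin n) D) := by
        rw [Matrix.subalgebraCenter_eq_scalarAlgHom_map]
        exact ⟨x, hx, rfl⟩
      obtain ⟨k, hk⟩ := hM.1 hx'
      refine ⟨k, ?_⟩
      have := congrFun (congrFun hk 0) 0
      simpa [Algebra.ofId, Matrix.algebraMap_matrix_apply] using this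
    refine ⟨{ AlgCat.of K D with }, fun x hx => ?_, ?_⟩
    · exact IsUnit.mk0 (G₀ := D) x hx
    · refine Quotient.sound ⟨n, 1, hn.out, one_ne_zero, ⟨?_⟩⟩
      exact (e.mapMatrix (m := Fin 1) |>.trans <| Matrix.compAlgEquiv _ _ _ _ |>.trans <|
        Matrix.reindexAlgEquiv K D (Equiv.uniqueProd (Fin n) (Fin 1))).symm

/-- The central division algebra `D` (unique up to isomorphism) with `[D] = α`. -/
noncomputable def BrauerGroup.divisionAlgebra {K : Type u} [Field K] (α : BrauerGroup.{u, v} K) :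
    CSA.{u, v} K :=
  α.exists_division.choose

/-- The index of a Brauer class: the degree of its division algebra `D`, i.e. the `n` with
`dim_K D = n²`. -/
noncomputable def BrauerGroup.ind {K : Type u} [Field K] (α : BrauerGroup.{u, v} K) : ℕ :=
  Nat.sqrt (Module.finrank K α.divisionAlgebra)

/-- The `F`-unitary `u`-invariant `u(α/F)` of a Brauer class `α ∈ Br(K)`: it is `u(D/F)` for the
central division algebra `D` with `[D] = α`. -/
noncomputable def BrauerGroup.unitaryUInv (F : Type u) [Field F] {K : Type v} [Field K]
    [Algebra F K] (α : BrauerGroup.{v, w} K) : ℕ∞ :=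
  _root_.unitaryUInv F K α.divisionAlgebra

/-! Let `n = u(F)` be finite, `D` of degree `d` with unitary involution `σ`, and `h` an anisotropic
hermitian form on `V`. For `d = 1, 2, 3, 4` the dimension of `V` is at most `n/2`, `7n/8`, `n`,
`63n/32`; the last bound is the largest.

Two tools are used throughout. Leep's bound on systems of quadratic forms
(`QuadraticUBound.exists_common_zero`) gives `u(L) ≤ ([L:F]+1)/2 · u(F)` for finite `L/F`
(`QuadraticUBound.extension`). And if a property of vectors can always be found beyond dimension
`N`, and survives adding a multiple of `x` on a subspace of codimension at most `c`, then it holds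
on a whole subspace of dimension `k + 1` once the dimension exceeds `N + (c+1)k`
(`exists_submodule_forall_isotropic`).

Degree 4. After scaling `h` there is a symmetric noncentral `s`, quadratic over `F`
(`IsUnitaryInvolution.exists_quadratic_symm`). Let `C` be its centralizer and `j` a skew element
with `j s = (τ - s) j`. Then `[s, h] j⁻¹` is a hermitian form over `C` for the involution `x ↦ j
σ(x) j⁻¹`, and it vanishes where `h` takes values in `C`. For either involution, `C` is a quaternion
algebra with unitary involution over a quadratic extension of `F`, so by the degree 2 case
anisotropic forms over it have dimension at most `7/8 · 3n/2 = 21n/16`. Hence vectors with `h x x ∈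
C` exist beyond dimension `21n/16`, a `C`-subspace of them has dimension at most `21n/16` because
`h` is anisotropic, and each of its dimensions costs two. So `2 dim_D V = dim_C V ≤ 3 · 21n/16`.

Degree 2 has the same shape, in two stages. Now `C` is commutative and `[s, h] j⁻¹` yields a
quadratic form over a quadratic extension `L` of `F`; its zeros have `h x x ∈ F + F s`, and one more
form over `F` makes `h x x ∈ F`. Such vectors are accumulated into a subspace over the quaternion
`F`-algebra `L + L j`, where `h x x` is a quadratic form over `F`.

Degree 3 uses a cubic symmetric `θ` and a map `T` from `D` to its centralizer. A subspace on which
`T ∘ h` vanishes embeds as a totally isotropic subspace of a hermitian form on `V³`, which bounds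
its dimension by `dim V`. -/

open Module

/-! ### Building subspaces of isotropic vectors over division rings -/

section LinearAlgebra

variable {E : Type*} {V : Type*} [DivisionRing E] [AddCommGroup V] [Module E V]
  [FiniteDimensional E V]

theorem Submodule.finrank_le_finrank_inf_add_finrank_quotient (A B : Submodule E V) :
    finrank E A ≤ finrank E (A ⊓ B : Submodule E V) + finrank E (V ⧸ B) := by
  have h1 := Submodule.finrank_sup_add_finrank_inf_eq A B
  have h2 := B.finrank_quotient_add_finrank
  have h3 := Submodule.finrank_le (A ⊔ B)
  omega

/-- If every subspace of dimension `> N` has a nonzero vector satisfying `I`, and each such vector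
has an "orthogonal complement" of codimension at most `c`, then spaces of dimension
`> N + (c + 1) k` contain a `(k + 1)`-dimensional subspace all of whose vectors satisfy `I`. -/
theorem exists_submodule_forall_isotropic (I : V → Prop) (hI0 : I 0) (c N : ℕ)
    (hN : ∀ U : Submodule E V, N < finrank E U → ∃ x ∈ U, x ≠ 0 ∧ I x)
    (H : ∀ x, I x → ∃ S : Submodule E V, x ∈ S ∧ finrank E (V ⧸ S) ≤ c ∧
      ∀ y ∈ S, I y → ∀ a : E, I (a • x + y)) (k : ℕ) :
    ∀ U : Submodule E V, N + (c + 1) * k < finrank E U →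
      ∃ W ≤ U, finrank E W = k + 1 ∧ ∀ x ∈ W, I x := by
  induction k with
  | zero =>
    intro U hU
    obtain ⟨x, hxU, hx0, hx⟩ := hN U (by omega)
    obtain ⟨S, hxS, -, hS⟩ := H x hx
    refine ⟨Submodule.span E {x}, by simpa using hxU, finrank_span_singleton hx0, ?_⟩
    intro y hy
    obtain ⟨a, rfl⟩ := Submodule.mem_span_singleton.1 hy
    simpa using hS 0 S.zero_mem hI0 a
  | succ k ih =>
    intro U hU
    obtain ⟨x, hxU, hx0, hx⟩ := hN U (by nlinarith)
    obtain ⟨S, hxS, hSc, hS⟩ := H x hx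
    -- The induction continues inside `U ⊓ S ⊓ q`. The complement `q` keeps the new subspace
    -- independent of `x`; passing to `S` costs at most `c` dimensions and passing to `q` one,
    -- whence the factor `c + 1`.
    obtain ⟨q, hq⟩ := (Submodule.span E {x}).exists_isCompl
    have h1 := Submodule.finrank_le_finrank_inf_add_finrank_quotient U S
    have h2 := Submodule.finrank_le_finrank_inf_add_finrank_quotient (U ⊓ S) q
    have h3 : finrank E (V ⧸ q) = 1 := by
      rw [(Submodule.quotientEquivOfIsCompl q _ hq.symm).finrank_eq, finrank_span_singleton hx0]
    obtain ⟨W, hWU, hWk, hW⟩ := ih (U ⊓ S ⊓ q) (by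
      have : (c + 1) * (k + 1) = (c + 1) * k + c + 1 := by ring
      omega)
    refine ⟨Submodule.span E {x} ⊔ W, ?_, ?_, ?_⟩
    · exact sup_le (by simpa using hxU) (hWU.trans (inf_le_left.trans inf_le_left))
    · have hd : Submodule.span E {x} ⊓ W = ⊥ :=
        (hq.disjoint.mono_right (hWU.trans inf_le_right)).eq_bot
      have := Submodule.finrank_sup_add_finrank_inf_eq (Submodule.span E {x}) W
      rw [hd, finrank_bot, finrank_span_singleton hx0, hWk] at this
      omega
    · intro y hy
      obtain ⟨y1, hy1, y2, hy2, rfl⟩ := Submodule.mem_sup.1 hy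
      obtain ⟨a, rfl⟩ := Submodule.mem_span_singleton.1 hy1
      exact hS y2 (hWU hy2).1.2 (hW y2 hy2) a

omit [FiniteDimensional E V] in
theorem finrank_quotient_comap_le {A : Type*} [AddCommGroup A] [Module E A] [FiniteDimensional E A]
    (f : V →ₗ[E] A) (B : Submodule E A) :
    finrank E (V ⧸ B.comap f) ≤ finrank E (A ⧸ B) := by
  refine LinearMap.finrank_le_finrank_of_injective (f := Submodule.mapQ (B.comap f) B f le_rfl) ?_
  rw [← LinearMap.ker_eq_bot, Submodule.ker_mapQ, Submodule.mkQ_map_self]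

omit [FiniteDimensional E V] in
theorem finrank_quotient_ker_le {A : Type*} [AddCommGroup A] [Module E A] [FiniteDimensional E A]
    (f : V →ₗ[E] A) : finrank E (V ⧸ LinearMap.ker f) ≤ finrank E A := by
  rw [f.quotKerEquivRange.finrank_eq]
  exact Submodule.finrank_le _

end LinearAlgebra

/-! ### Isotropy bounds for quadratic forms: systems and finite extensions -/

section QuadraticForms

/-- Every quadratic form over `F` of dimension greater than `n` is isotropic. -/
def QuadraticUBound (F : Type*) [Field F] (n : ℕ) : Prop :=
  ∀ k, n < k → ∀ q : QuadraticForm F (Fin k → F), ∃ x, x ≠ 0 ∧ q x = 0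

variable {F : Type*} [Field F] {n : ℕ}

theorem QuadraticUBound.exists_isotropic (hn : QuadraticUBound F n) {V : Type*} [AddCommGroup V]
    [Module F V] [FiniteDimensional F V] (q : QuadraticForm F V) (hV : n < finrank F V) :
    ∃ x, x ≠ 0 ∧ q x = 0 := by
  let e := (finBasis F V).equivFun
  obtain ⟨x, hx, hq⟩ := hn _ hV (q.comp (e.symm : (Fin (finrank F V) → F) →ₗ[F] V))
  exact ⟨e.symm x, by simpa using hx, by simpa using hq⟩

theorem QuadraticUBound.exists_isotropic_mem (hn : QuadraticUBound F n) {V : Type*}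
    [AddCommGroup V] [Module F V] [FiniteDimensional F V] (q : QuadraticForm F V)
    (U : Submodule F V) (hV : n < finrank F U) : ∃ x ∈ U, x ≠ 0 ∧ q x = 0 := by
  obtain ⟨x, hx, hq⟩ := hn.exists_isotropic (q.comp U.subtype) hV
  exact ⟨x, x.2, by simpa using hx, hq⟩

theorem QuadraticUBound.of_fieldUInv {F : Type u} [Field F] {n : ℕ} (h : fieldUInv F ≤ n) :
    QuadraticUBound F n := by
  intro k hk q
  by_contra! hq
  have : (k : ℕ∞) ≤ fieldUInv F := by
    refine le_sSup ⟨Fin k → F, inferInstance, inferInstance, inferInstance, q, ?_, by simp⟩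
    intro x hx
    by_contra h0
    exact hq x h0 hx
  have := this.trans h
  norm_cast at this
  omega

theorem QuadraticMap.map_smul_add_eq_zero {V : Type*} [AddCommGroup V] [Module F V]
    (q : QuadraticForm F V) {x y : V} (hx : q x = 0) (hy : q y = 0)
    (h : QuadraticMap.polar q x y = 0) (a : F) : q (a • x + y) = 0 := by
  have h1 : QuadraticMap.polar q (a • x) y = 0 := by rw [QuadraticMap.polar_smul_left, h, smul_zero]
  rw [QuadraticMap.polar, QuadraticMap.map_smul, hx, hy] at h1
  simpa using h1

theorem QuadraticMap.polar_self_eq_zero {V : Type*} [AddCommGroup V] [Module F V]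
    (q : QuadraticForm F V) {x : V} (hx : q x = 0) : QuadraticMap.polar q x x = 0 := by
  rw [QuadraticMap.polar_self, hx, smul_zero]

/-- Leep's bound for systems of quadratic forms. -/
theorem QuadraticUBound.exists_common_zero (hn : QuadraticUBound F n) (r : ℕ) :
    ∀ {V : Type v} [AddCommGroup V] [Module F V] [FiniteDimensional F V]
      (q : Fin r → QuadraticForm F V), r * (r + 1) * n < 2 * finrank F V →
      ∃ x, x ≠ 0 ∧ ∀ i, q i x = 0 := by
  induction r with
  | zero =>
    intro V _ _ _ q hV
    have : 0 < finrank F V := by simpa using hV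
    have := finrank_pos_iff_exists_ne_zero.1 this
    obtain ⟨x, hx⟩ := this
    exact ⟨x, hx, fun i => i.elim0⟩
  | succ r ih =>
    intro V _ _ _ q hV
    have hdiv : 2 * (r * (r + 1) * n / 2) = r * (r + 1) * n :=
      Nat.mul_div_cancel' ((Nat.even_mul_succ_self r).two_dvd.mul_right n)
    -- The first `r` forms vanish together on a subspace of dimension `n + 1`, where the last form
    -- must be isotropic. The cost is `r(r+1)n/2` for a first common zero and `r + 1` for each of
    -- `n` further dimensions, in total `(r+1)(r+2)n/2`.
    have key := exists_submodule_forall_isotropic (E := F) (V := V)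
      (fun x => ∀ i : Fin r, q i.castSucc x = 0) (by simp) r (r * (r + 1) * n / 2) ?_ ?_ n ⊤ ?_
    · obtain ⟨W, -, hWk, hW⟩ := key
      obtain ⟨x, hxW, hx0, hx⟩ := hn.exists_isotropic_mem (q (Fin.last r)) W (by omega)
      exact ⟨x, hx0, Fin.lastCases hx (hW x hxW)⟩
    · intro U hU
      obtain ⟨x, hx, hq⟩ := ih (V := U) (fun i => (q i.castSucc).comp U.subtype) (by omega)
      exact ⟨x, x.2, by simpa using hx, hq⟩
    · intro x hx
      let f : V →ₗ[F] (Fin r → F) := LinearMap.pi fun i => (q i.castSucc).polarBilin x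
      refine ⟨LinearMap.ker f, ?_, (finrank_quotient_ker_le f).trans (by simp), ?_⟩
      · rw [LinearMap.mem_ker]
        ext i
        exact QuadraticMap.polar_self_eq_zero _ (hx i)
      · intro y hy hy' a i
        exact QuadraticMap.map_smul_add_eq_zero _ (hx i) (hy' i) (congrFun hy i) a
    · rw [finrank_top]
      have : (r + 1) * (r + 1 + 1) * n = r * (r + 1) * n + 2 * ((r + 1) * n) := by ring
      omega

/-- Coordinates in an `F`-basis of `L` turn a form over `L` in `k` variables into `[L:F]` forms over
`F` in `k [L:F]` variables, to which Leep's bound applies. The condition on `n'` allows `n' =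
⌊([L:F]+1)n/2⌋`. -/
theorem QuadraticUBound.extension (hn : QuadraticUBound F n) {L : Type*} [Field L] [Algebra F L]
    [FiniteDimensional F L] {n' : ℕ} (h : (finrank F L + 1) * n < 2 * (n' + 1)) :
    QuadraticUBound L n' := by
  intro k hk q
  have b := finBasis F L
  have hfin : finrank F (Fin k → L) = k * finrank F L := by
    rw [← finrank_mul_finrank F L, finrank_fin_fun, mul_comm]
  obtain ⟨x, hx, hq⟩ := hn.exists_common_zero (finrank F L) (V := Fin k → L)
    (fun i => (b.coord i).compQuadraticMap (q.restrictScalars (S := F))) (by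
      rw [hfin]
      have : 0 < finrank F L := finrank_pos
      nlinarith)
  refine ⟨x, hx, b.ext_elem fun i => ?_⟩
  simpa using hq i

end QuadraticForms

/-! ### Subalgebras and minimal polynomials in division algebras -/

section DivisionAlgebra

variable {F D : Type*} [Field F] [DivisionRing D] [Algebra F D] [FiniteDimensional F D]

/-- Subalgebras of finite-dimensional division algebras are division rings. -/
noncomputable abbrev Subalgebra.divisionRing (S : Subalgebra F D) : DivisionRing S :=
  DivisionRing.ofIsUnitOrEqZero fun x => by
    by_cases hx : x = 0
    · exact Or.inr hx
    · left
      have hinj : Function.Injective (LinearMap.mulLeft F x) := by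
        rw [injective_iff_map_eq_zero]
        intro y hy
        exact (mul_eq_zero.1 hy).resolve_left hx
      obtain ⟨y, hy⟩ := LinearMap.surjective_of_injective hinj 1
      have hxy : x * y = 1 := hy
      have hyx : y * x = 1 := by
        have h1 : x * (y * x - 1) = 0 := by rw [mul_sub, ← mul_assoc, hxy, one_mul, mul_one, sub_self]
        exact sub_eq_zero.1 ((mul_eq_zero.1 h1).resolve_left hx)
      exact ⟨⟨x, y, hxy, hyx⟩, rfl⟩

/-- Commutative subalgebras of finite-dimensional division algebras are fields. -/
noncomputable abbrev Subalgebra.fieldOfComm (S : Subalgebra F D) (h : ∀ x y : S, x * y = y * x) :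
    Field S :=
  { S.divisionRing with mul_comm := h }

omit [FiniteDimensional F D] in
theorem Algebra.adjoin_singleton_comm (x : D) (y z : Algebra.adjoin F {x}) : y * z = z * y := by
  obtain ⟨y, hy⟩ := y
  obtain ⟨z, hz⟩ := z
  rw [Algebra.adjoin_singleton_eq_range_aeval] at hy hz
  obtain ⟨p, rfl⟩ := hy
  obtain ⟨q, rfl⟩ := hz
  apply Subtype.ext
  change Polynomial.aeval x p * Polynomial.aeval x q = Polynomial.aeval x q * Polynomial.aeval x p
  rw [← map_mul, ← map_mul, mul_comm]

variable (F) in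
theorem toSubmodule_adjoin_singleton (x : D) :
    Subalgebra.toSubmodule (Algebra.adjoin F {x}) =
      Submodule.span F (Set.range fun i : Fin (minpoly F x).natDegree => x ^ (i : ℕ)) := by
  have hx : IsIntegral F x := Algebra.IsIntegral.isIntegral x
  apply le_antisymm
  · intro y hy
    rw [Subalgebra.mem_toSubmodule, Algebra.adjoin_singleton_eq_range_aeval] at hy
    obtain ⟨p, rfl⟩ := hy
    change Polynomial.aeval x p ∈ _
    rw [← Polynomial.aeval_modByMonic_eq_self_of_root (minpoly.aeval F x),
      Polynomial.aeval_eq_sum_range' (Polynomial.natDegree_modByMonic_lt p (minpoly.monic hx)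
        (minpoly.ne_one F x))]
    refine Submodule.sum_mem _ fun i hi => Submodule.smul_mem _ _ (Submodule.subset_span ?_)
    exact ⟨⟨i, Finset.mem_range.1 hi⟩, rfl⟩
  · rw [Submodule.span_le]
    rintro _ ⟨i, rfl⟩
    exact pow_mem (Algebra.self_mem_adjoin_singleton F x) _

variable (F) in
theorem finrank_adjoin_singleton (x : D) :
    finrank F (Algebra.adjoin F {x}) = (minpoly F x).natDegree := by
  have h := finrank_span_eq_card (R := F) (linearIndependent_pow (K := F) x)
  rw [← toSubmodule_adjoin_singleton, Fintype.card_fin] at h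
  exact h

theorem Subalgebra.finrank_dvd (S : Subalgebra F D) : finrank F S ∣ finrank F D := by
  let := S.divisionRing
  exact ⟨_, (finrank_mul_finrank F S D).symm⟩

variable (F) in
theorem exists_pow_eq_sum (x : D) : ∃ a : Fin (minpoly F x).natDegree → F,
    x ^ (minpoly F x).natDegree = ∑ i, a i • x ^ (i : ℕ) := by
  have : x ^ (minpoly F x).natDegree ∈ Subalgebra.toSubmodule (Algebra.adjoin F {x}) :=
    pow_mem (Algebra.self_mem_adjoin_singleton F x) _
  rw [toSubmodule_adjoin_singleton] at this
  obtain ⟨c, hc⟩ := (Submodule.mem_span_range_iff_exists_fun F).1 this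
  exact ⟨c, hc.symm⟩

omit [FiniteDimensional F D] in
theorem algebraMap_mem_center (a : F) : algebraMap F D a ∈ Subring.center D :=
  Subring.mem_center_iff.2 fun g => (Algebra.commutes a g).symm

variable (F) in
theorem mem_range_algebraMap_of_natDegree_minpoly_eq_one {x : D}
    (h : (minpoly F x).natDegree = 1) : x ∈ Set.range (algebraMap F D) := by
  have h1 := toSubmodule_adjoin_singleton F x
  rw [h] at h1
  have h2 : x ∈ Subalgebra.toSubmodule (Algebra.adjoin F {x}) :=
    Algebra.self_mem_adjoin_singleton F x
  rw [h1] at h2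
  obtain ⟨c, hc⟩ := (Submodule.mem_span_range_iff_exists_fun F).1 h2
  refine ⟨c 0, ?_⟩
  simpa [Algebra.smul_def] using hc

theorem eq_top_of_finrank_center_eq_one (h : finrank (Subring.center D) D = 1) :
    Subring.center D = ⊤ := by
  refine eq_top_iff.2 fun x _ => ?_
  obtain ⟨a, ha⟩ := (finrank_eq_one_iff_of_nonzero' (1 : D) one_ne_zero).1 h x
  rw [← ha, Algebra.smul_def, mul_one]
  exact a.2

/-- An element of a noncommutative division algebra does not generate it over the centre. -/
theorem natDegree_minpoly_ne_finrank (x : D) [FiniteDimensional (Subring.center D) D]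
    (h : finrank (Subring.center D) D ≠ 1) :
    (minpoly (Subring.center D) x).natDegree ≠ finrank (Subring.center D) D := by
  intro h1
  rw [← finrank_adjoin_singleton] at h1
  have h2 := Submodule.eq_top_of_finrank_eq
    (S := Subalgebra.toSubmodule (Algebra.adjoin (Subring.center D) {x})) h1
  have hmem : ∀ y, y ∈ Algebra.adjoin (Subring.center D) {x} := fun y => by
    rw [← Subalgebra.mem_toSubmodule, h2]; trivial
  apply h
  have h3 : Function.Surjective (Algebra.linearMap (Subring.center D) D) := fun y =>
    ⟨⟨y, Subring.mem_center_iff.2 fun g =>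
      congrArg Subtype.val (Algebra.adjoin_singleton_comm x ⟨g, hmem g⟩ ⟨y, hmem y⟩)⟩, rfl⟩
  have h4 := (LinearEquiv.ofBijective _
    ⟨(algebraMap (Subring.center D) D).injective, h3⟩).finrank_eq
  rw [← h4, finrank_self]

theorem natDegree_minpoly_dvd (x : D) : (minpoly F x).natDegree ∣ finrank F D := by
  rw [← finrank_adjoin_singleton]
  exact Subalgebra.finrank_dvd _

instance Subring.center.isCentral : Algebra.IsCentral (Subring.center D) D where
  out x hx := by
    have hx' : x ∈ Subring.center D := Subring.mem_center_iff.2 fun g => by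
      rw [Subalgebra.mem_center_iff] at hx
      exact hx g
    exact ⟨⟨x, hx'⟩, rfl⟩

end DivisionAlgebra

theorem inv_mem_center {D : Type*} [DivisionRing D] {z : D} (hz : z ∈ Subring.center D) :
    z⁻¹ ∈ Subring.center D := by
  rw [Subring.mem_center_iff] at hz ⊢
  exact fun g => (Commute.inv_right₀ (show Commute _ _ from hz g)).eq

theorem center_ne_top_of_finrank_ne_one {D : Type*} [DivisionRing D]
    (h1 : finrank (Subring.center D) D ≠ 1) :
    Subring.center D ≠ ⊤ := by
  intro h
  have h2 : Function.Surjective (Algebra.linearMap (Subring.center D) D) := fun y =>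
    ⟨⟨y, h ▸ Subring.mem_top y⟩, rfl⟩
  have h3 := (LinearEquiv.ofBijective _
    ⟨(algebraMap (Subring.center D) D).injective, h2⟩).finrank_eq
  rw [finrank_self] at h3
  exact h1 h3.symm

/-! ### Unitary involutions; the centre plays the role of `K` -/

/-- A map `σ` on an `F`-division algebra `D` is a unitary involution with `F` as its field of
central symmetric elements. -/
structure IsUnitaryInvolution (F : Type*) {D : Type*} [Field F] [DivisionRing D] [Algebra F D]
    (σ : D → D) : Prop where
  map_add : ∀ x y, σ (x + y) = σ x + σ y
  map_mul : ∀ x y, σ (x * y) = σ y * σ x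
  invol : ∀ x, σ (σ x) = x
  map_algebraMap : ∀ a : F, σ (algebraMap F D a) = algebraMap F D a
  mem_range : ∀ x ∈ Subring.center D, σ x = x → x ∈ Set.range (algebraMap F D)
  exists_ne : ∃ t ∈ Subring.center D, σ t ≠ t

namespace IsUnitaryInvolution

variable {F D : Type*} [Field F] [DivisionRing D] [Algebra F D] {σ : D → D}
  (hσ : IsUnitaryInvolution F σ)
include hσ

theorem map_zero : σ 0 = 0 := by simpa using hσ.map_add 0 0

theorem map_one : σ 1 = 1 := by simpa using hσ.map_algebraMap 1

theorem map_neg (x : D) : σ (-x) = -σ x := by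
  have := hσ.map_add x (-x)
  rw [add_neg_cancel, hσ.map_zero] at this
  exact (neg_eq_of_add_eq_zero_right this.symm).symm

theorem map_sub (x y : D) : σ (x - y) = σ x - σ y := by
  rw [sub_eq_add_neg, hσ.map_add, hσ.map_neg, sub_eq_add_neg]

theorem map_smul (a : F) (x : D) : σ (a • x) = a • σ x := by
  rw [Algebra.smul_def, hσ.map_mul, hσ.map_algebraMap, ← Algebra.commutes, Algebra.smul_def]

theorem map_inv (x : D) : σ x⁻¹ = (σ x)⁻¹ := by
  by_cases hx : x = 0
  · simp [hx, hσ.map_zero]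
  · refine eq_inv_of_mul_eq_one_left ?_
    rw [← hσ.map_mul, mul_inv_cancel₀ hx, hσ.map_one]

theorem map_pow (x : D) (n : ℕ) : σ (x ^ n) = σ x ^ n := by
  induction n with
  | zero => simpa using hσ.map_one
  | succ n ih => rw [pow_succ, hσ.map_mul, ih, pow_succ']

theorem map_mem_center {x : D} (hx : x ∈ Subring.center D) : σ x ∈ Subring.center D := by
  rw [Subring.mem_center_iff] at hx ⊢
  intro g
  have := congrArg σ (hx (σ g))
  rw [hσ.map_mul, hσ.map_mul, hσ.invol] at this
  exact this.symm

/-- Divide `t` by its trace `t + σ t`. If the trace is zero, use `t + 1`, which has trace `2`; and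
`2 = 0` would give `σ t = -t = t`. This produces a generator of the centre of trace one in every
characteristic. -/
theorem exists_normalized : ∃ t ∈ Subring.center D, σ t = 1 - t ∧ σ t ≠ t := by
  obtain ⟨t, ht, hne⟩ := hσ.exists_ne
  have key : ∀ t ∈ Subring.center D, σ t ≠ t → t + σ t ≠ 0 →
      ∃ t ∈ Subring.center D, σ t = 1 - t ∧ σ t ≠ t := by
    intro t ht hne h0
    obtain ⟨a, ha⟩ := hσ.mem_range (t + σ t) (add_mem ht (hσ.map_mem_center ht)) (by
      rw [hσ.map_add, hσ.invol, add_comm])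
    have ha0 : a ≠ 0 := by
      rintro rfl
      exact h0 (by rw [← ha, _root_.map_zero])
    refine ⟨a⁻¹ • t, ?_, ?_, ?_⟩
    · rw [Algebra.smul_def]
      exact mul_mem (algebraMap_mem_center _) ht
    · rw [hσ.map_smul, eq_sub_iff_add_eq, ← smul_add, add_comm, ← ha, Algebra.smul_def,
        ← _root_.map_mul, inv_mul_cancel₀ ha0, _root_.map_one]
    · rw [hσ.map_smul]
      intro h
      exact hne (smul_right_injective D (inv_ne_zero ha0) h)
  by_cases h0 : t + σ t = 0
  · refine key (t + 1) (add_mem ht (one_mem _)) ?_ ?_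
    · rw [hσ.map_add, hσ.map_one]
      simpa using hne
    · rw [hσ.map_add, hσ.map_one]
      intro h2
      have h3 : (2 : D) = 0 := by
        rw [← h2, ← one_add_one_eq_two]
        have : t + 1 + (σ t + 1) = (t + σ t) + (1 + 1) := by abel
        rw [this, h0, zero_add]
      have h4 : σ t = -t := (neg_eq_of_add_eq_zero_right h0).symm
      refine hne ?_
      have h5 : t + t = 0 := by rw [← two_mul, h3, zero_mul]
      rw [h4, neg_eq_of_add_eq_zero_right h5]
  · exact key t ht hne h0

/-- Elements `a + b t` with `a, b` symmetric. -/
theorem exists_eq_add_mul {t : D} (ht : t ∈ Subring.center D) (hne : σ t ≠ t) (x : D) :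
    ∃ a b, σ a = a ∧ σ b = b ∧ x = a + t * b := by
  have hδ : t - σ t ≠ 0 := sub_ne_zero.2 fun h => hne h.symm
  have hδc : t - σ t ∈ Subring.center D := sub_mem ht (hσ.map_mem_center ht)
  have hδ' : σ (t - σ t) = -(t - σ t) := by rw [hσ.map_sub, hσ.invol, neg_sub]
  have hc := fun g => (Subring.mem_center_iff.1 hδc g)
  have htc := fun g => (Subring.mem_center_iff.1 ht g)
  -- Applying `σ` to `x = a + t b` and subtracting gives `x - σ x = (t - σ t) b`, which dictates
  -- `b`.
  have hb : σ ((t - σ t)⁻¹ * (x - σ x)) = (t - σ t)⁻¹ * (x - σ x) := by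
    rw [hσ.map_mul, hσ.map_inv, hδ', hσ.map_sub, hσ.invol, inv_neg, mul_neg, ← neg_mul, neg_sub]
    exact (Commute.inv_right₀ (show Commute _ _ from hc _)).eq
  have h1 : (t - σ t) * ((t - σ t)⁻¹ * (x - σ x)) = x - σ x := by
    rw [← mul_assoc, mul_inv_cancel₀ hδ, one_mul]
  generalize (t - σ t)⁻¹ * (x - σ x) = b at hb h1
  refine ⟨x - t * b, b, ?_, hb, by abel⟩
  rw [hσ.map_sub, hσ.map_mul, hb, Subring.mem_center_iff.1 (hσ.map_mem_center ht) b]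
  rw [sub_mul] at h1
  rw [sub_eq_sub_iff_sub_eq_sub, ← neg_sub x, ← h1]
  abel

/-- Applying `σ` to the relation conjugates its coefficients and fixes the powers of `x`; by
independence the coefficients are fixed by `σ`. -/
theorem mem_range_of_pow_eq_sum {r : ℕ} {x : D} (hx : σ x = x)
    (hli : LinearIndependent (Subring.center D) fun i : Fin r => x ^ (i : ℕ))
    (a : Fin r → Subring.center D) (h : x ^ r = ∑ i, a i • x ^ (i : ℕ)) (i : Fin r) :
    (a i : D) ∈ Set.range (algebraMap F D) := by
  let b : Fin r → Subring.center D := fun i => ⟨σ (a i), hσ.map_mem_center (a i).2⟩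
  let f : D →+ D := ⟨⟨σ, hσ.map_zero⟩, hσ.map_add⟩
  have h2 : x ^ r = ∑ i, b i • x ^ (i : ℕ) := by
    have h3 : f (x ^ r) = x ^ r := by
      change σ _ = _
      rw [hσ.map_pow, hx]
    rw [← h3, h, _root_.map_sum]
    refine Finset.sum_congr rfl fun j _ => ?_
    change σ ((a j : D) * x ^ (j : ℕ)) = σ (a j) * x ^ (j : ℕ)
    rw [hσ.map_mul, hσ.map_pow, hx, Subring.mem_center_iff.1 (hσ.map_mem_center (a j).2)]
  have h4 : ∑ i, (a i - b i) • x ^ (i : ℕ) = 0 := by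
    simp only [sub_smul, Finset.sum_sub_distrib, ← h, ← h2, sub_self]
  have h5 := Fintype.linearIndependent_iff.1 hli _ h4 i
  have h6 : (a i : D) = σ (a i) := congrArg Subtype.val (sub_eq_zero.1 h5)
  exact hσ.mem_range _ (a i).2 h6.symm

/-- The centre is `F ⊕ F t` for any central `t` with `σ t ≠ t`. -/
theorem finrank_eq_two_mul [FiniteDimensional F D] :
    finrank F D = 2 * finrank (Subring.center D) D := by
  let i : F →+* Subring.center D :=
    (algebraMap F D).codRestrict (Subring.center D) algebraMap_mem_center
  let _ : Algebra F (Subring.center D) := i.toAlgebra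
  have : IsScalarTower F (Subring.center D) D := IsScalarTower.of_algebraMap_eq fun _ => rfl
  rw [← finrank_mul_finrank F (Subring.center D) D]
  congr 1
  obtain ⟨t, ht, hne⟩ := hσ.exists_ne
  let f : F × F →ₗ[F] Subring.center D :=
    (LinearMap.fst F F F).smulRight 1 + (LinearMap.snd F F F).smulRight ⟨t, ht⟩
  have hf : ∀ p, (f p : D) = algebraMap F D p.1 + algebraMap F D p.2 * t := by
    intro p
    change algebraMap F D p.1 * 1 + algebraMap F D p.2 * t = _
    rw [mul_one]
  have hb : Function.Bijective f := by
    constructor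
    · rw [injective_iff_map_eq_zero]
      rintro ⟨a, b⟩ hp
      have h1 : algebraMap F D a + algebraMap F D b * t = 0 := by
        rw [← hf (a, b), hp]; rfl
      have hb : b = 0 := by
        by_contra hb0
        have hb1 : algebraMap F D b ≠ 0 := by simpa using hb0
        apply hne
        have h2 : t = algebraMap F D (-(b⁻¹ * a)) := by
          rw [_root_.map_neg, _root_.map_mul, map_inv₀, eq_neg_iff_add_eq_zero]
          have := congrArg (fun z => (algebraMap F D b)⁻¹ * z) h1
          simp only [mul_add, mul_zero] at this
          rw [← mul_assoc, inv_mul_cancel₀ hb1, one_mul, add_comm] at this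
          exact this
        rw [h2, hσ.map_algebraMap]
      subst hb
      simpa using h1
    · intro z
      obtain ⟨a, b, ha, hb, hz⟩ := hσ.exists_eq_add_mul ht hne (z : D)
      have hδ : t - σ t ≠ 0 := sub_ne_zero.2 fun h => hne h.symm
      have hδc : t - σ t ∈ Subring.center D := sub_mem ht (hσ.map_mem_center ht)
      have hb' : b = (t - σ t)⁻¹ * ((z : D) - σ z) := by
        rw [eq_inv_mul_iff_mul_eq₀ hδ, hz, hσ.map_add, hσ.map_mul, ha, hb, sub_mul,
          Subring.mem_center_iff.1 (hσ.map_mem_center ht) b]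
        abel
      have hbc : b ∈ Subring.center D := by
        rw [hb']
        refine mul_mem ?_ (sub_mem z.2 (hσ.map_mem_center z.2))
        rw [Subring.mem_center_iff] at hδc ⊢
        exact fun g => (Commute.inv_right₀ (show Commute _ _ from hδc g)).eq
      have hac : a ∈ Subring.center D := by
        have : a = z - t * b := by rw [hz]; abel
        rw [this]
        exact sub_mem z.2 (mul_mem ht hbc)
      obtain ⟨a, rfl⟩ := hσ.mem_range a hac ha
      obtain ⟨b, rfl⟩ := hσ.mem_range b hbc hb
      refine ⟨(a, b), Subtype.ext ?_⟩
      rw [hf, hz, Algebra.commutes]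
  have := (LinearEquiv.ofBijective f hb).finrank_eq
  rw [← this, finrank_prod, finrank_self]

theorem finiteDimensional_center [FiniteDimensional F D] :
    FiniteDimensional (Subring.center D) D := by
  refine FiniteDimensional.of_finrank_pos ?_
  have h1 := hσ.finrank_eq_two_mul
  have h2 : 0 < finrank F D := finrank_pos
  omega

/-- The minimal equation over the centre of a symmetric element has coefficients in `F`. -/
theorem exists_pow_eq_sum [FiniteDimensional F D] {s : D} (hs : σ s = s) {r : ℕ}
    (hr : (minpoly (Subring.center D) s).natDegree = r) :
    ∃ a : Fin r → F, s ^ r = ∑ i, a i • s ^ (i : ℕ) := by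
  subst hr
  have := hσ.finiteDimensional_center
  obtain ⟨a, ha⟩ := _root_.exists_pow_eq_sum (Subring.center D) s
  choose b hb using hσ.mem_range_of_pow_eq_sum hs (linearIndependent_pow s) a ha
  refine ⟨b, ha.trans (Finset.sum_congr rfl fun i _ => ?_)⟩
  rw [Algebra.smul_def (b i), hb]
  rfl

theorem exists_quadratic [FiniteDimensional F D] {s : D} (hs : σ s = s)
    (h2 : (minpoly (Subring.center D) s).natDegree = 2) :
    ∃ τ ν : F, s * s = algebraMap F D τ * s - algebraMap F D ν := by
  obtain ⟨a, ha⟩ := hσ.exists_pow_eq_sum hs h2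
  refine ⟨a 1, -a 0, ?_⟩
  rw [Fin.sum_univ_two] at ha
  simp only [Fin.val_zero, pow_zero, Fin.val_one, pow_one, pow_two, Algebra.smul_def,
    mul_one] at ha
  rw [ha, _root_.map_neg, sub_neg_eq_add, add_comm]

/-- Symmetric elements cannot all be central in a noncommutative division algebra. -/
theorem exists_symm_notMem_center (hD : Subring.center D ≠ ⊤) :
    ∃ s, σ s = s ∧ s ∉ Subring.center D := by
  by_contra! H
  obtain ⟨t, ht, hne⟩ := hσ.exists_ne
  refine hD (eq_top_iff.2 fun x _ => ?_)
  obtain ⟨a, b, ha, hb, rfl⟩ := hσ.exists_eq_add_mul ht hne x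
  exact add_mem (H a ha) (mul_mem ht (H b hb))

end IsUnitaryInvolution

/-! ### Hermitian forms and the quadratic forms they induce over `F` -/

/-- A hermitian form (linear in the first variable) on a left vector space. -/
structure IsHermitianForm {D : Type*} [DivisionRing D] (σ : D → D) {V : Type*} [AddCommGroup V]
    [Module D V] (h : V → V → D) : Prop where
  add_left : ∀ x y z, h (x + y) z = h x z + h y z
  smul_left : ∀ (a : D) (x y), h (a • x) y = a * h x y
  symm : ∀ x y, h y x = σ (h x y)

namespace IsHermitianForm

variable {F D : Type*} [Field F] [DivisionRing D] [Algebra F D] {σ : D → D}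
  {V : Type*} [AddCommGroup V] [Module D V] {h : V → V → D}

theorem zero_left (hh : IsHermitianForm σ h) (y : V) : h 0 y = 0 := by
  simpa using hh.smul_left 0 0 y

theorem add_right (hσ : IsUnitaryInvolution F σ) (hh : IsHermitianForm σ h) (x y z : V) :
    h x (y + z) = h x y + h x z := by
  rw [hh.symm (y + z) x, hh.add_left, hσ.map_add, ← hh.symm, ← hh.symm]

theorem smul_right (hσ : IsUnitaryInvolution F σ) (hh : IsHermitianForm σ h) (a : D) (x y : V) :
    h x (a • y) = h x y * σ a := by
  rw [hh.symm (a • y) x, hh.smul_left, hσ.map_mul, ← hh.symm]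

/-- The quadratic form `x ↦ g (h x x)` over `F` for an `F`-linear form `g` on `D`. -/
def quadraticForm (hσ : IsUnitaryInvolution F σ) (hh : IsHermitianForm σ h) [Module F V]
    [IsScalarTower F D V] (g : D →ₗ[F] F) : QuadraticForm F V :=
  LinearMap.BilinMap.toQuadraticMap <| LinearMap.mk₂ F (fun x y => g (h x y))
    (fun x y z => by rw [hh.add_left, map_add])
    (fun a x y => by
      rw [← algebraMap_smul D a x, hh.smul_left, ← Algebra.smul_def, map_smul])
    (fun x y z => by rw [hh.add_right hσ, map_add])
    (fun a x y => by
      rw [← algebraMap_smul D a y, hh.smul_right hσ, hσ.map_algebraMap, ← Algebra.commutes,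
        ← Algebra.smul_def, map_smul])

@[simp]
theorem quadraticForm_apply (hσ : IsUnitaryInvolution F σ) (hh : IsHermitianForm σ h) [Module F V]
    [IsScalarTower F D V] (g : D →ₗ[F] F) (x : V) :
    hh.quadraticForm hσ g x = g (h x x) := rfl

end IsHermitianForm

theorem exists_linearMap_algebraMap_eq {F D : Type*} [Field F] [DivisionRing D] [Algebra F D] :
    ∃ g : D →ₗ[F] F, ∀ a, g (algebraMap F D a) = a := by
  obtain ⟨g, hg⟩ := LinearMap.exists_leftInverse_of_injective (Algebra.linearMap F D)
    (LinearMap.ker_eq_bot.2 (algebraMap F D).injective)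
  exact ⟨g, fun a => LinearMap.congr_fun hg a⟩

/-! ### Quadratic elements, their conjugating skew elements and their centralizers -/

section QuadraticElement

variable {F D : Type*} [Field F] [DivisionRing D] [Algebra F D] [FiniteDimensional F D]

theorem finrank_adjoin_of_quadratic {x : D} {τ ν : F}
    (hx : x * x = algebraMap F D τ * x - algebraMap F D ν) (hxF : x ∉ Set.range (algebraMap F D)) :
    finrank F (Algebra.adjoin F {x}) = 2 := by
  rw [finrank_adjoin_singleton]
  have hint : IsIntegral F x := Algebra.IsIntegral.isIntegral x
  have h0 := minpoly.natDegree_pos hint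
  have h1 : (minpoly F x).natDegree ≠ 1 := fun h =>
    hxF (mem_range_algebraMap_of_natDegree_minpoly_eq_one F h)
  have h2 : (minpoly F x).natDegree ≤ 2 := by
    let p : Polynomial F := Polynomial.X ^ 2 - Polynomial.C τ * Polynomial.X + Polynomial.C ν
    have hp : p.natDegree ≤ 2 := by
      dsimp only [p]
      compute_degree
    have hp0 : p ≠ 0 := by
      intro h
      have := congrArg (fun q => Polynomial.coeff q 2) h
      simp [p] at this
    refine (Polynomial.natDegree_le_of_dvd (minpoly.dvd F x ?_) hp0).trans hp
    simp only [p, map_add, map_sub, map_mul, Polynomial.aeval_C, Polynomial.aeval_X, map_pow]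
    rw [pow_two, hx]
    abel
  omega

theorem mem_adjoin_of_quadratic {x : D} {τ ν : F}
    (hx : x * x = algebraMap F D τ * x - algebraMap F D ν) (hxF : x ∉ Set.range (algebraMap F D))
    {y : D} (hy : y ∈ Algebra.adjoin F {x}) :
    ∃ a b : F, y = algebraMap F D a + algebraMap F D b * x := by
  have h1 := toSubmodule_adjoin_singleton F x
  rw [← finrank_adjoin_singleton, finrank_adjoin_of_quadratic hx hxF] at h1
  rw [← Subalgebra.mem_toSubmodule, h1] at hy
  obtain ⟨c, hc⟩ := (Submodule.mem_span_range_iff_exists_fun F).1 hy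
  refine ⟨c 0, c 1, ?_⟩
  rw [← hc, Fin.sum_univ_two]
  simp [Algebra.smul_def]

omit [FiniteDimensional F D] in
theorem mem_centralizer_singleton {s x : D} :
    x ∈ Subalgebra.centralizer F {s} ↔ s * x = x * s := by
  simp [Subalgebra.mem_centralizer_iff]

end QuadraticElement

/-- A symmetric noncentral element `s` of degree `2` over `F` in a division algebra with unitary
involution, and a nonzero skew element `j` with `j s = s̄ j`. -/
structure QuadraticPair (F : Type*) {D : Type*} [Field F] [DivisionRing D] [Algebra F D]
    (σ : D → D) (s j : D) (τ ν : F) : Prop where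
  symm : σ s = s
  eqn : s * s = algebraMap F D τ * s - algebraMap F D ν
  notMem : s ∉ Subring.center D
  ne_zero : j ≠ 0
  conj : j * s = (algebraMap F D τ - s) * j
  skew : σ j = -j

namespace QuadraticPair

variable {F D : Type*} [Field F] [DivisionRing D] [Algebra F D]
  {σ : D → D} (hσ : IsUnitaryInvolution F σ) {s j : D} {τ ν : F}

theorem commutator_mul {F D : Type*} [Field F] [DivisionRing D] [Algebra F D] {s : D} {τ ν : F}
    (hs : s * s = algebraMap F D τ * s - algebraMap F D ν) (y : D) :
    (s * y - y * s) * s = (algebraMap F D τ - s) * (s * y - y * s) := by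
  have h1 : (s * y - y * s) * s = s * y * s - y * (s * s) := by noncomm_ring
  have h2 : (algebraMap F D τ - s) * (s * y - y * s) =
      algebraMap F D τ * s * y - algebraMap F D τ * y * s - s * s * y + s * y * s := by noncomm_ring
  rw [h1, h2, hs, mul_sub, sub_mul, ← mul_assoc y, ← Algebra.commutes τ y, ← Algebra.commutes ν y]
  abel

include hσ in
-- A nonzero commutator `x = [s, y]` satisfies `x s = (τ - s) x`, and so does `σ x`. Take `j = x - σ
-- x`; if this is zero, `x` is symmetric and multiplying it by the central skew element `t - σ t`
-- makes it skew.
theorem exists_of_symm (hs : σ s = s) (he : s * s = algebraMap F D τ * s - algebraMap F D ν)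
    (hn : s ∉ Subring.center D) : ∃ j, QuadraticPair F σ s j τ ν := by
  obtain ⟨y, hy⟩ : ∃ y, y * s ≠ s * y := by
    by_contra! H
    exact hn (Subring.mem_center_iff.2 H)
  obtain ⟨x, hx0, hxs⟩ : ∃ x, x ≠ 0 ∧ x * s = (algebraMap F D τ - s) * x :=
    ⟨_, sub_ne_zero.2 hy.symm, commutator_mul he y⟩
  have hσx : σ x * s = (algebraMap F D τ - s) * σ x := by
    have := congrArg σ hxs
    rw [hσ.map_mul, hσ.map_mul, hσ.map_sub, hσ.map_algebraMap, hs, mul_sub,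
      ← Algebra.commutes τ (σ x)] at this
    rw [sub_mul, this, sub_sub_cancel]
  by_cases h : x - σ x = 0
  · obtain ⟨t, ht, hne⟩ := hσ.exists_ne
    have htc := Subring.mem_center_iff.1 (sub_mem ht (hσ.map_mem_center ht))
    refine ⟨(t - σ t) * x, hs, he, hn, mul_ne_zero (sub_ne_zero.2 hne.symm) hx0, ?_, ?_⟩
    · rw [mul_assoc, hxs, ← mul_assoc, ← htc, mul_assoc]
    · rw [hσ.map_mul, hσ.map_sub, hσ.invol, ← sub_eq_zero.1 h, ← neg_sub t, mul_neg, htc]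
  · refine ⟨x - σ x, hs, he, hn, h, ?_, ?_⟩
    · rw [sub_mul, mul_sub, hxs, hσx]
    · rw [hσ.map_sub, hσ.invol, neg_sub]

variable (q : QuadraticPair F σ s j τ ν)
include q

theorem conj' : j * (algebraMap F D τ - s) = s * j := by
  rw [mul_sub, q.conj, ← Algebra.commutes, sub_mul, sub_sub_cancel]

theorem inv_conj : j⁻¹ * s = (algebraMap F D τ - s) * j⁻¹ := by
  rw [inv_mul_eq_iff_eq_mul₀ q.ne_zero, ← mul_assoc, q.conj', mul_assoc, mul_inv_cancel₀ q.ne_zero,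
    mul_one]

theorem mul_inv_mem {x : D} (hx : x * s = (algebraMap F D τ - s) * x) :
    x * j⁻¹ ∈ Subalgebra.centralizer F {s} := by
  have h : x * (algebraMap F D τ - s) = s * x := by
    rw [mul_sub, hx, ← Algebra.commutes, sub_mul, sub_sub_cancel]
  rw [mem_centralizer_singleton, mul_assoc x, q.inv_conj, ← mul_assoc, ← mul_assoc, h]

/-- The map `y ↦ [s, y] j⁻¹` from `D` to the centralizer `C` of `s`. It has kernel `C`. -/
noncomputable def toCentralizer :
    D →ₗ[Subalgebra.centralizer F {s}] Subalgebra.centralizer F {s} where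
  toFun y := ⟨(s * y - y * s) * j⁻¹, q.mul_inv_mem (commutator_mul q.eqn y)⟩
  map_add' x y := Subtype.ext (by
    change (s * (x + y) - (x + y) * s) * j⁻¹ = (s * x - x * s) * j⁻¹ + (s * y - y * s) * j⁻¹
    noncomm_ring)
  map_smul' c x := Subtype.ext (by
    change (s * ((c : D) * x) - ((c : D) * x) * s) * j⁻¹ = (c : D) * ((s * x - x * s) * j⁻¹)
    rw [← mul_assoc, mem_centralizer_singleton.1 c.2]
    noncomm_ring)

theorem coe_toCentralizer (y : D) : (q.toCentralizer y : D) = (s * y - y * s) * j⁻¹ := rfl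

theorem toCentralizer_eq_zero {y : D} :
    q.toCentralizer y = 0 ↔ y ∈ Subalgebra.centralizer F {s} := by
  rw [mem_centralizer_singleton, ← Subtype.coe_inj, coe_toCentralizer, ZeroMemClass.coe_zero,
    mul_eq_zero, or_iff_left (inv_ne_zero q.ne_zero), sub_eq_zero]

theorem exists_toCentralizer_ne_zero : ∃ y, q.toCentralizer y ≠ 0 := by
  by_contra! H
  refine q.notMem (Subring.mem_center_iff.2 fun g => ?_)
  exact (mem_centralizer_singleton.1 (q.toCentralizer_eq_zero.1 (H g))).symm

variable [FiniteDimensional F D]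

/-- Rank and nullity of `toCentralizer` over the centralizer `C`: the kernel is `C` itself, a line,
and the image is a nonzero subspace of the line `C`. -/
theorem finrank_centralizer_eq_two :
    finrank (Subalgebra.centralizer F {s}) D = 2 := by
  let _ := (Subalgebra.centralizer F {s}).divisionRing
  have hfin : FiniteDimensional (Subalgebra.centralizer F {s}) D :=
    Module.Finite.of_restrictScalars_finite F _ _
  obtain ⟨y, hy⟩ := q.exists_toCentralizer_ne_zero
  have h1 := q.toCentralizer.finrank_range_add_finrank_ker
  have h2 : LinearMap.range q.toCentralizer = ⊤ := by
    refine eq_top_iff.2 fun c _ => ?_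
    refine ⟨(c * (q.toCentralizer y)⁻¹) • y, ?_⟩
    rw [map_smul, smul_eq_mul, mul_assoc, inv_mul_cancel₀ hy, mul_one]
  have h3 : LinearMap.ker q.toCentralizer =
      Submodule.span (Subalgebra.centralizer F {s}) {(1 : D)} := by
    ext x
    rw [LinearMap.mem_ker, q.toCentralizer_eq_zero, Submodule.mem_span_singleton]
    constructor
    · intro hx
      exact ⟨⟨x, hx⟩, mul_one x⟩
    · rintro ⟨c, rfl⟩
      have : c • (1 : D) = c := mul_one (c : D)
      rw [this]
      exact c.2
  rw [h2, finrank_top, h3, finrank_self, finrank_span_singleton one_ne_zero] at h1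
  exact h1.symm

theorem finrank_eq_two_mul_centralizer :
    finrank F D = 2 * finrank F (Subalgebra.centralizer F {s}) := by
  let _ := (Subalgebra.centralizer F {s}).divisionRing
  rw [← finrank_mul_finrank F (Subalgebra.centralizer F {s}) D, q.finrank_centralizer_eq_two,
    mul_comm]

/-- The centre of the centralizer of `s` is generated by `s`. -/
theorem exists_eq_add_mul_of_mem_center {x : D}
    (hx : ∀ c ∈ Subalgebra.centralizer F {s}, c * x = x * c) :
    ∃ a ∈ Subring.center D, ∃ b ∈ Subring.center D, x = a + b * s := by
  let _ := (Subalgebra.centralizer F {s}).divisionRing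
  obtain ⟨y, hy⟩ := q.exists_toCentralizer_ne_zero
  have hdec : ∀ d : D, ∃ c ∈ Subalgebra.centralizer F {s}, ∃ c' ∈ Subalgebra.centralizer F {s},
      d = c + c' * y := by
    intro d
    let c' := q.toCentralizer d * (q.toCentralizer y)⁻¹
    refine ⟨d - c' * y, ?_, c', c'.2, by abel⟩
    rw [← q.toCentralizer_eq_zero]
    have : d - c' * y = d - c' • y := rfl
    rw [this, map_sub, map_smul, smul_eq_mul, mul_assoc, inv_mul_cancel₀ hy, mul_one, sub_self]
  have hsy : s * y - y * s ≠ 0 := fun h => hy (by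
    rw [q.toCentralizer_eq_zero, mem_centralizer_singleton]; exact sub_eq_zero.1 h)
  -- The derivations `[x, ·]` and `[s, ·]` vanish on `C` and are left `C`-linear, so on `D = C + C
  -- y` they are determined by their values at `y` and differ by a fixed right factor `b`.
  obtain ⟨b, hb⟩ : ∃ b, ∀ d, x * d - d * x = (s * d - d * s) * b := by
    refine ⟨(s * y - y * s)⁻¹ * (x * y - y * x), fun d => ?_⟩
    obtain ⟨c, hc, c', hc', rfl⟩ := hdec d
    have h1 := hx c hc
    have h2 := hx c' hc'
    have h3 := mem_centralizer_singleton.1 hc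
    have h4 := mem_centralizer_singleton.1 hc'
    have e1 : x * (c + c' * y) - (c + c' * y) * x = c' * (x * y - y * x) := by
      rw [mul_add, add_mul, ← h1, ← mul_assoc, ← h2]
      noncomm_ring
    have e2 : s * (c + c' * y) - (c + c' * y) * s = c' * (s * y - y * s) := by
      rw [mul_add, add_mul, h3, ← mul_assoc, h4]
      noncomm_ring
    rw [e1, e2, mul_assoc, ← mul_assoc (s * y - y * s), mul_inv_cancel₀ hsy, one_mul]
  -- Expanding the relation at `y g` by the Leibniz rule leaves `[s, y] b g = [s, y] g b`. Once `b`
  -- is central, `x - b s` commutes with everything.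
  have hbc : b ∈ Subring.center D := by
    refine Subring.mem_center_iff.2 fun g => ?_
    have e1 := hb (y * g)
    have e2 : x * (y * g) - y * g * x = (x * y - y * x) * g + y * (x * g - g * x) := by
      noncomm_ring
    have e3 : s * (y * g) - y * g * s = (s * y - y * s) * g + y * (s * g - g * s) := by
      noncomm_ring
    rw [e2, e3, hb y, hb g, add_mul, mul_assoc y, add_left_inj, mul_assoc, mul_assoc] at e1
    exact (mul_left_cancel₀ hsy e1).symm
  refine ⟨x - b * s, Subring.mem_center_iff.2 fun g => ?_, b, hbc, by abel⟩
  have h1 := hb g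
  have h2 := Subring.mem_center_iff.1 hbc
  have h3 : g * (b * s) = b * (g * s) := by rw [← mul_assoc, h2, mul_assoc]
  rw [h2, mul_sub] at h1
  rw [mul_sub, sub_mul, h3, mul_assoc, sub_eq_sub_iff_add_eq_add, sub_eq_sub_iff_add_eq_add.1 h1,
    add_comm]

end QuadraticPair

namespace QuadraticPair

variable {F D : Type*} [Field F] [DivisionRing D] [Algebra F D] [FiniteDimensional F D]
  {σ : D → D} (hσ : IsUnitaryInvolution F σ) {s j : D} {τ ν : F}
  (q : QuadraticPair F σ s j τ ν)
include hσ q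

/-- With `t + σ t = 1`, the element `ℓ = t s + σ(t) s̄` is mapped to `τ - ℓ` by both `σ` and
conjugation by `j`. -/
theorem exists_generator : ∃ ℓ, ∃ ν' : F, ∃ α ∈ Subring.center D, ∃ β ∈ Subring.center D,
    α ≠ 0 ∧ ℓ = α * s + β ∧ σ ℓ = algebraMap F D τ - ℓ ∧ j * ℓ = (algebraMap F D τ - ℓ) * j ∧
    ℓ * ℓ = algebraMap F D τ * ℓ - algebraMap F D ν' := by
  have := hσ.finiteDimensional_center
  obtain ⟨t, ht, hσt, hne⟩ := hσ.exists_normalized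
  -- The identities `e1`, `e2`, `e3` involve only `s` and central elements, so they can be checked
  -- in the field generated by `s` over the centre. There `ℓ = t s + (1 - t)(τ - s)` is written as
  -- `(t - (1 - t)) s + (1 - t) τ`.
  let S := Algebra.adjoin (Subring.center D) {s}
  let _ : Field S := S.fieldOfComm (Algebra.adjoin_singleton_comm s)
  let s' : S := ⟨s, Algebra.self_mem_adjoin_singleton _ s⟩
  let t' : S := algebraMap (Subring.center D) S ⟨t, ht⟩
  let T' : S := algebraMap (Subring.center D) S ⟨algebraMap F D τ, algebraMap_mem_center τ⟩
  let N' : S := algebraMap (Subring.center D) S ⟨algebraMap F D ν, algebraMap_mem_center ν⟩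
  have hs' : s' * s' = T' * s' - N' := Subtype.ext q.eqn
  have hα : t - (1 - t) ∈ Subring.center D := sub_mem ht (sub_mem (one_mem _) ht)
  have hβ : (1 - t) * algebraMap F D τ ∈ Subring.center D :=
    mul_mem (sub_mem (one_mem _) ht) (algebraMap_mem_center τ)
  have hα0 : t - (1 - t) ≠ 0 := by
    rw [← hσt]
    exact sub_ne_zero.2 hne.symm
  have e1 : (t - (1 - t)) * (algebraMap F D τ - s) + (1 - t) * algebraMap F D τ =
      algebraMap F D τ - ((t - (1 - t)) * s + (1 - t) * algebraMap F D τ) :=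
    congrArg Subtype.val (show (t' - (1 - t')) * (T' - s') + (1 - t') * T' =
      T' - ((t' - (1 - t')) * s' + (1 - t') * T') by ring)
  have e2 : s * ((1 - t) - t) + algebraMap F D τ * t =
      algebraMap F D τ - ((t - (1 - t)) * s + (1 - t) * algebraMap F D τ) :=
    congrArg Subtype.val (show s' * ((1 - t') - t') + T' * t' =
      T' - ((t' - (1 - t')) * s' + (1 - t') * T') by ring)
  have e3 : ((t - (1 - t)) * s + (1 - t) * algebraMap F D τ) *
      (algebraMap F D τ - ((t - (1 - t)) * s + (1 - t) * algebraMap F D τ)) =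
      (t - (1 - t)) * (t - (1 - t)) * algebraMap F D ν +
        (1 - t) * algebraMap F D τ * algebraMap F D τ
        - (1 - t) * algebraMap F D τ * ((1 - t) * algebraMap F D τ) :=
    congrArg Subtype.val (show ((t' - (1 - t')) * s' + (1 - t') * T') *
      (T' - ((t' - (1 - t')) * s' + (1 - t') * T')) =
      (t' - (1 - t')) * (t' - (1 - t')) * N' + (1 - t') * T' * T' - (1 - t') * T' * ((1 - t') * T')
      by linear_combination (-(t' - (1 - t')) * (t' - (1 - t'))) * hs')
  have hσℓ : σ ((t - (1 - t)) * s + (1 - t) * algebraMap F D τ) =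
      algebraMap F D τ - ((t - (1 - t)) * s + (1 - t) * algebraMap F D τ) := by
    rw [← e2, hσ.map_add, hσ.map_mul, hσ.map_mul, q.symm, hσ.map_algebraMap, hσ.map_sub,
      hσ.map_sub, hσ.map_one, hσt, sub_sub_cancel]
  obtain ⟨ν', hν'⟩ := hσ.mem_range
    (((t - (1 - t)) * s + (1 - t) * algebraMap F D τ) *
      (algebraMap F D τ - ((t - (1 - t)) * s + (1 - t) * algebraMap F D τ)))
    (by
      rw [e3]
      exact sub_mem (add_mem (mul_mem (mul_mem hα hα) (algebraMap_mem_center ν))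
        (mul_mem hβ (algebraMap_mem_center τ))) (mul_mem hβ hβ))
    (by rw [hσ.map_mul, hσ.map_sub, hσℓ, hσ.map_algebraMap, sub_sub_cancel])
  refine ⟨_, ν', _, hα, _, hβ, hα0, rfl, hσℓ, ?_, ?_⟩
  · rw [← e1, mul_add, add_mul, ← mul_assoc, Subring.mem_center_iff.1 hα j, mul_assoc, q.conj,
      ← mul_assoc, Subring.mem_center_iff.1 hβ j]
  · rw [hν']
    generalize (t - (1 - t)) * s + (1 - t) * algebraMap F D τ = ℓ
    rw [mul_sub, ← Algebra.commutes τ ℓ, sub_sub_cancel]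

omit [FiniteDimensional F D] in
/-- `x ↦ j σ(x) j⁻¹`. -/
theorem twist_invol (x : D) : j * σ (j * σ x * j⁻¹) * j⁻¹ = x := by
  rw [hσ.map_mul, hσ.map_mul, hσ.invol, hσ.map_inv, q.skew, inv_neg]
  have := q.ne_zero
  have h1 : j * (-j⁻¹ * (x * -j)) * j⁻¹ = (j * j⁻¹) * x * (j * j⁻¹) := by noncomm_ring
  rw [h1, mul_inv_cancel₀ this, one_mul, mul_one]

omit [FiniteDimensional F D] in
theorem map_mem_centralizer {x : D} (hx : x ∈ Subalgebra.centralizer F {s}) :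
    σ x ∈ Subalgebra.centralizer F {s} := by
  rw [mem_centralizer_singleton] at hx ⊢
  have := congrArg σ hx
  rw [hσ.map_mul, hσ.map_mul, q.symm] at this
  exact this.symm

omit hσ [FiniteDimensional F D] in
theorem conj_mem_centralizer {x : D} (hx : x ∈ Subalgebra.centralizer F {s}) :
    j * x * j⁻¹ ∈ Subalgebra.centralizer F {s} := by
  apply q.mul_inv_mem
  rw [mem_centralizer_singleton] at hx
  rw [mul_assoc, ← hx, ← mul_assoc, q.conj, mul_assoc]

omit [FiniteDimensional F D] in
/-- The form `[s, h] j⁻¹` is hermitian over the centralizer of `s` for the twisted involution. -/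
theorem toCentralizer_symm {V : Type*} [AddCommGroup V] [Module D V] {h : V → V → D}
    (hh : IsHermitianForm σ h) (x y : V) :
    (q.toCentralizer (h y x) : D) = j * σ (q.toCentralizer (h x y)) * j⁻¹ := by
  rw [coe_toCentralizer, coe_toCentralizer, hσ.map_mul, hσ.map_inv, q.skew, hσ.map_sub, hσ.map_mul,
    hσ.map_mul, q.symm, ← hh.symm, inv_neg, ← mul_assoc, mul_neg, mul_inv_cancel₀ q.ne_zero,
    neg_one_mul, neg_sub]

end QuadraticPair

/-! ### Preparations in degree two: separable elements and quaternion subalgebras -/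

section Quaternion

variable {F D : Type*} [Field F] [DivisionRing D] [Algebra F D]
  {σ : D → D} (hσ : IsUnitaryInvolution F σ)

include hσ in
-- The map `ρ` is semilinear over the centre and fixes `m = α s + β`. If `x = c + d m` is fixed,
-- then `(d - σ d) m` is central while `m` is not, so `d`, and then `c`, lies in `F`. It identifies
-- the fixed field as `F(s)` for `σ` and as `F(ℓ)` for `x ↦ j σ(x) j⁻¹`.
theorem IsUnitaryInvolution.mem_adjoin_of_fixed {s : D} (hs : s ∉ Subring.center D) {ρ : D → D}
    (hadd : ∀ x y, ρ (x + y) = ρ x + ρ y) (hmul : ∀ z ∈ Subring.center D, ∀ y, ρ (z * y) = σ z * ρ y)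
    (hone : ρ 1 = 1) {α β : D} (hα : α ∈ Subring.center D) (hβ : β ∈ Subring.center D) (hα0 : α ≠ 0)
    (hm : ρ (α * s + β) = α * s + β) {x : D}
    (hx : ∃ a ∈ Subring.center D, ∃ b ∈ Subring.center D, x = a + b * s) (hρx : ρ x = x) :
    x ∈ Algebra.adjoin F {α * s + β} := by
  obtain ⟨a, ha, b, hb, rfl⟩ := hx
  have hm' : s = α⁻¹ * (α * s + β - β) := by
    rw [add_sub_cancel_right, ← mul_assoc, inv_mul_cancel₀ hα0, one_mul]
  have hαi : α⁻¹ ∈ Subring.center D := inv_mem_center hα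
  have hmc : α * s + β ∉ Subring.center D := fun h => hs (by
    rw [hm']
    exact mul_mem hαi (sub_mem h hβ))
  generalize α * s + β = m at *
  have hb' : b * α⁻¹ ∈ Subring.center D := mul_mem hb hαi
  have ha' : a - b * α⁻¹ * β ∈ Subring.center D := sub_mem ha (mul_mem hb' hβ)
  have hx : a + b * s = (a - b * α⁻¹ * β) + b * α⁻¹ * m := by
    rw [hm', mul_sub, mul_sub, ← mul_assoc, ← mul_assoc]
    abel
  rw [hx] at hρx ⊢
  generalize a - b * α⁻¹ * β = c at *
  generalize b * α⁻¹ = d at *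
  have hc : ρ c = σ c := by rw [← mul_one c, hmul c ha', hone, mul_one, mul_one]
  rw [hadd, hmul d hb', hm, hc] at hρx
  have hd : σ d = d := by
    by_contra hne
    have h0 : d - σ d ≠ 0 := sub_ne_zero.2 (Ne.symm hne)
    have h1 : d - σ d ∈ Subring.center D := sub_mem hb' (hσ.map_mem_center hb')
    apply hmc
    have h2 : (d - σ d) * m = σ c - c := by
      rw [sub_mul, sub_eq_sub_iff_add_eq_add, add_comm (d * m), hρx.symm]
    rw [(eq_inv_mul_iff_mul_eq₀ h0).2 h2]
    exact mul_mem (inv_mem_center h1) (sub_mem (hσ.map_mem_center ha') ha')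
  rw [hd, add_left_inj] at hρx
  obtain ⟨c, rfl⟩ := hσ.mem_range c ha' hρx
  obtain ⟨d, rfl⟩ := hσ.mem_range d hb' hd
  exact add_mem (Subalgebra.algebraMap_mem _ c)
    (mul_mem (Subalgebra.algebraMap_mem _ d) (Algebra.self_mem_adjoin_singleton F m))

variable [FiniteDimensional F D]

include hσ in
-- The last condition says that `s` is separable over `F`. If every symmetric noncentral `s` had `2
-- s = τ`, the characteristic would be `2` and all symmetric elements would have central squares;
-- writing elements as `a + t b`, so would all elements. Polarizing, `w = s y + y s` and `s (y s) +
-- (y s) s = w s` are central, and `w ≠ 0` for suitable `y`, so `s` is central.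
theorem IsUnitaryInvolution.exists_separable_symm (h4 : finrank (Subring.center D) D = 4) :
    ∃ s, ∃ τ ν : F, σ s = s ∧ s ∉ Subring.center D ∧
      s * s = algebraMap F D τ * s - algebraMap F D ν ∧ s + s ≠ algebraMap F D τ := by
  have := hσ.finiteDimensional_center
  have hZ : Subring.center D ≠ ⊤ := center_ne_top_of_finrank_ne_one (by omega)
  have hquad : ∀ s, σ s = s → s ∉ Subring.center D →
      ∃ τ ν : F, s * s = algebraMap F D τ * s - algebraMap F D ν := by
    intro s hs hsc
    refine hσ.exists_quadratic hs ?_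
    have h1 := natDegree_minpoly_dvd (F := Subring.center D) s
    have h2 := natDegree_minpoly_ne_finrank s (by omega)
    have h3 : (minpoly (Subring.center D) s).natDegree ≠ 1 := fun h => by
      obtain ⟨z, rfl⟩ := mem_range_algebraMap_of_natDegree_minpoly_eq_one _ h
      exact hsc z.2
    rw [h4] at h1 h2
    have h5 := Nat.le_of_dvd (by norm_num) h1
    interval_cases (minpoly (Subring.center D) s).natDegree <;> omega
  by_contra! H
  obtain ⟨s, hs, hsc⟩ := hσ.exists_symm_notMem_center hZ
  obtain ⟨τ, ν, he⟩ := hquad s hs hsc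
  have h2F : (2 : F) = 0 := by
    by_contra h2
    apply hsc
    have h3 : s = algebraMap F D (2⁻¹ * τ) := by
      rw [_root_.map_mul, ← H s τ ν hs hsc he, ← two_mul, ← mul_assoc,
        ← map_ofNat (algebraMap F D) 2, ← _root_.map_mul, inv_mul_cancel₀ h2, _root_.map_one, one_mul]
    rw [h3]
    exact algebraMap_mem_center _
  have h2D : ∀ x : D, x + x = 0 := fun x => by
    rw [← two_mul, ← map_ofNat (algebraMap F D) 2, h2F, _root_.map_zero, zero_mul]
  have hneg : ∀ x : D, -x = x := fun x => neg_eq_of_add_eq_zero_right (h2D x)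
  have hsymm : ∀ x, σ x = x → x * x ∈ Subring.center D := by
    intro x hx
    by_cases hxc : x ∈ Subring.center D
    · exact mul_mem hxc hxc
    · obtain ⟨τ, ν, he⟩ := hquad x hx hxc
      rw [he, ← H x τ ν hx hxc he, h2D, zero_mul]
      exact sub_mem (zero_mem _) (algebraMap_mem_center _)
  have hpolar : ∀ x y, x * x ∈ Subring.center D → y * y ∈ Subring.center D →
      (x + y) * (x + y) ∈ Subring.center D → x * y + y * x ∈ Subring.center D := by
    intro x y hx hy hxy
    have : x * y + y * x = (x + y) * (x + y) - x * x - y * y := by noncomm_ring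
    rw [this]
    exact sub_mem (sub_mem hxy hx) hy
  have hall : ∀ x, x * x ∈ Subring.center D := by
    intro x
    obtain ⟨t, ht, hne⟩ := hσ.exists_ne
    obtain ⟨a, b, ha, hb, rfl⟩ := hσ.exists_eq_add_mul ht hne x
    have h1 := hpolar a b (hsymm a ha) (hsymm b hb) (hsymm _ (by rw [hσ.map_add, ha, hb]))
    have htc := Subring.mem_center_iff.1 ht
    have h3 : (a + t * b) * (a + t * b) = a * a + t * t * (b * b) + t * (a * b + b * a) := by
      have e1 : a * (t * b) = t * (a * b) := by rw [← mul_assoc, htc, mul_assoc]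
      have e2 : t * b * (t * b) = t * t * (b * b) := by
        rw [mul_assoc, ← mul_assoc b, htc, mul_assoc, mul_assoc]
      rw [add_mul, mul_add, mul_add, e1, e2]
      noncomm_ring
    rw [h3]
    exact add_mem (add_mem (hsymm a ha) (mul_mem (mul_mem ht ht) (hsymm b hb))) (mul_mem ht h1)
  obtain ⟨y, hy⟩ : ∃ y, y * s ≠ s * y := by
    by_contra! H
    exact hsc (Subring.mem_center_iff.2 H)
  have hw := hpolar s y (hall _) (hall _) (hall _)
  have hw' := hpolar s (y * s) (hall _) (hall _) (hall _)
  have hw0 : s * y + y * s ≠ 0 := by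
    intro h
    apply hy
    rw [← hneg (y * s)]
    exact (eq_neg_of_add_eq_zero_left h).symm
  apply hsc
  have e : s = (s * y + y * s)⁻¹ * (s * (y * s) + y * s * s) := by
    rw [eq_inv_mul_iff_mul_eq₀ hw0]
    noncomm_ring
  rw [e]
  refine mul_mem ?_ hw'
  rw [Subring.mem_center_iff] at hw ⊢
  exact fun g => (Commute.inv_right₀ (show Commute _ _ from hw g)).eq

omit [FiniteDimensional F D] in
-- With the centre `Z` as base field, the centralizer of `s` has dimension `4 / 2 = 2`, hence equals
-- `Z(s)`.
theorem QuadraticPair.centralizer_comm {s j : D} {τ ν : F} (q : QuadraticPair F σ s j τ ν)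
    [FiniteDimensional (Subring.center D) D] (h4 : finrank (Subring.center D) D = 4)
    {x y : D} (hx : s * x = x * s) (hy : s * y = y * s) : x * y = y * x := by
  let τ' : Subring.center D := ⟨algebraMap F D τ, algebraMap_mem_center τ⟩
  let ν' : Subring.center D := ⟨algebraMap F D ν, algebraMap_mem_center ν⟩
  have q' : QuadraticPair (Subring.center D) σ s j τ' ν' :=
    ⟨q.symm, q.eqn, q.notMem, q.ne_zero, q.conj, q.skew⟩
  have h1 := q'.finrank_eq_two_mul_centralizer
  have hle : Subalgebra.toSubmodule (Algebra.adjoin (Subring.center D) {s}) ≤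
      Subalgebra.toSubmodule (Subalgebra.centralizer (Subring.center D) {s}) := by
    have h0 : s ∈ Subalgebra.centralizer (Subring.center D) {s} :=
      mem_centralizer_singleton.2 rfl
    exact Algebra.adjoin_le (Set.singleton_subset_iff.2 h0)
  have h2 : finrank (Subring.center D) (Algebra.adjoin (Subring.center D) {s}) = 2 :=
    finrank_adjoin_of_quadratic q'.eqn (by
      rintro ⟨z, hz⟩
      exact q.notMem (hz ▸ z.2))
  have h3 := Submodule.eq_of_le_of_finrank_eq hle (by
    change finrank _ (Algebra.adjoin (Subring.center D) {s}) =
      finrank _ (Subalgebra.centralizer (Subring.center D) {s})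
    omega)
  have hmem : ∀ z, s * z = z * s → z ∈ Algebra.adjoin (Subring.center D) {s} := fun z hz => by
    rw [← Subalgebra.mem_toSubmodule, h3]
    exact (mem_centralizer_singleton (F := Subring.center D)).2 hz
  exact congrArg Subtype.val (Algebra.adjoin_singleton_comm s ⟨x, hmem x hx⟩ ⟨y, hmem y hy⟩)

/-- The subalgebra `L + L j`, for a subalgebra `L` normalized by `j`. -/
def Subalgebra.addMul (L : Subalgebra F D) (j : D) (hj : ∀ a ∈ L, ∃ a' ∈ L, j * a = a' * j)
    (hjj : j * j ∈ L) : Subalgebra F D where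
  carrier := {x | ∃ a ∈ L, ∃ b ∈ L, x = a + b * j}
  mul_mem' := by
    rintro _ _ ⟨a, ha, b, hb, rfl⟩ ⟨c, hc, d, hd, rfl⟩
    obtain ⟨c', hc', hcj⟩ := hj c hc
    obtain ⟨d', hd', hdj⟩ := hj d hd
    refine ⟨a * c + b * d' * (j * j), add_mem (mul_mem ha hc) (mul_mem (mul_mem hb hd') hjj),
      a * d + b * c', add_mem (mul_mem ha hd) (mul_mem hb hc'), ?_⟩
    have e : (a + b * j) * (c + d * j) = a * c + a * d * j + b * (j * c) + b * (j * d) * j := by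
      noncomm_ring
    rw [e, hcj, hdj]
    noncomm_ring
  add_mem' := by
    rintro _ _ ⟨a, ha, b, hb, rfl⟩ ⟨c, hc, d, hd, rfl⟩
    exact ⟨a + c, add_mem ha hc, b + d, add_mem hb hd, by noncomm_ring⟩
  algebraMap_mem' r := ⟨algebraMap F D r, L.algebraMap_mem r, 0, L.zero_mem, by simp⟩

theorem Subalgebra.finrank_addMul {L : Subalgebra F D} {j : D} {hj hjj}
    (hind : ∀ a ∈ L, ∀ b ∈ L, a + b * j = 0 → b = 0) :
    finrank F (L.addMul j hj hjj) = 2 * finrank F L := by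
  let f : L × L →ₗ[F] L.addMul j hj hjj :=
    { toFun := fun p => ⟨p.1 + p.2 * j, p.1, p.1.2, p.2, p.2.2, rfl⟩
      map_add' := fun p r => Subtype.ext (by
        change ((p.1 : D) + r.1) + ((p.2 : D) + r.2) * j = p.1 + p.2 * j + (r.1 + r.2 * j)
        noncomm_ring)
      map_smul' := fun c p => Subtype.ext (by
        change c • (p.1 : D) + (c • (p.2 : D)) * j = c • (p.1 + p.2 * j)
        rw [smul_add, smul_mul_assoc]) }
  have hf : Function.Bijective f := by
    constructor
    · rw [injective_iff_map_eq_zero]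
      rintro ⟨a, b⟩ hab
      have h1 : (a : D) + b * j = 0 := congrArg Subtype.val hab
      have h2 := hind a a.2 b b.2 h1
      rw [h2, zero_mul, add_zero] at h1
      exact Prod.ext (Subtype.ext h1) (Subtype.ext h2)
    · rintro ⟨_, a, ha, b, hb, rfl⟩
      exact ⟨(⟨a, ha⟩, ⟨b, hb⟩), rfl⟩
  rw [← (LinearEquiv.ofBijective f hf).finrank_eq, finrank_prod, two_mul]

/-- For a division subalgebra `S` with `dim_S D = 2`, the condition `h y x ∈ S` on `y` cuts out a
subspace of codimension at most `1`. -/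
theorem IsHermitianForm.exists_submodule_mem {S : Subalgebra F D} (hS : finrank S D = 2)
    {V : Type*} [AddCommGroup V] [Module D V] [FiniteDimensional D V] {h : V → V → D}
    (hh : IsHermitianForm σ h) (x : V) :
    ∃ T : Submodule S V, (∀ y, y ∈ T ↔ h y x ∈ S) ∧ finrank S (V ⧸ T) ≤ 1 := by
  let _ := S.divisionRing
  have : FiniteDimensional S D := Module.Finite.of_restrictScalars_finite F _ _
  have : FiniteDimensional S V := Module.Finite.trans D V
  let f : V →ₗ[S] D :=
    { toFun := fun y => h y x
      map_add' := fun y z => hh.add_left y z x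
      map_smul' := fun c y => hh.smul_left c y x }
  refine ⟨(Submodule.span S {(1 : D)}).comap f, fun y => ?_, ?_⟩
  · rw [Submodule.mem_comap, Submodule.mem_span_singleton]
    constructor
    · rintro ⟨c, hc⟩
      have h1 : (c : D) * 1 = h y x := hc
      rw [← h1, mul_one]
      exact c.2
    · intro hy
      exact ⟨⟨h y x, hy⟩, mul_one _⟩
  · refine (finrank_quotient_comap_le f _).trans ?_
    have h1 := (Submodule.span S {(1 : D)}).finrank_quotient_add_finrank
    rw [hS, finrank_span_singleton one_ne_zero] at h1
    omega

end Quaternion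

/-! ### Degree two: the bound `7n/8` -/

section Degree2

variable {F D : Type*} [Field F] [DivisionRing D] [Algebra F D] [FiniteDimensional F D]
  {σ : D → D} (hσ : IsUnitaryInvolution F σ) {s j : D} {τ ν : F}
  (q : QuadraticPair F σ s j τ ν) {n : ℕ} (hn : QuadraticUBound F n)
  {V : Type*} [AddCommGroup V] [Module D V] [FiniteDimensional D V] {h : V → V → D}
  (hh : IsHermitianForm σ h)

omit [FiniteDimensional D V] in
theorem Subalgebra.finrank_mul_finrank_restrictScalars [Module F V] [IsScalarTower F D V]
    (S : Subalgebra F D) (U : Submodule S V) :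
    finrank F S * finrank S U = finrank F (U.restrictScalars F) := by
  let _ := S.divisionRing
  exact finrank_mul_finrank F S U

/-- The data of a quaternion subalgebra `L + L j` on which `σ` is the canonical involution. -/
structure QuaternionData (σ : D → D) (s j : D) (L : Subalgebra F D) : Prop where
  comm : ∀ x y : L, x * y = y * x
  commute : ∀ a ∈ L, s * a = a * s
  finrank_eq : finrank F L = 2
  map_mem : ∀ a ∈ L, σ a ∈ L
  conj : ∀ a ∈ L, j * a = σ a * j
  trace_mem : ∀ a ∈ L, a + σ a ∈ Set.range (algebraMap F D)
  norm_mem : ∀ a ∈ L, a * σ a ∈ Set.range (algebraMap F D)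
  sq_mem : j * j ∈ Set.range (algebraMap F D)
  mem_of_fixed : ∀ a, s * a = a * s → j * σ a * j⁻¹ = a → a ∈ L
  mem_of_symm : ∀ a, s * a = a * s → σ a = a → ∃ x y : F, a = algebraMap F D x + algebraMap F D y * s
  indep : ∀ a ∈ L, ∀ b ∈ L, a + b * j = 0 → b = 0

include hσ q in
-- Take `L = F(ℓ)` with `ℓ` from `exists_generator`: both `σ` and conjugation by `j` send `ℓ` to `τ
-- - ℓ`, so they agree on `L`. Separability of `s` yields `j² ∈ F` and the independence of `1, j`
-- over `L`.
theorem QuadraticPair.exists_quaternionData (h4 : finrank (Subring.center D) D = 4)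
    (hsep : s + s ≠ algebraMap F D τ) : ∃ L : Subalgebra F D, QuaternionData σ s j L := by
  have := hσ.finiteDimensional_center
  obtain ⟨ℓ, ν', α, hα, β, hβ, hα0, hℓ, hσℓ, hjℓ, he⟩ := q.exists_generator hσ
  have hαs := Subring.mem_center_iff.1 hα s
  have hβs := Subring.mem_center_iff.1 hβ s
  have hsℓ : s * ℓ = ℓ * s := by
    rw [hℓ, mul_add, add_mul, ← mul_assoc, hαs, mul_assoc, hβs]
  have hℓF : ℓ ∉ Set.range (algebraMap F D) := by
    rintro ⟨c, hc⟩
    apply q.notMem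
    have h1 : s = α⁻¹ * (ℓ - β) := by
      rw [hℓ, add_sub_cancel_right, ← mul_assoc, inv_mul_cancel₀ hα0, one_mul]
    rw [h1, ← hc]
    refine mul_mem ?_ (sub_mem (algebraMap_mem_center c) hβ)
    rw [Subring.mem_center_iff] at hα ⊢
    exact fun g => (Commute.inv_right₀ (show Commute _ _ from hα g)).eq
  have hform : ∀ a ∈ Algebra.adjoin F {ℓ}, ∃ x y : F, a = algebraMap F D x + algebraMap F D y * ℓ :=
    fun a ha => mem_adjoin_of_quadratic he hℓF ha
  have hσf : ∀ x y : F, σ (algebraMap F D x + algebraMap F D y * ℓ) =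
      algebraMap F D x + algebraMap F D y * (algebraMap F D τ - ℓ) := by
    intro x y
    rw [hσ.map_add, hσ.map_mul, hσ.map_algebraMap, hσ.map_algebraMap, hσℓ, Algebra.commutes]
  have hcomm : ∀ x y : D, s * x = x * s → s * y = y * s → x * y = y * x :=
    fun x y => q.centralizer_comm h4
  have hcen : ∀ x, s * x = x * s →
      ∃ a ∈ Subring.center D, ∃ b ∈ Subring.center D, x = a + b * s := fun x hx =>
    q.exists_eq_add_mul_of_mem_center fun c hc => hcomm c x (mem_centralizer_singleton.1 hc) hx
  -- Since `j²` commutes with `s`, it is `a + b s` with central `a, b`. It also commutes with `j`,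
  -- which moves `s` to `τ - s ≠ s`; hence `b = 0`.
  have hjj : j * j ∈ Subring.center D := by
    obtain ⟨a, ha, b, hb, hab⟩ := hcen (j * j) (by
      rw [mul_assoc j j, q.conj, ← mul_assoc s, ← mul_assoc j, q.conj'])
    have h1 : j * (a + b * s) = (a + b * s) * j := by rw [← hab, mul_assoc]
    rw [mul_add, add_mul, ← mul_assoc, Subring.mem_center_iff.1 ha, Subring.mem_center_iff.1 hb,
      add_right_inj, mul_assoc, mul_assoc, q.conj] at h1
    by_cases hb0 : b = 0
    · rw [hab, hb0, zero_mul, add_zero]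
      exact ha
    · exfalso
      have h2 := mul_right_cancel₀ q.ne_zero (mul_left_cancel₀ hb0 h1)
      exact hsep (sub_eq_iff_eq_add.1 h2).symm
  refine ⟨Algebra.adjoin F {ℓ}, Algebra.adjoin_singleton_comm ℓ, ?_,
    finrank_adjoin_of_quadratic he hℓF, ?_, ?_, ?_, ?_, ?_, ?_, ?_, ?_⟩
  · intro a ha
    obtain ⟨x, y, rfl⟩ := hform a ha
    rw [mul_add, add_mul, ← Algebra.commutes, ← mul_assoc, ← Algebra.commutes y s, mul_assoc, hsℓ,
      mul_assoc]
  · intro a ha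
    obtain ⟨x, y, rfl⟩ := hform a ha
    rw [hσf]
    exact add_mem (Subalgebra.algebraMap_mem _ x) (mul_mem (Subalgebra.algebraMap_mem _ y)
      (sub_mem (Subalgebra.algebraMap_mem _ τ) (Algebra.self_mem_adjoin_singleton F ℓ)))
  · intro a ha
    obtain ⟨x, y, rfl⟩ := hform a ha
    rw [hσf, mul_add, add_mul, ← Algebra.commutes, ← mul_assoc, ← Algebra.commutes y j, mul_assoc,
      hjℓ, mul_assoc]
  · intro a ha
    obtain ⟨x, y, rfl⟩ := hform a ha
    refine ⟨x + x + y * τ, ?_⟩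
    rw [hσf, map_add, map_add, map_mul]
    noncomm_ring
  · intro a ha
    obtain ⟨x, y, rfl⟩ := hform a ha
    refine ⟨x * x + x * y * τ + y * y * ν', ?_⟩
    have e1 : ℓ * (algebraMap F D τ - ℓ) = algebraMap F D ν' := by
      rw [mul_sub, he, ← Algebra.commutes, sub_sub_cancel]
    have e2 : algebraMap F D y * ℓ * (algebraMap F D y * (algebraMap F D τ - ℓ)) =
        algebraMap F D y * algebraMap F D y * algebraMap F D ν' := by
      rw [← e1, mul_assoc, ← mul_assoc ℓ, ← Algebra.commutes y ℓ]
      noncomm_ring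
    rw [hσf, add_mul, mul_add, mul_add, e2, mul_assoc (algebraMap F D y) ℓ, ← Algebra.commutes x ℓ]
    simp only [map_add, map_mul]
    have e3 : algebraMap F D x * algebraMap F D y = algebraMap F D y * algebraMap F D x :=
      Algebra.commutes _ _
    have e4 : algebraMap F D y * (algebraMap F D x * ℓ) =
        algebraMap F D x * algebraMap F D y * ℓ := by rw [e3, mul_assoc]
    rw [e4]
    noncomm_ring
  · exact hσ.mem_range _ hjj (by rw [hσ.map_mul, q.skew, neg_mul_neg])
  · intro a ha haf
    rw [hℓ]
    refine hσ.mem_adjoin_of_fixed q.notMem (ρ := fun x => j * σ x * j⁻¹) ?_ ?_ ?_ hα hβ hα0 ?_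
      (hcen a ha) haf
    · intro x y
      simp only [hσ.map_add]
      noncomm_ring
    · intro z hz y
      simp only [hσ.map_mul]
      have := Subring.mem_center_iff.1 (hσ.map_mem_center hz)
      rw [this (σ y), ← mul_assoc, this j]
      noncomm_ring
    · simp only [hσ.map_one, mul_one, mul_inv_cancel₀ q.ne_zero]
    · rw [← hℓ]
      simp only [hσℓ]
      have : j * (algebraMap F D τ - ℓ) = ℓ * j := by
        rw [mul_sub, hjℓ, ← Algebra.commutes, sub_mul, sub_sub_cancel]
      rw [this, mul_assoc, mul_inv_cancel₀ q.ne_zero, mul_one]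
  · intro a ha haf
    have hsF : s ∉ Set.range (algebraMap F D) := by
      rintro ⟨c, rfl⟩
      exact q.notMem (algebraMap_mem_center c)
    refine mem_adjoin_of_quadratic q.eqn hsF ?_
    have := hσ.mem_adjoin_of_fixed q.notMem (ρ := σ) (α := 1) (β := 0) hσ.map_add ?_ hσ.map_one
      (one_mem _) (zero_mem _) one_ne_zero (by rw [one_mul, add_zero, q.symm]) (hcen a ha) haf
    · rwa [one_mul, add_zero] at this
    · intro z hz y
      rw [hσ.map_mul, Subring.mem_center_iff.1 (hσ.map_mem_center hz)]
  · intro a ha b hb hab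
    by_contra hb0
    have hsa : ∀ a ∈ Algebra.adjoin F {ℓ}, s * a = a * s := by
      intro a ha
      obtain ⟨x, y, rfl⟩ := hform a ha
      rw [mul_add, add_mul, ← Algebra.commutes, ← mul_assoc, ← Algebra.commutes y s, mul_assoc, hsℓ,
        mul_assoc]
    have h1 : b * (s * j) = b * (j * s) := by
      have h2 : b * j = -a := eq_neg_of_add_eq_zero_right hab
      rw [← mul_assoc, ← hsa b hb, mul_assoc, h2, mul_neg, hsa a ha, ← mul_assoc, h2, neg_mul]
    rw [q.conj] at h1
    have h3 := mul_right_cancel₀ q.ne_zero (mul_left_cancel₀ hb0 h1)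
    exact hsep (eq_sub_iff_add_eq.1 h3)

variable {L : Subalgebra F D} (hL : QuaternionData σ s j L)
include hσ q hh hL

/-- The `L`-valued quadratic form `x ↦ [s, h x x] j⁻¹`. -/
noncomputable def QuaternionData.quadraticForm
    (hcomm : ∀ x y : D, s * x = x * s → s * y = y * s → x * y = y * x) :
    letI := L.fieldOfComm hL.comm
    QuadraticForm L V :=
  letI := L.fieldOfComm hL.comm
  have hδ := fun x y => q.toCentralizer_symm hσ hh x y
  have hmemδ : ∀ x y, s * (q.toCentralizer (h x y) : D) = (q.toCentralizer (h x y) : D) * s :=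
    fun x y => mem_centralizer_singleton.1 (q.toCentralizer (h x y)).2
  have hsmul : ∀ (a : L) (x y : V), (q.toCentralizer (h ((a : D) • x) y) : D) =
      a * q.toCentralizer (h x y) := fun a x y => by
    rw [hh.smul_left, q.coe_toCentralizer, q.coe_toCentralizer, ← mul_assoc s, hL.commute a a.2]
    noncomm_ring
  have hadd : ∀ x y z : V, (q.toCentralizer (h (x + y) z) : D) =
      q.toCentralizer (h x z) + q.toCentralizer (h y z) := fun x y z => by
    rw [hh.add_left, map_add]; rfl
  have haddr : ∀ x y z : V, (q.toCentralizer (h z (x + y)) : D) =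
      q.toCentralizer (h z x) + q.toCentralizer (h z y) := fun x y z => by
    rw [hh.add_right hσ, map_add]; rfl
  -- The twisted involution is trivial on `L`, so scalars from `L` leave a hermitian form for it as
  -- squares: the diagonal is a quadratic form over `L`.
  have hconj : ∀ a ∈ L, j * σ a * j⁻¹ = a := fun a ha => by
    rw [hL.conj _ (hL.map_mem a ha), hσ.invol, mul_assoc, mul_inv_cancel₀ q.ne_zero, mul_one]
  have hsmulr : ∀ (a : L) (x y : V), (q.toCentralizer (h x ((a : D) • y)) : D) =
      a * q.toCentralizer (h x y) := fun a x y => by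
    rw [hδ ((a : D) • y) x, hsmul, hσ.map_mul, hδ y x]
    have e : j * (σ (q.toCentralizer (h y x)) * σ a) * j⁻¹ =
        (j * σ (q.toCentralizer (h y x)) * j⁻¹) * (j * σ a * j⁻¹) := by
      have : (j * σ (q.toCentralizer (h y x)) * j⁻¹) * (j * σ a * j⁻¹) =
        j * σ (q.toCentralizer (h y x)) * (j⁻¹ * j) * σ a * j⁻¹ := by noncomm_ring
      rw [this, inv_mul_cancel₀ q.ne_zero]
      noncomm_ring
    rw [e, hconj a a.2, ← hδ y x]
    exact hcomm _ _ (hmemδ x y) (hL.commute a a.2)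
  QuadraticMap.ofPolar
    (fun x => ⟨q.toCentralizer (h x x), hL.mem_of_fixed _ (hmemδ x x) (hδ x x).symm⟩)
    (fun a x => Subtype.ext (by
      change (q.toCentralizer (h ((a : D) • x) ((a : D) • x)) : D) =
        (a : D) * a * q.toCentralizer (h x x)
      rw [hsmul, hsmulr, mul_assoc]))
    (fun x y z => Subtype.ext (by
      change (q.toCentralizer (h (x + y + z) (x + y + z)) : D) -
        (q.toCentralizer (h (x + y) (x + y))) - (q.toCentralizer (h z z)) =
        ((q.toCentralizer (h (x + z) (x + z)) : D) - (q.toCentralizer (h x x)) -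
          (q.toCentralizer (h z z))) +
        ((q.toCentralizer (h (y + z) (y + z)) : D) - (q.toCentralizer (h y y)) -
          (q.toCentralizer (h z z)))
      simp only [hadd, haddr]
      abel))
    (fun a x y => Subtype.ext (by
      change (q.toCentralizer (h ((a : D) • x + y) ((a : D) • x + y)) : D) -
        (q.toCentralizer (h ((a : D) • x) ((a : D) • x))) - (q.toCentralizer (h y y)) =
        (a : D) * ((q.toCentralizer (h (x + y) (x + y)) : D) - (q.toCentralizer (h x x)) -
          (q.toCentralizer (h y y)))
      simp only [hadd, haddr, hsmul, hsmulr]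
      noncomm_ring))

include hn

/-- A zero of the `L`-form has `h x x` symmetric and commuting with `s`, hence in `F + F s`. As
`u(L) ≤ 3n/2`, the `L`-form vanishes on an `L`-subspace of dimension `⌊n/2⌋ + 1`. Its dimension over
`F` exceeds `n`, so the coefficient of `s`, a quadratic form over `F`, has a zero there. -/
theorem QuaternionData.exists_mem_range (hcomm : ∀ x y : D, s * x = x * s → s * y = y * s → x * y = y * x)
    [Module F V] [IsScalarTower F D V] (U : Submodule L V)
    (hU : 3 * n / 2 + 2 * (n / 2) < finrank L U) :
    ∃ x ∈ U, x ≠ 0 ∧ h x x ∈ Set.range (algebraMap F D) := by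
  let _ := L.fieldOfComm hL.comm
  have : FiniteDimensional L D := Module.Finite.of_restrictScalars_finite F _ _
  have : FiniteDimensional L V := Module.Finite.trans D V
  have : FiniteDimensional F V := Module.Finite.trans D V
  have hnL : QuadraticUBound L (3 * n / 2) := hn.extension (by rw [hL.finrank_eq]; omega)
  let β := hL.quadraticForm hσ q hh hcomm
  have hβ : ∀ x, β x = 0 → s * h x x = h x x * s := fun x hx => by
    have h1 : (q.toCentralizer (h x x) : D) = 0 := congrArg Subtype.val hx
    rw [← mem_centralizer_singleton (F := F), ← q.toCentralizer_eq_zero]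
    exact Subtype.ext h1
  obtain ⟨W, hWU, hWk, hW⟩ := exists_submodule_forall_isotropic (E := L) (fun x => β x = 0)
    (QuadraticMap.map_zero _) 1 (3 * n / 2) (fun U hU => hnL.exists_isotropic_mem β U hU)
    (fun x hx => ⟨LinearMap.ker (β.polarBilin x), QuadraticMap.polar_self_eq_zero _ hx,
      (finrank_quotient_ker_le _).trans (by simp),
      fun y hy hy' a => QuadraticMap.map_smul_add_eq_zero _ hx hy' hy a⟩) (n / 2) U hU
  have hsF : LinearIndependent F ![(1 : D), s] := by
    rw [LinearIndependent.pair_iff]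
    intro a b hab
    have hb : b = 0 := by
      by_contra hb
      apply q.notMem
      have : s = algebraMap F D (-(b⁻¹ * a)) := by
        rw [Algebra.algebraMap_eq_smul_one, neg_smul, mul_smul, ← smul_neg,
          eq_inv_smul_iff₀ hb, eq_neg_iff_add_eq_zero, add_comm, hab]
      rw [this]
      exact algebraMap_mem_center _
    subst hb
    simpa using hab
  obtain ⟨g, hg⟩ : ∃ g : D →ₗ[F] F, g 1 = 0 ∧ g s = 1 := by
    let b := Basis.span hsF
    let g₀ : Submodule.span F (Set.range ![(1 : D), s]) →ₗ[F] F := b.coord 1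
    obtain ⟨g, hg⟩ := g₀.exists_extend
    have hgb : ∀ i, g (![(1 : D), s] i) = if i = 1 then 1 else 0 := fun i => by
      have h1 : (b i : D) = ![(1 : D), s] i := congrArg Subtype.val (Basis.span_apply hsF i)
      have h2 : g (b i) = g₀ (b i) := LinearMap.congr_fun hg (b i)
      rw [← h1, h2, Basis.coord_apply, b.repr_self, Finsupp.single_apply]
    exact ⟨g, hgb 0, hgb 1⟩
  have hfin : n < finrank F (W.restrictScalars F) := by
    rw [← Subalgebra.finrank_mul_finrank_restrictScalars, hWk, hL.finrank_eq]
    omega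
  obtain ⟨x, hxW, hx0, hx⟩ := hn.exists_isotropic_mem (hh.quadraticForm hσ g)
    (W.restrictScalars F) hfin
  refine ⟨x, hWU hxW, hx0, ?_⟩
  obtain ⟨a, b, hab⟩ := hL.mem_of_symm (h x x) (hβ x (hW x hxW)) (hh.symm x x).symm
  rw [IsHermitianForm.quadraticForm_apply, hab, map_add, Algebra.algebraMap_eq_smul_one, map_smul,
    hg.1, ← Algebra.smul_def, map_smul, hg.2] at hx
  simp only [smul_eq_mul, mul_zero, mul_one, zero_add] at hx
  rw [hab, hx, map_zero, zero_mul, add_zero]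
  exact ⟨a, rfl⟩

/-- On `Q = L + L j` the involution is canonical, with traces and norms in `F`. This lets vectors
with `h x x ∈ F` be combined with coefficients in `Q`; a `Q`-subspace of dimension `⌊n/4⌋ + 1` of
them has more than `n` dimensions over `F` and contradicts anisotropy. -/
theorem QuaternionData.finrank_le
    (hcomm : ∀ x y : D, s * x = x * s → s * y = y * s → x * y = y * x) (hD : finrank F D = 8)
    [Module F V] [IsScalarTower F D V] (han : ∀ x, h x x = 0 → x = 0) :
    8 * finrank D V ≤ 7 * n := by
  by_contra! hlt
  have hjmem : ∀ a ∈ L, ∃ a' ∈ L, j * a = a' * j := fun a ha => ⟨σ a, hL.map_mem a ha, hL.conj a ha⟩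
  obtain ⟨J, hJ⟩ := hL.sq_mem
  have hjj : j * j ∈ L := hJ ▸ L.algebraMap_mem J
  let Q := L.addMul j hjmem hjj
  have hQ4 : finrank F Q = 4 := by
    rw [Subalgebra.finrank_addMul hL.indep, hL.finrank_eq]
  have hQσ : ∀ x ∈ Q, σ x ∈ Q ∧ x + σ x ∈ Set.range (algebraMap F D) ∧
      x * σ x ∈ Set.range (algebraMap F D) := by
    rintro _ ⟨a, ha, b, hb, rfl⟩
    have e1 : σ (a + b * j) = σ a - b * j := by
      rw [hσ.map_add, hσ.map_mul, q.skew, neg_mul, hL.conj _ (hL.map_mem b hb), hσ.invol,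
        sub_eq_add_neg]
    rw [e1]
    refine ⟨⟨σ a, hL.map_mem a ha, -b, neg_mem hb, by noncomm_ring⟩, ?_, ?_⟩
    · rw [add_add_sub_cancel]
      exact hL.trace_mem a ha
    · obtain ⟨c, hc⟩ := hL.norm_mem a ha
      obtain ⟨d, hd⟩ := hL.norm_mem b hb
      have hab : a * b = b * a := congrArg Subtype.val (hL.comm ⟨a, ha⟩ ⟨b, hb⟩)
      refine ⟨c - d * J, ?_⟩
      have e2 : (a + b * j) * (σ a - b * j) =
          a * σ a - (a * b) * j + b * (j * σ a) - b * (j * b) * j := by noncomm_ring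
      rw [e2, hL.conj _ (hL.map_mem a ha), hL.conj b hb, hσ.invol, map_sub, map_mul, hc, hd, hJ, hab]
      noncomm_ring
  have hLQ : L ≤ Q := fun a ha => ⟨a, ha, 0, zero_mem _, by simp⟩
  let _ := Q.divisionRing
  have hQ2 : finrank Q D = 2 := by
    have := finrank_mul_finrank F Q D
    rw [hQ4, hD] at this
    omega
  have : FiniteDimensional Q D := Module.Finite.of_restrictScalars_finite F _ _
  have : FiniteDimensional Q V := Module.Finite.trans D V
  have : FiniteDimensional F V := Module.Finite.trans D V
  -- Over `Q` the threshold of `exists_mem_range` is halved, to at most `5n/4`. The further `⌊n/4⌋`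
  -- dimensions cost two each, giving at most `7n/4`, and `dim_Q V = 2 dim_D V`.
  have key := exists_submodule_forall_isotropic (E := Q) (V := V)
    (fun x => h x x ∈ Set.range (algebraMap F D)) ⟨0, by rw [hh.zero_left, map_zero]⟩ 1
    ((3 * n / 2 + 2 * (n / 2)) / 2) ?_ ?_ (n / 4) ⊤ ?_
  · obtain ⟨W, -, hWk, hW⟩ := key
    have hfin : n < finrank F (W.restrictScalars F) := by
      rw [← Subalgebra.finrank_mul_finrank_restrictScalars, hWk, hQ4]
      omega
    obtain ⟨g, hg⟩ := exists_linearMap_algebraMap_eq (F := F) (D := D)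
    obtain ⟨x, hxW, hx0, hx⟩ := hn.exists_isotropic_mem (hh.quadraticForm hσ g)
      (W.restrictScalars F) hfin
    obtain ⟨a, ha⟩ := hW x hxW
    rw [IsHermitianForm.quadraticForm_apply, ← ha, hg] at hx
    exact hx0 (han x (by rw [← ha, hx, map_zero]))
  · intro U hU
    let U' : Submodule L V :=
      { U.toAddSubmonoid with smul_mem' := fun a x hx => U.smul_mem ⟨a, hLQ a.2⟩ hx }
    refine hL.exists_mem_range hσ q hn hh hcomm U' ?_
    have h1 := Subalgebra.finrank_mul_finrank_restrictScalars L U'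
    have h2 := Subalgebra.finrank_mul_finrank_restrictScalars Q U
    have h3 : U'.restrictScalars F = U.restrictScalars F := rfl
    rw [h3, ← h2, hL.finrank_eq, hQ4] at h1
    omega
  · intro x hx
    obtain ⟨T, hT, hT1⟩ := hh.exists_submodule_mem hQ2 x
    obtain ⟨c, hc⟩ := hx
    refine ⟨T, (hT x).2 (hc ▸ Q.algebraMap_mem c), hT1, ?_⟩
    rintro y hy ⟨d, hd⟩ a
    -- The value at `a x + y` is `h x x · a σ(a) + h y y + (z + σ z)` with `z = h y x σ(a)`: a norm
    -- and a trace from `Q`.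
    have hz : h y x * σ a ∈ Q := mul_mem ((hT y).1 hy) (hQσ a a.2).1
    obtain ⟨e, he⟩ := (hQσ _ hz).2.1
    obtain ⟨f, hf⟩ := (hQσ a a.2).2.2
    refine ⟨c * f + d + e, ?_⟩
    change _ = h ((a : D) • x + y) ((a : D) • x + y)
    rw [hσ.map_mul, hσ.invol, ← hh.symm] at he
    rw [hh.add_left, hh.add_right hσ, hh.add_right hσ, hh.smul_left, hh.smul_left,
      hh.smul_right hσ, hh.smul_right hσ, ← hd, ← hc, map_add, map_add, map_mul, hf, he,
      Algebra.commutes c (σ a), Algebra.commutes c (_ * _)]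
    noncomm_ring
  · rw [finrank_top]
    have := finrank_mul_finrank Q D V
    rw [hQ2] at this
    omega

end Degree2

/-- Hermitian forms over a quaternion division algebra with unitary involution. -/
theorem IsHermitianForm.finrank_le_of_finrank_eq_eight {F D : Type*} [Field F] [DivisionRing D]
    [Algebra F D] (hD : finrank F D = 8) {σ : D → D} (hσ : IsUnitaryInvolution F σ) {n : ℕ}
    (hn : QuadraticUBound F n) {V : Type*} [AddCommGroup V] [Module D V] [FiniteDimensional D V]
    {h : V → V → D} (hh : IsHermitianForm σ h) (han : ∀ x, h x x = 0 → x = 0) :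
    8 * finrank D V ≤ 7 * n := by
  have : FiniteDimensional F D := FiniteDimensional.of_finrank_pos (by omega)
  have h4 : finrank (Subring.center D) D = 4 := by
    have := hσ.finrank_eq_two_mul
    omega
  have := hσ.finiteDimensional_center
  obtain ⟨s, τ, ν, hs, hsc, he, hsep⟩ := hσ.exists_separable_symm h4
  obtain ⟨j, q⟩ := QuadraticPair.exists_of_symm hσ hs he hsc
  obtain ⟨L, hL⟩ := q.exists_quaternionData hσ h4 hsep
  let _ : Module F V := Module.compHom V (algebraMap F D)
  have : IsScalarTower F D V := ⟨fun a x v => by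
    rw [Algebra.smul_def, mul_smul]; rfl⟩
  exact hL.finrank_le hσ q hn hh (fun x y => q.centralizer_comm h4) hD han

/-! ### Splitting a central division algebra; the reduced trace -/

section Splitting

open TensorProduct

/-- A nonzero left subspace of `D^(ι)` that is stable under right multiplication by the elements of
`X` contains a nonzero vector with coordinates in the centralizer of `X`. -/
theorem exists_ne_zero_forall_commute {D : Type*} [DivisionRing D] {ι : Type*}
    (R : Submodule D (ι →₀ D)) (X : Set D)
    (hX : ∀ x ∈ X, ∀ c ∈ R, c.mapRange (· * x) (zero_mul x) ∈ R) (hR : R ≠ ⊥) :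
    ∃ c ∈ R, c ≠ 0 ∧ ∀ i, ∀ x ∈ X, x * c i = c i * x := by
  obtain ⟨c₀, hc₀⟩ := Submodule.exists_mem_ne_zero_of_ne_bot hR
  -- Choose a nonzero vector of minimal support and normalize it to `d` with one coordinate `1`.
  -- Then `x d - d x` lies in `R` and vanishes at that coordinate, so it has smaller support and is
  -- zero.
  obtain ⟨c, ⟨hcR, hc0⟩, hmin⟩ := WellFounded.has_min
    (InvImage.wf (fun c : ι →₀ D => c.support.card) Nat.lt_wfRel.wf)
    {c | c ∈ R ∧ c ≠ 0} ⟨c₀, hc₀⟩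
  obtain ⟨i₀, hi₀⟩ : ∃ i, c i ≠ 0 := by
    by_contra! H
    exact hc0 (Finsupp.ext H)
  have hd0 : (c i₀)⁻¹ • c ≠ 0 := smul_ne_zero (inv_ne_zero hi₀) hc0
  refine ⟨(c i₀)⁻¹ • c, R.smul_mem _ hcR, hd0, fun i x hx => ?_⟩
  set d := (c i₀)⁻¹ • c with hd
  have hdR : d ∈ R := R.smul_mem _ hcR
  have hdi : d i₀ = 1 := by
    rw [hd, Finsupp.smul_apply, smul_eq_mul, inv_mul_cancel₀ hi₀]
  have heR : x • d - d.mapRange (· * x) (zero_mul x) ∈ R :=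
    R.sub_mem (R.smul_mem _ hdR) (hX x hx d hdR)
  have he0 : x • d - d.mapRange (· * x) (zero_mul x) = 0 := by
    by_contra hne
    refine hmin _ ⟨heR, hne⟩ (Finset.card_lt_card ?_)
    rw [Finset.ssubset_iff_of_subset]
    · refine ⟨i₀, Finsupp.mem_support_iff.2 hi₀, ?_⟩
      simp [hdi]
    · intro k hk
      rw [Finsupp.mem_support_iff] at hk ⊢
      intro hck
      apply hk
      simp [hd, hck]
  have := DFunLike.congr_fun he0 i
  simpa [sub_eq_zero] using this

variable {K D : Type*} [Field K] [DivisionRing D] [Algebra K D] [Algebra.IsCentral K D]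

/-- In coordinates for a `K`-basis of `Ω`, a two-sided ideal is a left `D`-subspace stable under
right multiplication by `D`. If nonzero, it contains a vector with coordinates in the centre `K`,
which is `μ ⊗ 1` with `μ ≠ 0`, a unit. -/
theorem isSimpleRing_tensorProduct (Ω : Type*) [Field Ω] [Algebra K Ω] :
    IsSimpleRing (Ω ⊗[K] D) := by
  classical
  have hnt : Nontrivial (Ω ⊗[K] D) := inferInstance
  refine IsSimpleRing.of_eq_bot_or_eq_top fun I => ?_
  by_contra! H
  obtain ⟨hbot, htop⟩ := H
  let b := Basis.ofVectorSpace K Ω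
  let e := TensorProduct.equivFinsuppOfBasisLeft (N := D) b
  have hsymm : ∀ c, e.symm c = c.sum fun i n => b i ⊗ₜ[K] n :=
    TensorProduct.equivFinsuppOfBasisLeft_symm_apply b
  have hleft : ∀ (d : D) c, e.symm (d • c) = (1 ⊗ₜ[K] d) * e.symm c := by
    intro d c
    rw [hsymm, hsymm, Finsupp.sum_smul_index' (by simp), Finsupp.mul_sum]
    simp [Finsupp.sum]
  have hright : ∀ (d : D) c, e.symm (c.mapRange (· * d) (zero_mul d)) =
      e.symm c * (1 ⊗ₜ[K] d) := by
    intro d c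
    rw [hsymm, hsymm, Finsupp.sum_mapRange_index (by simp), Finsupp.sum_mul]
    simp [Finsupp.sum]
  let R : Submodule D (_ →₀ D) :=
    { carrier := {c | e.symm c ∈ I}
      add_mem' := fun {c d} hc hd => by
        change e.symm (c + d) ∈ I
        rw [map_add]
        exact I.add_mem hc hd
      zero_mem' := by
        change e.symm 0 ∈ I
        rw [map_zero]
        exact I.zero_mem
      smul_mem' := fun d c hc => by
        change e.symm (d • c) ∈ I
        rw [hleft]
        exact I.mul_mem_left _ _ hc }
  obtain ⟨c, hcR, hc0, hc⟩ := exists_ne_zero_forall_commute R Set.univ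
    (fun d _ c hc => by
      change e.symm _ ∈ I
      rw [hright]
      exact I.mul_mem_right _ _ hc)
    (by
      rintro hR
      apply hbot
      rw [eq_bot_iff]
      intro x hx
      have h1 : e x ∈ R := by
        change e.symm (e x) ∈ I
        rwa [e.symm_apply_apply]
      rw [hR, Submodule.mem_bot] at h1
      rw [TwoSidedIdeal.mem_bot]
      exact e.map_eq_zero_iff.1 h1)
  have hcK : ∀ i, ∃ k : K, algebraMap K D k = c i := fun i => by
    have h1 : c i ∈ Subalgebra.center K D := Subalgebra.mem_center_iff.2 fun x => hc i x trivial
    obtain ⟨k, hk⟩ := Algebra.IsCentral.mem_center_iff K |>.1 h1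
    exact ⟨k, hk.symm⟩
  choose k hk using hcK
  have h1 : e.symm c = (∑ i ∈ c.support, k i • b i) ⊗ₜ[K] (1 : D) := by
    rw [hsymm, TensorProduct.sum_tmul]
    refine Finset.sum_congr rfl fun i _ => ?_
    rw [← hk i, Algebra.algebraMap_eq_smul_one]
    exact (TensorProduct.smul_tmul (k i) (b i) (1 : D)).symm
  have hμ : ∑ i ∈ c.support, k i • b i ≠ 0 := by
    intro h0
    rw [h0, TensorProduct.zero_tmul] at h1
    exact hc0 (e.symm.map_eq_zero_iff.1 h1)
  apply htop
  rw [← TwoSidedIdeal.one_mem_iff]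
  have h2 : (1 : Ω ⊗[K] D) = ((∑ i ∈ c.support, k i • b i)⁻¹ ⊗ₜ[K] (1 : D)) * e.symm c := by
    rw [h1, Algebra.TensorProduct.tmul_mul_tmul, inv_mul_cancel₀ hμ, one_mul]
    rfl
  rw [h2]
  exact I.mul_mem_left _ _ hcR

theorem LinearIndependent.one_tmul {K D Ω : Type*} [Field K] [Field Ω] [Algebra K Ω] [AddCommGroup D]
    [Module K D] {ι : Type*} [Fintype ι] {v : ι → D} (hv : LinearIndependent K v) :
    LinearIndependent Ω fun i => (1 : Ω) ⊗ₜ[K] v i := by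
  classical
  obtain ⟨l, hl⟩ := LinearMap.exists_leftInverse_of_injective (Finsupp.linearCombination K v)
    (LinearMap.ker_eq_bot.2 hv)
  have hlv : ∀ i j, l (v j) i = if j = i then 1 else 0 := fun i j => by
    have := LinearMap.congr_fun hl (Finsupp.single j 1)
    simp only [LinearMap.comp_apply, Finsupp.linearCombination_single, one_smul,
      LinearMap.id_apply] at this
    rw [this, Finsupp.single_apply]
  rw [Fintype.linearIndependent_iff]
  intro g hg i
  have := congrArg (TensorProduct.rid K Ω ∘ (((Finsupp.lapply i).comp l).baseChange Ω)) hg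
  simpa [hlv, TensorProduct.smul_tmul', TensorProduct.rid_tmul] using this

theorem Polynomial.eq_zero_of_aeval_eq_zero_of_linearIndependent {R A : Type*} [CommRing R] [Ring A]
    [Algebra R A] {x : A} {n : ℕ} (h : LinearIndependent R fun i : Fin n => x ^ (i : ℕ))
    {p : Polynomial R} (hp : p.natDegree < n) (h0 : Polynomial.aeval x p = 0) : p = 0 := by
  rw [Polynomial.aeval_eq_sum_range' hp, Finset.sum_range fun i => p.coeff i • x ^ i] at h0
  have := Fintype.linearIndependent_iff.1 h (fun i => p.coeff i) h0
  ext k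
  by_cases hk : k < n
  · exact this ⟨k, hk⟩
  · rw [Polynomial.coeff_eq_zero_of_natDegree_lt (by omega), Polynomial.coeff_zero]

variable (K D) in
/-- The dimension of a central division algebra is a square `n²`, degrees of elements are at most
`n`, and there is a reduced trace. -/
theorem exists_reducedTrace [FiniteDimensional K D] : ∃ n : ℕ, finrank K D = n * n ∧
    (∀ x : D, (minpoly K x).natDegree ≤ n) ∧
    ∃ T : D →ₗ[K] AlgebraicClosure K, (∀ x y, T (x * y) = T (y * x)) ∧
      ∀ (x : D) (a : Fin n → K) (i : Fin n), (i : ℕ) + 1 = n →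
        LinearIndependent K (fun i : Fin n => x ^ (i : ℕ)) → x ^ n = ∑ i, a i • x ^ (i : ℕ) →
        T x = algebraMap K (AlgebraicClosure K) (a i) := by
  let Ω := AlgebraicClosure K
  have hsimple : IsSimpleRing (Ω ⊗[K] D) := isSimpleRing_tensorProduct Ω
  obtain ⟨n, hn, ⟨φ⟩⟩ := IsSimpleRing.exists_algEquiv_matrix_of_isAlgClosed Ω (Ω ⊗[K] D)
  let ρ : D →ₐ[K] Matrix (Fin n) (Fin n) Ω :=
    (φ.toAlgHom.restrictScalars K).comp Algebra.TensorProduct.includeRight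
  have hρ : ∀ x, ρ x = φ (1 ⊗ₜ[K] x) := fun _ => rfl
  -- Independence of powers survives extension to `Ω`, so Cayley–Hamilton over `Ω` controls
  -- equations over `K`.
  have hli : ∀ {r : ℕ} {x : D}, LinearIndependent K (fun i : Fin r => x ^ (i : ℕ)) →
      LinearIndependent Ω (fun i : Fin r => ρ x ^ (i : ℕ)) := by
    intro r x hx
    rw [Fintype.linearIndependent_iff]
    intro g hg i
    refine Fintype.linearIndependent_iff.1 (LinearIndependent.one_tmul (Ω := Ω) hx) g
      (φ.injective ?_) i
    rw [map_sum, map_zero, ← hg]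
    refine Finset.sum_congr rfl fun k _ => ?_
    rw [map_smul, ← map_pow]
    rfl
  have hdeg : ∀ x, (ρ x).charpoly.natDegree = n := fun x => by
    rw [Matrix.charpoly_natDegree_eq_dim, Fintype.card_fin]
  refine ⟨n, ?_, fun x => ?_, ((Matrix.traceLinearMap (Fin n) Ω Ω).restrictScalars K).comp
    ρ.toLinearMap, fun x y => ?_, fun x a i hi hx hsum => ?_⟩
  · have h1 := φ.toLinearEquiv.finrank_eq
    rw [finrank_baseChange, finrank_matrix, Fintype.card_fin, finrank_self, mul_one] at h1
    exact h1
  · by_contra! hlt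
    have h1 := Polynomial.eq_zero_of_aeval_eq_zero_of_linearIndependent
      (hli (linearIndependent_pow (K := K) x)) (p := (ρ x).charpoly) (by rw [hdeg]; exact hlt)
      (Matrix.aeval_self_charpoly _)
    exact (Matrix.charpoly_monic (ρ x)).ne_zero h1
  · change Matrix.trace (ρ (x * y)) = Matrix.trace (ρ (y * x))
    rw [map_mul, map_mul, Matrix.trace_mul_comm]
  · change Matrix.trace (ρ x) = _
    let r : Polynomial Ω := ∑ i : Fin n, Polynomial.C (algebraMap K Ω (a i)) * Polynomial.X ^ (i : ℕ)
    have hr : r.degree < n := Polynomial.degree_sum_fin_lt fun i => algebraMap K Ω (a i)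
    -- Both polynomials are monic of degree `n` and annihilate `ρ x`. Their difference has degree
    -- below `n` and vanishes by independence of the powers, so the trace is read off from the given
    -- equation.
    have hr' : (ρ x).charpoly = Polynomial.X ^ n - r := by
      by_contra hne
      have hne' : (ρ x).charpoly - (Polynomial.X ^ n - r) ≠ 0 := sub_ne_zero.2 hne
      apply hne'
      refine Polynomial.eq_zero_of_aeval_eq_zero_of_linearIndependent (hli hx) ?_ ?_
      · rw [Polynomial.natDegree_lt_iff_degree_lt hne']
        have hm := Polynomial.monic_X_pow_sub (n := n) hr
        have hd : (Polynomial.X ^ n - r).degree = (n : WithBot ℕ) := by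
          rw [Polynomial.degree_sub_eq_left_of_degree_lt (by rwa [Polynomial.degree_X_pow]),
            Polynomial.degree_X_pow]
        have hcd : (ρ x).charpoly.degree = (n : WithBot ℕ) := by
          rw [Matrix.charpoly_degree_eq_dim, Fintype.card_fin]
        have := Polynomial.degree_sub_lt_left (hcd.trans hd.symm)
          (Matrix.charpoly_monic (ρ x)).ne_zero
          ((Matrix.charpoly_monic (ρ x)).leadingCoeff.trans hm.leadingCoeff.symm)
        rwa [hcd] at this
      · have h1 := congrArg ρ hsum
        rw [map_pow, map_sum] at h1
        rw [map_sub, Matrix.aeval_self_charpoly, map_sub, map_pow, Polynomial.aeval_X, h1, map_sum,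
          zero_sub, neg_eq_zero, sub_eq_zero]
        refine Finset.sum_congr rfl fun i _ => ?_
        rw [map_smul, map_pow, map_mul, Polynomial.aeval_C, map_pow, Polynomial.aeval_X,
          ← Algebra.smul_def, algebraMap_smul]
    have : Nonempty (Fin n) := ⟨i⟩
    have hin : n - 1 = (i : ℕ) := by omega
    rw [Matrix.trace_eq_neg_charpoly_coeff, hr', Fintype.card_fin, Polynomial.coeff_sub,
      Polynomial.coeff_X_pow, if_neg (by omega), zero_sub, neg_neg, Polynomial.finsetSum_coeff, hin]
    simp only [Polynomial.coeff_C_mul, Polynomial.coeff_X_pow]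
    rw [Finset.sum_eq_single i]
    · simp; rfl
    · intro k _ hk
      rw [if_neg (fun h => hk (Fin.ext h.symm)), mul_zero]
    · simp

end Splitting

/-! ### Degree four: existence of a quadratic symmetric element -/

section Degree4

variable {F D : Type*} [Field F] [DivisionRing D] [Algebra F D] {σ : D → D}

theorem IsUnitaryInvolution.conj (hσ : IsUnitaryInvolution F σ) {w : D} (hw0 : w ≠ 0)
    (hw : σ w = w) : IsUnitaryInvolution F fun x => w⁻¹ * σ x * w := by
  have hc : ∀ z ∈ Subring.center D, w⁻¹ * σ z * w = σ z := fun z hz => by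
    rw [Subring.mem_center_iff.1 (hσ.map_mem_center hz), mul_assoc, inv_mul_cancel₀ hw0, mul_one]
  refine ⟨fun x y => ?_, fun x y => ?_, fun x => ?_, fun a => ?_, fun x hx hxf => ?_, ?_⟩
  · rw [hσ.map_add]
    noncomm_ring
  · have : w⁻¹ * σ y * w * (w⁻¹ * σ x * w) = w⁻¹ * σ y * (w * w⁻¹) * σ x * w := by noncomm_ring
    rw [this, mul_inv_cancel₀ hw0, mul_one, hσ.map_mul]
    noncomm_ring
  · rw [hσ.map_mul, hσ.map_mul, hσ.invol, hσ.map_inv, hw]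
    have : w⁻¹ * (w * (x * w⁻¹)) * w = w⁻¹ * w * x * (w⁻¹ * w) := by noncomm_ring
    rw [this, inv_mul_cancel₀ hw0, one_mul, mul_one]
  · rw [hc _ (algebraMap_mem_center a), hσ.map_algebraMap]
  · exact hσ.mem_range x hx (by rwa [hc x hx] at hxf)
  · obtain ⟨t, ht, hne⟩ := hσ.exists_ne
    exact ⟨t, ht, by rwa [hc t ht]⟩

/-- For `w ≠ 0` the forms `h` and `h w` have the same isotropic vectors, so the involution may be
changed by a symmetric `w` without affecting dimension bounds. -/
theorem IsHermitianForm.conj (hσ : IsUnitaryInvolution F σ) {w : D} (hw0 : w ≠ 0)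
    (hw : σ w = w) {V : Type*} [AddCommGroup V] [Module D V] {h : V → V → D}
    (hh : IsHermitianForm σ h) :
    IsHermitianForm (fun x => w⁻¹ * σ x * w) fun x y => h x y * w := by
  refine ⟨fun x y z => ?_, fun a x y => ?_, fun x y => ?_⟩
  · rw [hh.add_left, add_mul]
  · rw [hh.smul_left, mul_assoc]
  · rw [hσ.map_mul, hw, ← hh.symm, ← mul_assoc, inv_mul_cancel₀ hw0, one_mul]

/-- The "second derivation" trick: if no symmetric noncentral element is quadratic, then some
skew `y` satisfies `[a, [a, y]] ≠ 0`. -/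
theorem IsUnitaryInvolution.exists_skew_commutator_ne (hσ : IsUnitaryInvolution F σ) {a : D}
    (hac : a ∉ Subring.center D) (hq : a * a ∉ Subring.center D) :
    ∃ y, σ y = -y ∧ a * (a * y - y * a) ≠ (a * y - y * a) * a := by
  by_contra! H
  obtain ⟨t, ht, hne⟩ := hσ.exists_ne
  have hδ0 : t - σ t ≠ 0 := sub_ne_zero.2 hne.symm
  have hδc : t - σ t ∈ Subring.center D := sub_mem ht (hσ.map_mem_center ht)
  have hδ : σ (t - σ t) = -(t - σ t) := by rw [hσ.map_sub, hσ.invol, neg_sub]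
  have hcc := Subring.mem_center_iff.1 hδc
  have htc := Subring.mem_center_iff.1 ht
  have hcomm : ∀ z : D, (∀ g, g * z = z * g) → ∀ x, a * (z * x) - z * x * a = z * (a * x - x * a) :=
    fun z hz x => by
      rw [mul_sub, ← mul_assoc, hz, mul_assoc, mul_assoc]
  -- A symmetric `b` becomes skew when multiplied by the central skew element `t - σ t`, which
  -- factors out of commutators.
  have hsymm : ∀ b, σ b = b → a * (a * b - b * a) = (a * b - b * a) * a := by
    intro b hb
    have h1 := H ((t - σ t) * b) (by rw [hσ.map_mul, hb, hδ, mul_neg, hcc])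
    rw [hcomm _ hcc, ← mul_assoc, hcc, mul_assoc, mul_assoc] at h1
    exact mul_left_cancel₀ hδ0 h1
  have hall : ∀ x, a * (a * x - x * a) = (a * x - x * a) * a := by
    intro x
    obtain ⟨b, c, hb, hc, rfl⟩ := hσ.exists_eq_add_mul ht hne x
    have e : a * (b + t * c) - (b + t * c) * a = (a * b - b * a) + t * (a * c - c * a) := by
      rw [← hcomm t htc c]
      noncomm_ring
    rw [e, mul_add, add_mul, hsymm b hb, ← mul_assoc, htc, mul_assoc, hsymm c hc, mul_assoc]
  obtain ⟨y, hy⟩ : ∃ y, y * a ≠ a * y := by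
    by_contra! h
    exact hac (Subring.mem_center_iff.2 h)
  have hy0 : a * y - y * a ≠ 0 := sub_ne_zero.2 hy.symm
  -- Now `[a, [a, ·]]` vanishes identically. By the Leibniz rule its value at `y²` is `2 [a, y]²`,
  -- so `2 = 0`; and then `[a, [a, x]] = [a², x]`, which makes `a²` central.
  have h2 : (2 : D) = 0 := by
    have e1 := hall (y * y)
    have e2 : a * (y * y) - y * y * a = (a * y - y * a) * y + y * (a * y - y * a) := by
      noncomm_ring
    rw [e2] at e1
    have e3 : a * ((a * y - y * a) * y + y * (a * y - y * a)) -
        ((a * y - y * a) * y + y * (a * y - y * a)) * a =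
        (a * (a * y - y * a) - (a * y - y * a) * a) * y +
        2 * ((a * y - y * a) * (a * y - y * a)) +
        y * (a * (a * y - y * a) - (a * y - y * a) * a) := by noncomm_ring
    rw [e1, sub_self, hall y, sub_self, zero_mul, mul_zero, zero_add, add_zero] at e3
    by_contra h2
    exact mul_ne_zero h2 (mul_ne_zero hy0 hy0) e3.symm
  refine hq (Subring.mem_center_iff.2 fun x => ?_)
  have e1 := sub_eq_zero.2 (hall x)
  have e2 : a * (a * x - x * a) - (a * x - x * a) * a =
      (a * a * x - x * (a * a)) - 2 * (a * x * a) + 2 * (x * (a * a)) := by noncomm_ring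
  rw [e2, h2, zero_mul, zero_mul, sub_zero, add_zero] at e1
  exact (sub_eq_zero.1 e1).symm

/-- In a division algebra of degree `4`, a symmetric noncentral element that is quadratic over `F`
exists after a change of the involution. -/
theorem IsUnitaryInvolution.exists_quadratic_symm [FiniteDimensional F D]
    (hσ : IsUnitaryInvolution F σ) (h16 : finrank (Subring.center D) D = 16) :
    ∃ w, w ≠ 0 ∧ σ w = w ∧ ∃ s, ∃ τ ν : F, w⁻¹ * σ s * w = s ∧ s ∉ Subring.center D ∧
      s * s = algebraMap F D τ * s - algebraMap F D ν := by
  -- The aim is an element `x`, fixed by one of the involutions, such that `x` and `x⁻¹` both have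
  -- reduced trace zero. Its quartic equation is then biquadratic, so `x²` is quadratic.
  by_contra! H
  have := hσ.finiteDimensional_center
  obtain ⟨n, hn, hdeg, T, hT, hTtr⟩ := exists_reducedTrace (Subring.center D) D
  obtain rfl : n = 4 := by
    rw [h16] at hn
    nlinarith
  let ι : F → AlgebraicClosure (Subring.center D) := fun a =>
    algebraMap (Subring.center D) _ ⟨algebraMap F D a, algebraMap_mem_center a⟩
  have hι0 : ∀ a, ι a = 0 → a = 0 := fun a ha => by
    have h1 := (map_eq_zero _).1 ha
    have h2 : algebraMap F D a = 0 := congrArg Subtype.val h1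
    exact (map_eq_zero _).1 h2
  have hιmul : ∀ a (x : D), T (algebraMap F D a * x) = ι a * T x := fun a x => by
    have h1 := T.map_smul ⟨algebraMap F D a, algebraMap_mem_center a⟩ x
    rw [Algebra.smul_def, Algebra.smul_def] at h1
    exact h1
  -- The degree of such an `x` divides `16`, is at most `4`, and is neither `1` nor, by `H`, `2`. So
  -- its minimal equation is the reduced quartic, with coefficients and trace in `F`.
  have key : ∀ w, w ≠ 0 → σ w = w → ∀ x, w⁻¹ * σ x * w = x → x ∉ Subring.center D →
      LinearIndependent (Subring.center D) (fun i : Fin 4 => x ^ (i : ℕ)) ∧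
      ∃ a : Fin 4 → F, x ^ 4 = ∑ i, a i • x ^ (i : ℕ) ∧ T x = ι (a 3) := by
    intro w hw0 hw x hx hxc
    have hσw := hσ.conj hw0 hw
    have h4 : (minpoly (Subring.center D) x).natDegree = 4 := by
      have h1 := natDegree_minpoly_dvd (F := Subring.center D) x
      rw [h16] at h1
      have h2 := hdeg x
      have h3 : (minpoly (Subring.center D) x).natDegree ≠ 1 := fun h => by
        obtain ⟨z, rfl⟩ := mem_range_algebraMap_of_natDegree_minpoly_eq_one _ h
        exact hxc z.2
      have h5 : (minpoly (Subring.center D) x).natDegree ≠ 2 := fun h => by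
        obtain ⟨τ, ν, he⟩ := hσw.exists_quadratic hx h
        exact H w hw0 hw x τ ν hx hxc he
      interval_cases (minpoly (Subring.center D) x).natDegree <;> omega
    have hli := linearIndependent_pow (K := Subring.center D) x
    rw [h4] at hli
    obtain ⟨a, ha⟩ := hσw.exists_pow_eq_sum hx h4
    refine ⟨hli, a, ha, hTtr x (fun i => ⟨algebraMap F D (a i), algebraMap_mem_center _⟩) 3 rfl hli
      (ha.trans (Finset.sum_congr rfl fun i _ => ?_))⟩
    rw [Algebra.smul_def (a i)]
    rfl
  obtain ⟨a, ha, hac⟩ := hσ.exists_symm_notMem_center (center_ne_top_of_finrank_ne_one (by omega))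
  have hq : a * a ∉ Subring.center D := fun h => by
    obtain ⟨c, hc⟩ := hσ.mem_range _ h (by rw [hσ.map_mul, ha])
    refine H 1 one_ne_zero hσ.map_one a 0 (-c) (by rw [inv_one, one_mul, mul_one, ha]) hac ?_
    rw [_root_.map_zero, zero_mul, _root_.map_neg, hc, zero_sub, neg_neg]
  obtain ⟨y, hy, hyz⟩ := hσ.exists_skew_commutator_ne hac hq
  obtain ⟨z, hz⟩ : ∃ z, z = a * y - y * a := ⟨_, rfl⟩
  rw [← hz] at hyz
  have hz0 : z ≠ 0 := by
    rintro rfl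
    simp at hyz
  have hσz : σ z = z := by
    rw [hz, hσ.map_sub, hσ.map_mul, hσ.map_mul, ha, hy]
    noncomm_ring
  have hzi0 : z⁻¹ ≠ 0 := inv_ne_zero hz0
  have hσzi : σ z⁻¹ = z⁻¹ := by rw [hσ.map_inv, hσz]
  have hnfix : ∀ m, σ m = m → (z⁻¹)⁻¹ * σ (m * z⁻¹) * z⁻¹ = m * z⁻¹ := fun m hm => by
    rw [hσ.map_mul, hσzi, hm, inv_inv, ← mul_assoc, mul_inv_cancel₀ hz0, one_mul]
  have hncen : ∀ m, m ≠ 0 → a * m = m * a → m * z⁻¹ ∉ Subring.center D := by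
    intro m hm0 hma hmc
    have h1 : m = m * z⁻¹ * z := by rw [mul_assoc, inv_mul_cancel₀ hz0, mul_one]
    have hk := Subring.mem_center_iff.1 hmc
    have hk0 : m * z⁻¹ ≠ 0 := mul_ne_zero hm0 hzi0
    rw [h1, ← mul_assoc, hk a, mul_assoc, mul_assoc _ z a] at hma
    exact hyz (mul_left_cancel₀ hk0 hma)
  have ha0 : a ≠ 0 := fun h => hac (h ▸ zero_mem _)
  obtain ⟨-, a₁, -, hT₁⟩ := key z⁻¹ hzi0 hσzi (1 * z⁻¹) (hnfix 1 hσ.map_one)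
    (hncen 1 one_ne_zero (by simp))
  obtain ⟨-, a₂, -, hT₂⟩ := key z⁻¹ hzi0 hσzi (a * z⁻¹) (hnfix a ha) (hncen a ha0 rfl)
  -- The functional `m ↦ T (m z⁻¹)` is `F`-linear on the plane `F + F a` and takes values in the
  -- copy of `F`, so it has a nonzero kernel.
  obtain ⟨m, hm0, hσm, hma, hTm⟩ : ∃ m, m ≠ 0 ∧ σ m = m ∧ a * m = m * a ∧ T (m * z⁻¹) = 0 := by
    by_cases h0 : a₁ 3 = 0
    · refine ⟨1, one_ne_zero, hσ.map_one, by simp, ?_⟩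
      rw [hT₁, h0]
      simp [ι]
    · refine ⟨algebraMap F D (a₁ 3) * a - algebraMap F D (a₂ 3), ?_, ?_, ?_, ?_⟩
      · intro h
        apply hac
        rw [(eq_inv_mul_iff_mul_eq₀ (by simpa using h0)).2 (sub_eq_zero.1 h)]
        exact mul_mem (inv_mem_center (algebraMap_mem_center _)) (algebraMap_mem_center _)
      · rw [hσ.map_sub, hσ.map_mul, hσ.map_algebraMap, hσ.map_algebraMap, ha, Algebra.commutes]
      · rw [mul_sub, sub_mul, ← mul_assoc, ← Algebra.commutes, ← Algebra.commutes (a₂ 3) a]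
      · rw [sub_mul, mul_assoc, _root_.map_sub, hιmul, hιmul, hT₂, ← one_mul z⁻¹, hT₁, mul_comm, sub_self]
  obtain ⟨x, hx⟩ : ∃ x, x = m * z⁻¹ := ⟨_, rfl⟩
  have hx0 : x ≠ 0 := hx ▸ mul_ne_zero hm0 hzi0
  have hxc : x ∉ Subring.center D := hx ▸ hncen m hm0 hma
  have hxf : (z⁻¹)⁻¹ * σ x * z⁻¹ = x := hx ▸ hnfix m hσm
  -- Because `m` commutes with `a`, `x⁻¹ = [a, y] m⁻¹` is a commutator and has trace zero.
  have hxi : x⁻¹ = a * (y * m⁻¹) - y * m⁻¹ * a := by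
    have h1 : a * m⁻¹ = m⁻¹ * a := (Commute.inv_right₀ (show Commute _ _ from hma)).eq
    rw [hx, mul_inv_rev, inv_inv, hz, sub_mul, mul_assoc, mul_assoc, mul_assoc, h1]
  obtain ⟨hli, b, hb, hTb⟩ := key z⁻¹ hzi0 hσzi x hxf hxc
  obtain ⟨-, c, hc, hTc⟩ := key z⁻¹ hzi0 hσzi x⁻¹
    (by rw [(hσ.conj hzi0 hσzi).map_inv x, hxf])
    (fun h => hxc (by rw [← inv_inv x]; exact inv_mem_center h))
  have hb3 : b 3 = 0 := hι0 _ (by rw [← hTb, hx, hTm])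
  have hc3 : c 3 = 0 := hι0 _ (by rw [← hTc, hxi, _root_.map_sub, hT, sub_self])
  simp only [Fin.sum_univ_four, hb3, hc3, zero_smul, add_zero] at hb hc
  have hc' : algebraMap F D (c 0) * x ^ 4 + algebraMap F D (c 1) * x ^ 3 +
      algebraMap F D (c 2) * x ^ 2 = 1 := by
    have h1 := congrArg (· * x ^ 4) hc
    simp only [Algebra.smul_def, add_mul, mul_assoc] at h1
    have e4 : x⁻¹ ^ 4 * x ^ 4 = 1 := by rw [inv_pow, inv_mul_cancel₀ (pow_ne_zero 4 hx0)]
    have e1 : x⁻¹ ^ ((1 : Fin 4) : ℕ) * x ^ 4 = x ^ 3 := by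
      change x⁻¹ ^ 1 * x ^ 4 = x ^ 3
      rw [pow_one, pow_succ' x 3, ← mul_assoc, inv_mul_cancel₀ hx0, one_mul]
    have e2 : x⁻¹ ^ ((2 : Fin 4) : ℕ) * x ^ 4 = x ^ 2 := by
      change x⁻¹ ^ 2 * x ^ (2 + 2) = x ^ 2
      rw [pow_add, ← mul_assoc, inv_pow, inv_mul_cancel₀ (pow_ne_zero 2 hx0), one_mul]
    have e0 : x⁻¹ ^ ((0 : Fin 4) : ℕ) * x ^ 4 = x ^ 4 := by
      change x⁻¹ ^ 0 * x ^ 4 = x ^ 4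
      rw [pow_zero, one_mul]
    rw [e4, e0, e1, e2] at h1
    exact h1.symm
  -- The equation of `x⁻¹`, multiplied by `x⁴` and reduced by the equation of `x`, is a cubic
  -- relation with these coefficients. They all vanish: `c₀ b₀ = 1` and `c₀ b₁ = 0`, so `b₁ = 0`.
  let d : Fin 4 → F := ![c 0 * b 0 - 1, c 0 * b 1, c 0 * b 2 + c 2, c 1]
  have hd : ∑ i, (⟨algebraMap F D (d i), algebraMap_mem_center _⟩ : Subring.center D) •
      x ^ (i : ℕ) = 0 := by
    have h1 : ∀ i : Fin 4, (⟨algebraMap F D (d i), algebraMap_mem_center _⟩ : Subring.center D) •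
      x ^ (i : ℕ) = algebraMap F D (d i) * x ^ (i : ℕ) := fun _ => rfl
    simp only [h1, Fin.sum_univ_four, d]
    rw [hb] at hc'
    simp only [Algebra.smul_def] at hc'
    simp only [Matrix.cons_val_zero, Matrix.cons_val_one, Matrix.cons_val, Fin.isValue, _root_.map_sub,
      _root_.map_mul, _root_.map_add, _root_.map_one, Fin.val_zero, Fin.val_one, Fin.val_two, pow_zero, pow_one] at hc' ⊢
    have h3 : ((3 : Fin 4) : ℕ) = 3 := rfl
    rw [h3, ← sub_eq_zero.2 hc']
    noncomm_ring
  have hd1 := Fintype.linearIndependent_iff.1 hli _ hd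
  have hd2 : ∀ i, d i = 0 := fun i => by
    have h1 : algebraMap F D (d i) = 0 := congrArg Subtype.val (hd1 i)
    exact (map_eq_zero _).1 h1
  have h0 : c 0 * b 0 - 1 = 0 := hd2 0
  have h1 : c 0 * b 1 = 0 := hd2 1
  have hb1 : b 1 = 0 := by
    rcases mul_eq_zero.1 h1 with h | h
    · rw [h] at h0
      simp at h0
    · exact h
  -- What remains is `x⁴ = b₂ x² + b₀`; `x²` is not central because `1` and `x²` are independent
  -- over the centre.
  refine H z⁻¹ hzi0 hσzi (x * x) (b 2) (-b 0) ?_ ?_ ?_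
  · rw [(hσ.conj hzi0 hσzi).map_mul x x, hxf]
  · intro hxx
    have h1 := Fintype.linearIndependent_iff.1 hli ![⟨x * x, hxx⟩, 0, -1, 0] (by
      have e1 : (⟨x * x, hxx⟩ : Subring.center D) • (1 : D) = x * x := mul_one (x * x)
      simp [Fin.sum_univ_four, e1, pow_two]) 2
    simp at h1
  · rw [hb1] at hb
    have e : x * x * (x * x) = x ^ 4 := by noncomm_ring
    rw [e, hb]
    simp only [Algebra.smul_def, _root_.map_zero, zero_mul, add_zero, _root_.map_neg, sub_neg_eq_add]
    have h2 : ((2 : Fin 4) : ℕ) = 2 := rfl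
    rw [h2, Fin.val_zero, pow_zero, mul_one, pow_two, add_comm]

end Degree4

/-! ### Degree four: the bound `63n/32` -/

section Degree4Bound

variable {F D : Type*} [Field F] [DivisionRing D] [Algebra F D] [FiniteDimensional F D]
  {σ : D → D} {s j : D} {τ ν : F}

/-- Hermitian forms over the centralizer of `s`, which is a quaternion algebra, for an involution
`ρ` fixing `α s + β`. -/
theorem QuadraticPair.finrank_le_of_anisotropic (q : QuadraticPair F σ s j τ ν)
    (hσ : IsUnitaryInvolution F σ) (hD : finrank F D = 32) {n : ℕ} (hn : QuadraticUBound F n)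
    {ρ : D → D} (hadd : ∀ x y, ρ (x + y) = ρ x + ρ y) (hmul : ∀ x y, ρ (x * y) = ρ y * ρ x)
    (hinv : ∀ x, ρ (ρ x) = x) (hcen : ∀ z ∈ Subring.center D, ρ z = σ z)
    (hC : ∀ x ∈ Subalgebra.centralizer F {s}, ρ x ∈ Subalgebra.centralizer F {s})
    {α β : D} (hα : α ∈ Subring.center D) (hβ : β ∈ Subring.center D) (hα0 : α ≠ 0)
    (hm : ρ (α * s + β) = α * s + β) {τ' ν' : F}
    (he : (α * s + β) * (α * s + β) = algebraMap F D τ' * (α * s + β) - algebraMap F D ν')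
    {V : Type*} [AddCommGroup V] [Module D V] [FiniteDimensional D V]
    (U : Submodule (Subalgebra.centralizer F {s}) V)
    (k : U → U → Subalgebra.centralizer F {s})
    (hk1 : ∀ x y z, k (x + y) z = k x z + k y z) (hk2 : ∀ a x y, k (a • x) y = a * k x y)
    (hk3 : ∀ x y, (k y x : D) = ρ (k x y)) (hk : ∀ x, k x x = 0 → x = 0) :
    8 * finrank (Subalgebra.centralizer F {s}) U ≤ 7 * (3 * n / 2) := by
  have hcC : ∀ z ∈ Subring.center D, z ∈ Subalgebra.centralizer F {s} := fun z hz =>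
    mem_centralizer_singleton.2 (Subring.mem_center_iff.1 hz s)
  have hsC : s ∈ Subalgebra.centralizer F {s} := mem_centralizer_singleton.2 rfl
  have hmC : α * s + β ∈ Subalgebra.centralizer F {s} :=
    add_mem (mul_mem (hcC α hα) hsC) (hcC β hβ)
  have hcomm : ∀ c ∈ Subalgebra.centralizer F {s}, (α * s + β) * c = c * (α * s + β) := by
    intro c hc
    rw [add_mul, mul_add, mul_assoc, mem_centralizer_singleton.1 hc, ← mul_assoc,
      ← Subring.mem_center_iff.1 hα c, Subring.mem_center_iff.1 hβ c, mul_assoc]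
  have hmF : α * s + β ∉ Set.range (algebraMap F D) := by
    rintro ⟨a, ha⟩
    apply q.notMem
    have h1 : s = α⁻¹ * (algebraMap F D a - β) := by
      rw [ha, add_sub_cancel_right, ← mul_assoc, inv_mul_cancel₀ hα0, one_mul]
    rw [h1]
    exact mul_mem (inv_mem_center hα) (sub_mem (algebraMap_mem_center a) hβ)
  have hone : ρ 1 = 1 := by rw [hcen 1 (one_mem _), hσ.map_one]
  have hfix := fun x => hσ.mem_adjoin_of_fixed (x := x) q.notMem hadd
    (fun z hz y => by
      rw [hmul, hcen z hz, Subring.mem_center_iff.1 (hσ.map_mem_center hz)]) hone hα hβ hα0 hm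
  generalize hmdef : α * s + β = m at *
  let C := Subalgebra.centralizer F {s}
  let L := Algebra.adjoin F {m}
  have hLmem : ∀ a ∈ L, ∃ b c : F, a = algebraMap F D b + algebraMap F D c * m := fun a ha =>
    mem_adjoin_of_quadratic he hmF ha
  have hLC : ∀ a ∈ L, a ∈ C ∧ ∀ c ∈ C, a * c = c * a := by
    intro a ha
    obtain ⟨b, c, rfl⟩ := hLmem a ha
    refine ⟨add_mem (C.algebraMap_mem b) (mul_mem (C.algebraMap_mem c) hmC), fun x hx => ?_⟩
    rw [add_mul, mul_add, mul_assoc, hcomm x hx, ← mul_assoc, Algebra.commutes b,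
      Algebra.commutes c, mul_assoc x, Algebra.commutes c]
  let _ : Field L := L.fieldOfComm (Algebra.adjoin_singleton_comm m)
  let _ : DivisionRing C := C.divisionRing
  let i : L →+* C := (Subalgebra.inclusion fun a ha => (hLC a ha).1 : L →ₐ[F] C).toRingHom
  let _ : Algebra L C := i.toAlgebra' fun a c => Subtype.ext ((hLC a a.2).2 c c.2)
  have : IsScalarTower F L C := IsScalarTower.of_algebraMap_eq fun _ => rfl
  have hL2 : finrank F L = 2 := finrank_adjoin_of_quadratic he hmF
  -- `dim_F C = 16` and `[L:F] = 2`, so the degree two bound applies to `C` over `L`, with `u(L) ≤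
  -- 3n/2`.
  have hC8 : finrank L C = 8 := by
    have h1 : finrank F L * finrank L C = finrank F C := finrank_mul_finrank F L C
    have h2 : finrank F D = 2 * finrank F C := q.finrank_eq_two_mul_centralizer
    rw [hL2] at h1
    omega
  have hρ : IsUnitaryInvolution L fun x : C => (⟨ρ x, hC x x.2⟩ : C) := by
    refine ⟨fun x y => Subtype.ext (hadd x y), fun x y => Subtype.ext (hmul x y),
      fun x => Subtype.ext (hinv x), fun a => Subtype.ext ?_, fun x hx hxf => ?_, ?_⟩
    · change ρ a = a
      obtain ⟨b, c, hbc⟩ := hLmem a a.2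
      rw [hbc, hadd, hmul, hm, hcen _ (algebraMap_mem_center b), hcen _ (algebraMap_mem_center c),
        hσ.map_algebraMap, hσ.map_algebraMap, Algebra.commutes c]
    · have h1 : (x : D) ∈ L := hfix x (q.exists_eq_add_mul_of_mem_center fun c hc =>
        congrArg Subtype.val (Subring.mem_center_iff.1 hx ⟨c, hc⟩)) (congrArg Subtype.val hxf)
      exact ⟨⟨x, h1⟩, rfl⟩
    · obtain ⟨t, ht, hne⟩ := hσ.exists_ne
      refine ⟨⟨t, hcC t ht⟩, Subring.mem_center_iff.2 fun g =>
        Subtype.ext (Subring.mem_center_iff.1 ht g), fun h => hne ?_⟩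
      rw [← hcen t ht]
      exact congrArg Subtype.val h
  have hnL : QuadraticUBound L (3 * n / 2) := hn.extension (by rw [hL2]; omega)
  have : FiniteDimensional C D := Module.Finite.of_restrictScalars_finite F _ _
  have : FiniteDimensional C V := Module.Finite.trans D V
  have hkk : IsHermitianForm (fun x : C => (⟨ρ x, hC x x.2⟩ : C)) k :=
    ⟨hk1, hk2, fun x y => Subtype.ext (hk3 x y)⟩
  exact hkk.finrank_le_of_finrank_eq_eight hC8 hρ hnL hk

/-- The case of a symmetric noncentral quadratic element. -/
theorem QuadraticPair.finrank_le (q : QuadraticPair F σ s j τ ν)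
    (hσ : IsUnitaryInvolution F σ) (hD : finrank F D = 32) {n : ℕ} (hn : QuadraticUBound F n)
    {V : Type*} [AddCommGroup V] [Module D V] [FiniteDimensional D V]
    {h : V → V → D} (hh : IsHermitianForm σ h) (han : ∀ x, h x x = 0 → x = 0) :
    32 * finrank D V ≤ 63 * n := by
  by_contra! hlt
  let C := Subalgebra.centralizer F {s}
  let _ := C.divisionRing
  have hC2 : finrank C D = 2 := q.finrank_centralizer_eq_two
  have : FiniteDimensional C D := Module.Finite.of_restrictScalars_finite F _ _
  have : FiniteDimensional C V := Module.Finite.trans D V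
  have hσC : ∀ x ∈ C, σ x ∈ C := fun x hx => q.map_mem_centralizer hσ hx
  -- Put `M = ⌊7⌊3n/2⌋/8⌋`, the bound for anisotropic forms over `C` with either involution. It
  -- serves both as the threshold for a vector with `h x x ∈ C` and as the dimension that a subspace
  -- of such vectors cannot exceed. The total is `M + 2M ≤ 63n/16`, against `dim_C V = 2 dim_D V`.
  have key := exists_submodule_forall_isotropic (E := C) (V := V)
    (fun x => h x x ∈ C) (by rw [hh.zero_left]; exact zero_mem _) 1
    (7 * (3 * n / 2) / 8) ?_ ?_ (7 * (3 * n / 2) / 8) ⊤ ?_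
  · obtain ⟨W, -, hWk, hW⟩ := key
    have hmem : ∀ x ∈ W, ∀ y ∈ W, h x y ∈ C := by
      intro x hx y hy
      have hpol : ∀ x ∈ W, h x y + h y x ∈ C := fun x hx => by
        have e : h x y + h y x = h (x + y) (x + y) - h x x - h y y := by
          rw [hh.add_left, hh.add_right hσ, hh.add_right hσ]
          abel
        rw [e]
        exact sub_mem (sub_mem (hW _ (add_mem hx hy)) (hW x hx)) (hW y hy)
      -- Polarization gives only `h x y + h y x ∈ C`. Comparing this for `x` and for `t x` isolates
      -- `(t - σ t) h x y`.
      obtain ⟨t, ht, hne⟩ := hσ.exists_ne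
      have hcC : ∀ z ∈ Subring.center D, z ∈ C := fun z hz =>
        mem_centralizer_singleton.2 (Subring.mem_center_iff.1 hz s)
      have ht0 : t - σ t ≠ 0 := sub_ne_zero.2 hne.symm
      have htc : t - σ t ∈ Subring.center D := sub_mem ht (hσ.map_mem_center ht)
      have h1 := hpol ((⟨t, hcC t ht⟩ : C) • x) (W.smul_mem _ hx)
      change h (t • x) y + h y (t • x) ∈ C at h1
      have h2 := sub_mem h1 (mul_mem (hσC t (hcC t ht)) (hpol x hx))
      rw [hh.smul_left, hh.smul_right hσ, Subring.mem_center_iff.1 (hσ.map_mem_center ht),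
        mul_add, add_sub_add_right_eq_sub, ← sub_mul] at h2
      have h3 := mul_mem (hcC _ (inv_mem_center htc)) h2
      rwa [← mul_assoc, inv_mul_cancel₀ ht0, one_mul] at h3
    have h1 := q.finrank_le_of_anisotropic hσ hD hn hσ.map_add hσ.map_mul hσ.invol (fun _ _ => rfl)
      hσC (one_mem _) (zero_mem _) one_ne_zero (by rw [one_mul, add_zero, q.symm])
      (by rw [one_mul, add_zero, q.eqn]) W (fun x y => ⟨h x y, hmem x x.2 y y.2⟩)
      (fun x y z => Subtype.ext (hh.add_left x y z))
      (fun a x y => Subtype.ext (hh.smul_left a x y)) (fun x y => hh.symm x y)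
      (fun x hx => Subtype.ext (han x (congrArg Subtype.val hx)))
    change 8 * finrank C W ≤ _ at h1
    omega
  · intro U hU
    -- Without such a vector, `[s, h] j⁻¹` would be anisotropic on `U` for the involution `x ↦ j
    -- σ(x) j⁻¹`, which fixes `ℓ`.
    by_contra! H
    obtain ⟨ℓ, ν', α, hα, β, hβ, hα0, rfl, hσℓ, hjℓ, hℓ⟩ := q.exists_generator hσ
    have hj0 := q.ne_zero
    have h1 := q.finrank_le_of_anisotropic hσ hD hn (ρ := fun x => j * σ x * j⁻¹)
      (fun x y => by rw [hσ.map_add]; noncomm_ring)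
      (fun x y => by
        have e : j * σ y * j⁻¹ * (j * σ x * j⁻¹) = j * σ y * (j⁻¹ * j) * σ x * j⁻¹ := by
          noncomm_ring
        rw [e, inv_mul_cancel₀ hj0, hσ.map_mul]
        noncomm_ring)
      (q.twist_invol hσ)
      (fun z hz => by
        rw [Subring.mem_center_iff.1 (hσ.map_mem_center hz), mul_assoc, mul_inv_cancel₀ hj0,
          mul_one])
      (fun x hx => q.conj_mem_centralizer (hσC x hx)) hα hβ hα0
      (by
        rw [hσℓ, mul_sub, hjℓ, ← Algebra.commutes, ← sub_mul, sub_sub_cancel, mul_assoc,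
          mul_inv_cancel₀ hj0, mul_one])
      hℓ U (fun x y => q.toCentralizer (h x y))
      (fun x y z => by
        change q.toCentralizer (h ((x : V) + y) z) = _
        rw [hh.add_left, map_add])
      (fun a x y => by
        change q.toCentralizer (h ((a : D) • (x : V)) y) = _
        rw [hh.smul_left]
        exact q.toCentralizer.map_smul a _)
      (fun x y => q.toCentralizer_symm hσ hh x y)
      (fun x hx => by
        by_contra hx0
        exact H x x.2 (fun h => hx0 (Subtype.ext h)) (q.toCentralizer_eq_zero.1 hx))
    change 8 * finrank C U ≤ _ at h1
    omega
  · intro x hx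
    obtain ⟨T, hT, hT1⟩ := hh.exists_submodule_mem hC2 x
    refine ⟨T, (hT x).2 hx, hT1, fun y hy hyy a => ?_⟩
    have hyx := (hT y).1 hy
    change h ((a : D) • x + y) ((a : D) • x + y) ∈ C
    rw [hh.add_left, hh.add_right hσ, hh.add_right hσ, hh.smul_left, hh.smul_left,
      hh.smul_right hσ, hh.smul_right hσ, hh.symm y x]
    exact add_mem (add_mem (mul_mem a.2 (mul_mem hx (hσC a a.2))) (mul_mem a.2 (hσC _ hyx)))
      (add_mem (mul_mem hyx (hσC a a.2)) hyy)
  · rw [finrank_top]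
    have := finrank_mul_finrank C D V
    rw [hC2] at this
    omega

/-- Hermitian forms over a division algebra of degree `4` with unitary involution. -/
theorem IsHermitianForm.finrank_le_of_finrank_eq_thirtyTwo (hD : finrank F D = 32)
    (hσ : IsUnitaryInvolution F σ) {n : ℕ} (hn : QuadraticUBound F n) {V : Type*} [AddCommGroup V]
    [Module D V] [FiniteDimensional D V] {h : V → V → D} (hh : IsHermitianForm σ h)
    (han : ∀ x, h x x = 0 → x = 0) : 32 * finrank D V ≤ 63 * n := by
  have h16 : finrank (Subring.center D) D = 16 := by
    have := hσ.finrank_eq_two_mul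
    omega
  obtain ⟨w, hw0, hw, s, τ, ν, hs, hsc, he⟩ := hσ.exists_quadratic_symm h16
  obtain ⟨j, q⟩ := QuadraticPair.exists_of_symm (hσ.conj hw0 hw) hs he hsc
  exact q.finrank_le (hσ.conj hw0 hw) hD hn (hh.conj hσ hw0 hw)
    fun x hx => han x ((mul_eq_zero.1 hx).resolve_right hw0)

end Degree4Bound

/-! ### Degree three: the bound `n` -/

section Degree3

variable {F D : Type*} [Field F] [DivisionRing D] [Algebra F D]

/-- If `θ³ = e θ² - b θ + c`, then this map takes its values in the centralizer of `θ`. -/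
def cubicMap (θ : D) (e c : F) (d : D) : D :=
  c • d - e • (θ * d * θ) + θ * θ * d * θ + θ * d * θ * θ

section CubicMap

variable {θ : D} {e b c : F}

theorem cubicMap_add (x y : D) :
    cubicMap θ e c (x + y) = cubicMap θ e c x + cubicMap θ e c y := by
  simp only [cubicMap, mul_add, add_mul, smul_add]
  abel

/-- Let `X`, `Y` be left and right multiplication by `θ`, and `p = X³ - e X² + b X - c`. As a
polynomial in `X`, `Y`, `cubicMap` is `(Y p(X) - X p(Y)) / (X - Y)`, so `X - Y` annihilates it. The
coefficient `b` cancels. -/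
theorem commute_cubicMap (hθ : θ * θ * θ = e • (θ * θ) - b • θ + algebraMap F D c) (d : D) :
    θ * cubicMap θ e c d = cubicMap θ e c d * θ := by
  have h1 : θ * d * θ * θ * θ = θ * d * (θ * θ * θ) := by noncomm_ring
  simp only [cubicMap, mul_add, mul_sub, add_mul, sub_mul, mul_smul_comm, smul_mul_assoc,
    ← mul_assoc]
  rw [h1, hθ]
  simp only [mul_add, mul_sub, add_mul, sub_mul, mul_smul_comm, smul_mul_assoc, ← mul_assoc,
    ← Algebra.smul_def, ← Algebra.commutes c (θ * d)]
  abel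

theorem cubicMap_mul_left {a : D} (ha : θ * a = a * θ) (d : D) :
    cubicMap θ e c (a * d) = a * cubicMap θ e c d := by
  simp only [cubicMap, mul_add, mul_sub, mul_smul_comm, ← mul_assoc, ha]
  rw [mul_assoc θ θ a, ha, ← mul_assoc, ha]

theorem cubicMap_mul_right {a : D} (ha : θ * a = a * θ) (d : D) :
    cubicMap θ e c (d * a) = cubicMap θ e c d * a := by
  have h2 : a * (θ * θ) = θ * (a * θ) := by
    rw [← mul_assoc, ← ha, mul_assoc, ha]
  simp only [cubicMap, add_mul, sub_mul, smul_mul_assoc, mul_assoc, ha, h2]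

theorem IsUnitaryInvolution.map_cubicMap {σ : D → D} (hσ : IsUnitaryInvolution F σ)
    (hθ : σ θ = θ) (d : D) : σ (cubicMap θ e c d) = cubicMap θ e c (σ d) := by
  simp only [cubicMap, hσ.map_add, hσ.map_sub, hσ.map_smul, hσ.map_mul, hθ, ← mul_assoc]
  abel

end CubicMap

variable [FiniteDimensional F D] {σ : D → D} {θ : D}

/-- Over the centre `Z` the centralizer of `θ` has dimension at least `3`, dividing `9` and
different from `9`; hence it is `Z(θ)`. The coordinates of a symmetric element in the powers of `θ`
are fixed by `σ`, so they lie in `F`. -/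
theorem IsUnitaryInvolution.mem_adjoin_of_commute (hσ : IsUnitaryInvolution F σ) (hθ : σ θ = θ)
    (hD : finrank (Subring.center D) D = 9)
    (h3 : (minpoly (Subring.center D) θ).natDegree = 3) {x : D} (hx : σ x = x)
    (hxθ : θ * x = x * θ) : x ∈ Algebra.adjoin F {θ} := by
  have := hσ.finiteDimensional_center
  let E := Subalgebra.centralizer (Subring.center D) {θ}
  let S := Algebra.adjoin (Subring.center D) {θ}
  have hSE : S ≤ E := Algebra.adjoin_le (by
    rintro _ rfl
    exact mem_centralizer_singleton.2 rfl)
  have hS3 : finrank (Subring.center D) S = 3 := by rw [finrank_adjoin_singleton, h3]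
  have hES : finrank (Subring.center D) E = 3 := by
    have h1 : finrank (Subring.center D) S ≤ finrank (Subring.center D) E :=
      Submodule.finrank_mono (s := Subalgebra.toSubmodule S) (t := Subalgebra.toSubmodule E) hSE
    have h2 := E.finrank_dvd
    rw [hD] at h2
    have h4 : finrank (Subring.center D) E ≠ 9 := fun h => by
      have h5 := Submodule.eq_top_of_finrank_eq (S := Subalgebra.toSubmodule E) (h.trans hD.symm)
      have h6 : θ ∈ Subring.center D := Subring.mem_center_iff.2 fun g => by
        have : g ∈ Subalgebra.toSubmodule E := h5 ▸ Submodule.mem_top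
        exact ((mem_centralizer_singleton (F := Subring.center D)).1 this).symm
      have h7 := minpoly.natDegree_eq_one_iff.2 (⟨⟨θ, h6⟩, rfl⟩ :
        θ ∈ (algebraMap (Subring.center D) D).range)
      omega
    have h5 := Nat.le_of_dvd (by norm_num) h2
    interval_cases finrank (Subring.center D) E <;> omega
  have hEq : Subalgebra.toSubmodule S = Subalgebra.toSubmodule E :=
    Submodule.eq_of_le_of_finrank_eq hSE (hS3.trans hES.symm)
  have hxS : x ∈ Subalgebra.toSubmodule S := hEq ▸ (mem_centralizer_singleton (F := Subring.center D)).2 hxθ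
  rw [toSubmodule_adjoin_singleton, Submodule.mem_span_range_iff_exists_fun] at hxS
  obtain ⟨z, hz⟩ := hxS
  have hli := linearIndependent_pow (K := Subring.center D) θ
  let f : D →+ D := ⟨⟨σ, hσ.map_zero⟩, hσ.map_add⟩
  have hσz : ∑ i, (⟨σ (z i), hσ.map_mem_center (z i).2⟩ : Subring.center D) • θ ^ (i : ℕ) = x := by
    have h1 : f x = x := hx
    rw [← hz, map_sum] at h1
    rw [← hz, ← h1]
    refine Finset.sum_congr rfl fun i _ => ?_
    change σ (z i) * θ ^ (i : ℕ) = σ ((z i) * θ ^ (i : ℕ))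
    rw [hσ.map_mul, hσ.map_pow, hθ, Subring.mem_center_iff.1 (hσ.map_mem_center (z i).2)]
  have hfix := fun i => Fintype.linearIndependent_iff.1 hli
    (fun i => (⟨σ (z i), hσ.map_mem_center (z i).2⟩ : Subring.center D) - z i) (by
      simp only [sub_smul, Finset.sum_sub_distrib]
      rw [hσz, hz, sub_self]) i
  rw [← hz]
  refine sum_mem fun i _ => ?_
  obtain ⟨a, ha⟩ := hσ.mem_range _ (z i).2 (congrArg Subtype.val (sub_eq_zero.1 (hfix i)))
  change (z i : D) * θ ^ (i : ℕ) ∈ _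
  rw [← ha]
  exact mul_mem (Subalgebra.algebraMap_mem _ a) (pow_mem (Algebra.self_mem_adjoin_singleton F θ) _)

omit [FiniteDimensional F D] in
theorem IsUnitaryInvolution.fixed_of_mem_adjoin (hσ : IsUnitaryInvolution F σ) (hθ : σ θ = θ)
    {x : D} (hx : x ∈ Algebra.adjoin F {θ}) : σ x = x ∧ θ * x = x * θ := by
  refine Algebra.adjoin_induction (p := fun x _ => σ x = x ∧ θ * x = x * θ) ?_ ?_ ?_ ?_ hx
  · rintro _ rfl
    exact ⟨hθ, rfl⟩
  · exact fun r => ⟨hσ.map_algebraMap r, (Algebra.commutes r θ).symm⟩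
  · rintro x y - - ⟨h1, h2⟩ ⟨h3, h4⟩
    exact ⟨by rw [hσ.map_add, h1, h3], by rw [mul_add, add_mul, h2, h4]⟩
  · rintro x y hx hy ⟨h1, h2⟩ ⟨h3, h4⟩
    refine ⟨?_, by rw [← mul_assoc, h2, mul_assoc, h4, mul_assoc]⟩
    rw [hσ.map_mul, h1, h3]
    exact congrArg Subtype.val (Algebra.adjoin_singleton_comm θ ⟨y, hy⟩ ⟨x, hx⟩)

/-- For `x = a + t b` with `a, b` symmetric, the commutators `[θ, a]` and `[θ, b]` are skew. So `[θ,
a] + t [θ, b] = 0` forces both to vanish, and the centralizer is `F(θ) ⊕ t F(θ)`. -/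
theorem IsUnitaryInvolution.finrank_centralizer_cubic (hσ : IsUnitaryInvolution F σ)
    (hθ : σ θ = θ) (hD : finrank (Subring.center D) D = 9)
    (h3 : (minpoly (Subring.center D) θ).natDegree = 3) :
    finrank F (Subalgebra.centralizer F {θ}) = 2 * finrank F (Algebra.adjoin F {θ}) := by
  obtain ⟨t, ht, hne⟩ := hσ.exists_ne
  have htc := Subring.mem_center_iff.1 ht
  have hδ : t - σ t ≠ 0 := sub_ne_zero.2 hne.symm
  have hmem : ∀ a ∈ Algebra.adjoin F {θ}, ∀ b ∈ Algebra.adjoin F {θ},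
      a + t * b ∈ Subalgebra.centralizer F {θ} := fun a ha b hb => by
    rw [mem_centralizer_singleton, mul_add, add_mul, (hσ.fixed_of_mem_adjoin hθ ha).2, ← mul_assoc,
      htc, mul_assoc, (hσ.fixed_of_mem_adjoin hθ hb).2, mul_assoc]
  have hzero : ∀ a b, σ a = -a → σ b = -b → a + t * b = 0 → a = 0 ∧ b = 0 := by
    intro a b ha hb hab
    have h1 := congrArg σ hab
    rw [hσ.map_add, hσ.map_mul, ha, hb, hσ.map_zero,
      Subring.mem_center_iff.1 (hσ.map_mem_center ht)] at h1
    have h2 : (t - σ t) * b = 0 := by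
      have : (t - σ t) * b = (a + t * b) + (-a + σ t * -b) := by noncomm_ring
      rw [this, hab, h1, add_zero]
    have hb0 := (mul_eq_zero.1 h2).resolve_left hδ
    rw [hb0, mul_zero, add_zero] at hab
    exact ⟨hab, hb0⟩
  let f : Algebra.adjoin F {θ} × Algebra.adjoin F {θ} →ₗ[F] Subalgebra.centralizer F {θ} :=
    { toFun := fun p => ⟨p.1 + t * p.2, hmem _ p.1.2 _ p.2.2⟩
      map_add' := fun p r => Subtype.ext (by
        change ((p.1 : D) + r.1) + t * ((p.2 : D) + r.2) = p.1 + t * p.2 + (r.1 + t * r.2)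
        noncomm_ring)
      map_smul' := fun c p => Subtype.ext (by
        change c • (p.1 : D) + t * (c • (p.2 : D)) = c • (p.1 + t * p.2)
        rw [smul_add, mul_smul_comm]) }
  have hf : Function.Bijective f := by
    constructor
    · rw [injective_iff_map_eq_zero]
      rintro ⟨a, b⟩ hab
      have h1 : (a : D) + t * b = 0 := congrArg Subtype.val hab
      have h2 := congrArg σ h1
      rw [hσ.map_add, hσ.map_mul, (hσ.fixed_of_mem_adjoin hθ a.2).1,
        (hσ.fixed_of_mem_adjoin hθ b.2).1, hσ.map_zero,
        Subring.mem_center_iff.1 (hσ.map_mem_center ht)] at h2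
      have h4 : (t - σ t) * b = 0 := by
        rw [sub_mul, ← add_sub_add_left_eq_sub _ _ (a : D), h1, h2, sub_self]
      have hb0 := (mul_eq_zero.1 h4).resolve_left hδ
      rw [hb0, mul_zero, add_zero] at h1
      exact Prod.ext (Subtype.ext h1) (Subtype.ext hb0)
    · rintro ⟨x, hx⟩
      obtain ⟨a, b, ha, hb, rfl⟩ := hσ.exists_eq_add_mul ht hne x
      have hx' := sub_eq_zero.2 (mem_centralizer_singleton.1 hx)
      have e : θ * (a + t * b) - (a + t * b) * θ = (θ * a - a * θ) + t * (θ * b - b * θ) := by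
        have : θ * (a + t * b) = θ * a + (θ * t) * b := by noncomm_ring
        rw [this, htc θ]
        noncomm_ring
      rw [e] at hx'
      have hskew : ∀ a, σ a = a → σ (θ * a - a * θ) = -(θ * a - a * θ) := fun a ha => by
        rw [hσ.map_sub, hσ.map_mul, hσ.map_mul, hθ, ha, neg_sub]
      obtain ⟨h1, h2⟩ := hzero _ _ (hskew a ha) (hskew b hb) hx'
      exact ⟨(⟨a, hσ.mem_adjoin_of_commute hθ hD h3 ha (sub_eq_zero.1 h1)⟩,
        ⟨b, hσ.mem_adjoin_of_commute hθ hD h3 hb (sub_eq_zero.1 h2)⟩), rfl⟩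
  rw [← (LinearEquiv.ofBijective f hf).finrank_eq, finrank_prod, two_mul]

variable {e b c : F} {V : Type*} [AddCommGroup V] [Module D V] [FiniteDimensional D V]
  {h : V → V → D}

omit [FiniteDimensional F D] [FiniteDimensional D V] in
/-- Vectors that are independent over the centralizer of `θ` become independent over `D` under
`y ↦ (y, θ y, θ² y)`. -/
theorem linearIndependent_of_centralizer
    (hθ : θ * θ * θ = e • (θ * θ) - b • θ + algebraMap F D c) {ι : Type*} {y : ι → V}
    (hy : LinearIndependent (Subalgebra.centralizer F {θ}) y) :
    LinearIndependent D fun i => (y i, θ • y i, (θ * θ) • y i) := by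
  rw [linearIndependent_iff_ker]
  by_contra hR
  -- Right multiplication of a relation by `θ` shifts its three components, and the last one
  -- re-enters through the cubic equation. A nonzero relation can therefore be taken with
  -- coefficients in the centralizer, and its first component contradicts the independence of `y`.
  have hst : ∀ x ∈ ({θ} : Set D), ∀ d ∈ LinearMap.ker (Finsupp.linearCombination D
      fun i => (y i, θ • y i, (θ * θ) • y i)), d.mapRange (· * x) (zero_mul x) ∈
      LinearMap.ker (Finsupp.linearCombination D fun i => (y i, θ • y i, (θ * θ) • y i)) := by
    intro x hx d hd
    obtain rfl : x = θ := hx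
    have h1 : d.sum (fun i a => a • (y i, x • y i, (x * x) • y i)) = 0 := hd
    have h2 := congrArg Prod.fst h1
    have h3 := congrArg (fun p => p.2.1) h1
    have h4 := congrArg (fun p => p.2.2) h1
    simp only [Finsupp.sum, Prod.fst_sum, Prod.snd_sum, Prod.smul_mk, Prod.fst_zero, Prod.snd_zero]
      at h2 h3 h4
    rw [LinearMap.mem_ker, Finsupp.linearCombination_apply,
      Finsupp.sum_mapRange_index (by simp), Finsupp.sum]
    refine Prod.ext ?_ (Prod.ext ?_ ?_)
    · simpa only [Prod.fst_sum, Prod.smul_mk, mul_smul, Prod.fst_zero] using h3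
    · simpa only [Prod.fst_sum, Prod.snd_sum, Prod.smul_mk, mul_smul, Prod.fst_zero, Prod.snd_zero] using h4
    · simp only [Prod.snd_sum, Prod.smul_mk, Prod.snd_zero]
      have h5 : ∀ i, (d i * x) • (x * x) • y i = algebraMap F D e • d i • (x * x) • y i -
          algebraMap F D b • d i • x • y i + algebraMap F D c • d i • y i := fun i => by
        simp only [← mul_smul]
        rw [← sub_smul, ← add_smul, mul_assoc (d i) x, ← mul_assoc x x x, hθ, mul_add, mul_sub,
          mul_smul_comm, mul_smul_comm, Algebra.smul_def, Algebra.smul_def, Algebra.commutes c]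
      simp only [h5, Finset.sum_add_distrib, Finset.sum_sub_distrib, ← Finset.smul_sum]
      rw [h2, h3, h4]
      simp
  obtain ⟨d, hdR, hd0, hdc⟩ := exists_ne_zero_forall_commute _ {θ} hst hR
  have hd := fun i => mem_centralizer_singleton (F := F).2 (hdc i θ rfl)
  have h1 : (Finsupp.linearCombination D fun i => (y i, θ • y i, (θ * θ) • y i)) d = 0 := hdR
  have h2 := congrArg Prod.fst h1
  rw [Finsupp.linearCombination_apply, Finsupp.sum, Prod.fst_sum] at h2
  have h3 := linearIndependent_iff'.1 hy d.support (fun i => ⟨d i, hd i⟩) h2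
  obtain ⟨i, hi⟩ : ∃ i, d i ≠ 0 := by
    by_contra! H
    exact hd0 (Finsupp.ext H)
  exact hi (congrArg Subtype.val (h3 i (Finsupp.mem_support_iff.2 hi)))

/-- A subspace over the centralizer of `θ` on which `cubicMap θ e c ∘ h` vanishes is small. -/
theorem IsHermitianForm.finrank_le_of_cubicMap_eq_zero (hσ : IsUnitaryInvolution F σ)
    (hθσ : σ θ = θ) (hθ : θ * θ * θ = e • (θ * θ) - b • θ + algebraMap F D c) (hc : c ≠ 0)
    (hh : IsHermitianForm σ h) (han : ∀ x, h x x = 0 → x = 0)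
    (Y : Submodule (Subalgebra.centralizer F {θ}) V)
    (hY : ∀ x ∈ Y, ∀ y ∈ Y, cubicMap θ e c (h x y) = 0) :
    finrank (Subalgebra.centralizer F {θ}) Y ≤ finrank D V := by
  let E := Subalgebra.centralizer F {θ}
  let _ := E.divisionRing
  have : FiniteDimensional E D := Module.Finite.of_restrictScalars_finite F _ _
  have : FiniteDimensional E V := Module.Finite.trans D V
  let y := finBasis E Y
  have hy : LinearIndependent E fun i => (y i : V) :=
    y.linearIndependent.map' Y.subtype Y.ker_subtype
  have hφ := linearIndependent_of_centralizer hθ hy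
  obtain ⟨Z, hZ⟩ : ∃ Z, Z = Submodule.span D
    (Set.range fun i => ((y i : V), θ • (y i : V), (θ * θ) • (y i : V))) := ⟨_, rfl⟩
  have hZY : finrank D Z = finrank E Y := by
    rw [hZ, finrank_span_eq_card hφ, Fintype.card_fin]
  -- Chosen so that `H` at `(x, θ x, θ² x)` and `(y, θ y, θ² y)` equals `cubicMap θ e c (h x y)`.
  -- Hence `Z` is totally isotropic for `H`.
  let H : V × V × V → V × V × V → D := fun z w =>
    c • h z.1 w.1 - e • h z.2.1 w.2.1 + h z.2.2 w.2.1 + h z.2.1 w.2.2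
  have hH : IsHermitianForm σ H := by
    refine ⟨fun x y z => ?_, fun a x y => ?_, fun x y => ?_⟩
    · simp only [H, Prod.fst_add, Prod.snd_add, hh.add_left, smul_add]
      abel
    · simp only [H, Prod.smul_fst, Prod.smul_snd, hh.smul_left, mul_add, mul_sub, mul_smul_comm]
    · simp only [H, hσ.map_add, hσ.map_sub, hσ.map_smul, ← hh.symm]
      abel
  have hH0 : ∀ z ∈ Z, ∀ w ∈ Z, H z w = 0 := by
    have h1 : ∀ i, ∀ z ∈ Z, H z ((y i : V), θ • (y i : V), (θ * θ) • (y i : V)) = 0 := by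
      intro i z hz
      rw [hZ] at hz
      induction hz using Submodule.span_induction with
      | mem z hz =>
        obtain ⟨k, rfl⟩ := hz
        refine Eq.trans ?_ (hY _ (y k).2 _ (y i).2)
        simp only [H, cubicMap, hh.smul_left, hh.smul_right hσ, hσ.map_mul, hθσ, mul_assoc]
      | zero => exact hH.zero_left _
      | add x y _ _ hx hy => rw [hH.add_left, hx, hy, add_zero]
      | smul a x _ hx => rw [hH.smul_left, hx, mul_zero]
    intro z hz w hw
    rw [hH.symm w z]
    rw [hZ] at hw
    induction hw using Submodule.span_induction with
    | mem w hw =>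
      obtain ⟨k, rfl⟩ := hw
      rw [← hH.symm]
      exact h1 k z hz
    | zero => rw [hH.zero_left, hσ.map_zero]
    | add x y _ _ hx hy => rw [hH.add_left, hσ.map_add, hx, hy, add_zero]
    | smul a x _ hx => rw [hH.smul_left, hσ.map_mul, hx, zero_mul]
  -- Here `f` is the second coordinate and `g` the third coordinate on `ker f`. If `z₂ = 0`,
  -- isotropy reads `c h(z₁, z₁) = 0`, so `z₁ = 0` and `g` is injective. If moreover `z₃ = w₂`, then
  -- `0 = H(z, w) = h(w₂, w₂)`, so the two images meet trivially and `dim Z ≤ dim V`.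
  let f : Z →ₗ[D] V := LinearMap.fst D V V ∘ₗ LinearMap.snd D V (V × V) ∘ₗ Z.subtype
  let g : LinearMap.ker f →ₗ[D] V := LinearMap.snd D V V ∘ₗ LinearMap.snd D V (V × V) ∘ₗ
    Z.subtype ∘ₗ (LinearMap.ker f).subtype
  have hker : ∀ z ∈ Z, z.2.1 = 0 → z.1 = 0 := by
    intro z hz hz1
    have h1 := hH0 z hz z hz
    simp only [H, hz1, hh.zero_left, hh.symm 0 z.2.2, hσ.map_zero, smul_zero, sub_zero, add_zero]
      at h1
    exact han _ ((smul_eq_zero.1 h1).resolve_left hc)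
  have hg : Function.Injective g := by
    rw [injective_iff_map_eq_zero]
    rintro ⟨⟨z, hz⟩, hzf⟩ hzg
    have h1 : z.2.1 = 0 := hzf
    have h2 : z.2.2 = 0 := hzg
    exact Subtype.ext (Subtype.ext (Prod.ext (hker z hz h1) (Prod.ext h1 h2)))
  have hdisj : Disjoint (LinearMap.range f) (LinearMap.range g) := by
    rw [Submodule.disjoint_def]
    rintro _ ⟨⟨w, hw⟩, rfl⟩ ⟨⟨⟨z, hz⟩, hzf⟩, hzg⟩
    have h1 : z.2.1 = 0 := hzf
    have h2 : z.2.2 = w.2.1 := hzg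
    have h3 := hH0 z hz w hw
    simp only [H, h1, hker z hz h1, hh.zero_left, smul_zero, sub_zero, zero_add, add_zero, h2] at h3
    exact han _ h3
  have h1 := Submodule.finrank_add_finrank_le_of_disjoint hdisj
  rw [LinearMap.finrank_range_of_inj hg, f.finrank_range_add_finrank_ker, hZY] at h1
  exact h1

/-- Hermitian forms over a division algebra of degree `3` with unitary involution. -/
theorem IsHermitianForm.finrank_le_of_finrank_eq_eighteen (hD : finrank F D = 18)
    (hσ : IsUnitaryInvolution F σ) {n : ℕ} (hn : QuadraticUBound F n)
    (hh : IsHermitianForm σ h) (han : ∀ x, h x x = 0 → x = 0) : finrank D V ≤ n := by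
  by_contra! hlt
  have h9 : finrank (Subring.center D) D = 9 := by
    have := hσ.finrank_eq_two_mul
    omega
  have := hσ.finiteDimensional_center
  obtain ⟨θ, hθσ, hθc⟩ := hσ.exists_symm_notMem_center (center_ne_top_of_finrank_ne_one (by omega))
  have h3 : (minpoly (Subring.center D) θ).natDegree = 3 := by
    have h1 := natDegree_minpoly_dvd (F := Subring.center D) θ
    have h2 := natDegree_minpoly_ne_finrank θ (by omega)
    have h4 : (minpoly (Subring.center D) θ).natDegree ≠ 1 := fun h => by
      obtain ⟨z, rfl⟩ := mem_range_algebraMap_of_natDegree_minpoly_eq_one _ h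
      exact hθc z.2
    rw [h9] at h1 h2
    have h5 := Nat.le_of_dvd (by norm_num) h1
    interval_cases (minpoly (Subring.center D) θ).natDegree <;> omega
  have hli := linearIndependent_pow (K := Subring.center D) θ
  rw [h3] at hli
  obtain ⟨a, ha⟩ := hσ.exists_pow_eq_sum hθσ h3
  have hθ : θ * θ * θ = a 2 • (θ * θ) - (-a 1) • θ + algebraMap F D (a 0) := by
    have e1 : θ ^ 3 = θ * θ * θ := by noncomm_ring
    rw [← e1, ha, Fin.sum_univ_three]
    simp [pow_two, Algebra.algebraMap_eq_smul_one]
    abel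
  -- With zero constant term `θ` could be cancelled, leaving a quadratic relation.
  have hc : a 0 ≠ 0 := by
    intro h0
    have hθ0 : θ ≠ 0 := fun h => hθc (h ▸ zero_mem _)
    have e1 : (θ * θ - a 2 • θ - algebraMap F D (a 1)) * θ = 0 := by
      rw [sub_mul, sub_mul, hθ, h0, map_zero, smul_mul_assoc, ← Algebra.smul_def]
      simp
    have e2 := (mul_eq_zero.1 e1).resolve_right hθ0
    have h1 := Fintype.linearIndependent_iff.1 hli
      ![-⟨algebraMap F D (a 1), algebraMap_mem_center _⟩,
        -⟨algebraMap F D (a 2), algebraMap_mem_center _⟩, 1] (by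
      have e3 : ∀ (x : F) (y : D), (⟨algebraMap F D x, algebraMap_mem_center _⟩ :
        Subring.center D) • y = x • y := fun x y => (Algebra.smul_def x y).symm
      simp only [Fin.sum_univ_three, Matrix.cons_val_zero, Matrix.cons_val_one, Matrix.cons_val,
        neg_smul, e3, one_smul]
      rw [← e2]
      simp [pow_two, Algebra.algebraMap_eq_smul_one]
      abel) 2
    simp at h1
  generalize a 0 = c at *
  generalize -a 1 = b at *
  generalize a 2 = e at *
  let E := Subalgebra.centralizer F {θ}
  let L := Algebra.adjoin F {θ}
  have hL : ∀ x, σ x = x → θ * x = x * θ → x ∈ L := fun x hx hxθ =>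
    hσ.mem_adjoin_of_commute hθσ h9 h3 hx hxθ
  have hfix : ∀ x ∈ L, σ x = x ∧ θ * x = x * θ := fun x hx => hσ.fixed_of_mem_adjoin hθσ hx
  have hLE : L ≤ E := fun x hx => mem_centralizer_singleton.2 (hfix x hx).2
  have hLcomm : ∀ x, θ * x = x * θ → ∀ y ∈ L, x * y = y * x := by
    intro x hx y hy
    refine (mem_centralizer_singleton (F := F).1 (Algebra.adjoin_le (S := Subalgebra.centralizer F {x}) ?_ hy))
    rintro _ rfl
    exact mem_centralizer_singleton.2 hx.symm
  let _ : DivisionRing E := E.divisionRing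
  let _ : Field L := L.fieldOfComm (Algebra.adjoin_singleton_comm θ)
  let _ : Module F V := Module.compHom V (algebraMap F D)
  have : IsScalarTower F D V := ⟨fun a x v => by
    rw [Algebra.smul_def, mul_smul]; rfl⟩
  have : FiniteDimensional E D := Module.Finite.of_restrictScalars_finite F _ _
  have : FiniteDimensional E V := Module.Finite.trans D V
  have : FiniteDimensional L D := Module.Finite.of_restrictScalars_finite F _ _
  have : FiniteDimensional L V := Module.Finite.trans D V
  have hE2 : finrank F E = 2 * finrank F L := hσ.finrank_centralizer_cubic hθσ h9 h3
  have hED := finrank_mul_finrank F E D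
  have hEV := finrank_mul_finrank E D V
  -- The degree is `2` or `3`, and `2 [L:F]` divides `18`.
  have hL3 : finrank F L = 3 := by
    have h1 : finrank F L = (minpoly F θ).natDegree := finrank_adjoin_singleton (F := F) θ
    have h2 : (minpoly F θ).natDegree ≠ 1 := fun h => by
      obtain ⟨z, rfl⟩ := mem_range_algebraMap_of_natDegree_minpoly_eq_one F h
      exact hθc (algebraMap_mem_center z)
    have h4 : (minpoly F θ).natDegree ≤ 3 := by
      let p : Polynomial F := Polynomial.X ^ 3 - Polynomial.C e * Polynomial.X ^ 2 +
        Polynomial.C b * Polynomial.X - Polynomial.C c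
      have hp : p.natDegree ≤ 3 := by
        dsimp only [p]
        compute_degree
      have hp0 : p ≠ 0 := by
        intro h
        have := congrArg (fun q => Polynomial.coeff q 3) h
        simp [p, Polynomial.coeff_X_pow] at this
      refine (Polynomial.natDegree_le_of_dvd (minpoly.dvd F θ ?_) hp0).trans hp
      simp only [p, map_add, map_sub, map_mul, Polynomial.aeval_C, Polynomial.aeval_X, map_pow]
      have e1 : θ ^ 3 = θ * θ * θ := by noncomm_ring
      rw [e1, hθ, pow_two, ← Algebra.smul_def, ← Algebra.smul_def]
      abel
    have h5 : finrank F L * 2 * finrank E D = 18 := by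
      rw [← hD, ← hED, hE2, mul_comm 2]
    have h6 : 0 < finrank F L := finrank_pos
    rw [← h1] at h2 h4
    interval_cases finrank F L <;> omega
  have hnL : QuadraticUBound L (2 * n) := hn.extension (by rw [hL3]; omega)
  let T : D → D := cubicMap θ e c
  have hTc : ∀ d, θ * T d = T d * θ := commute_cubicMap hθ
  have hTa : ∀ x y, T (x + y) = T x + T y := cubicMap_add
  have hTl : ∀ a, θ * a = a * θ → ∀ d, T (a * d) = a * T d := fun a ha => cubicMap_mul_left ha
  have hTr : ∀ a, θ * a = a * θ → ∀ d, T (d * a) = T d * a := fun a ha => cubicMap_mul_right ha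
  have hTσ : ∀ d, σ (T d) = T (σ d) := hσ.map_cubicMap hθσ
  let Q : QuadraticForm L V := QuadraticMap.ofPolar
    (fun x => ⟨T (h x x), hL _ ((hTσ _).trans (by rw [← hh.symm])) (hTc _)⟩)
    (fun a x => Subtype.ext (by
      change T (h ((a : D) • x) ((a : D) • x)) = (a : D) * a * T (h x x)
      rw [hh.smul_left, hh.smul_right hσ, (hfix a a.2).1, hTl a (hfix a a.2).2,
        hTr a (hfix a a.2).2, hLcomm _ (hTc _) a a.2, mul_assoc]))
    (fun x y z => Subtype.ext (by
      change T (h (x + y + z) (x + y + z)) - T (h (x + y) (x + y)) - T (h z z) =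
        (T (h (x + z) (x + z)) - T (h x x) - T (h z z)) +
        (T (h (y + z) (y + z)) - T (h y y) - T (h z z))
      simp only [hh.add_left, hh.add_right hσ, hTa]
      abel))
    (fun a x y => Subtype.ext (by
      change T (h ((a : D) • x + y) ((a : D) • x + y)) - T (h ((a : D) • x) ((a : D) • x)) -
        T (h y y) = (a : D) * (T (h (x + y) (x + y)) - T (h x x) - T (h y y))
      simp only [hh.add_left, hh.add_right hσ, hh.smul_left, hh.smul_right hσ, hTa,
        (hfix a a.2).1, hTl a (hfix a a.2).2, hTr a (hfix a a.2).2]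
      rw [hLcomm _ (hTc (h y x)) a a.2]
      noncomm_ring))
  -- An `E`-subspace of dimension above `n` has `L`-dimension above `2n ≥ u(L)`, so `n` is the
  -- threshold. Since `dim_E V = 3 dim_D V`, the assumption `n < dim_D V` leaves room for a subspace
  -- of dimension `dim_D V + 1`, more than `finrank_le_of_cubicMap_eq_zero` permits.
  have key := exists_submodule_forall_isotropic (E := E) (V := V) (fun x => T (h x x) = 0)
    (by rw [hh.zero_left]; simp [T, cubicMap]) 1 n ?_ ?_ (finrank D V) ⊤ ?_
  · obtain ⟨Y, -, hYk, hY⟩ := key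
    have h1 := hh.finrank_le_of_cubicMap_eq_zero hσ hθσ hθ hc han Y ?_
    · change finrank E Y ≤ _ at h1
      omega
    · intro x hx y hy
      have hpol : ∀ x ∈ Y, T (h x y) + T (h y x) = 0 := fun x hx => by
        have h1 := hY _ (add_mem hx hy)
        simp only [hh.add_left, hh.add_right hσ, hTa] at h1
        have h2 := hY x hx
        have h3 := hY y hy
        rw [h2, h3, zero_add, add_zero, add_comm] at h1
        rw [add_comm, h1]
      obtain ⟨t, ht, hne⟩ := hσ.exists_ne
      have hcθ : ∀ z ∈ Subring.center D, θ * z = z * θ := fun z hz => Subring.mem_center_iff.1 hz θ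
      have ht0 : t - σ t ≠ 0 := sub_ne_zero.2 hne.symm
      have hσt := hσ.map_mem_center ht
      have h1 := hpol ((⟨t, mem_centralizer_singleton.2 (hcθ t ht)⟩ : E) • x) (Y.smul_mem _ hx)
      change T (h (t • x) y) + T (h y (t • x)) = 0 at h1
      rw [hh.smul_left, hh.smul_right hσ] at h1
      rw [hTl _ (hcθ t ht), hTr _ (hcθ _ hσt),
        Subring.mem_center_iff.1 hσt] at h1
      have h2 : (t - σ t) * T (h x y) = 0 := by
        have e1 : (t - σ t) * T (h x y) =
          (t * T (h x y) + σ t * T (h y x)) -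
          σ t * (T (h x y) + T (h y x)) := by noncomm_ring
        rw [e1, h1, hpol x hx, mul_zero, sub_zero]
      exact (mul_eq_zero.1 h2).resolve_left ht0
  · intro U hU
    let U' : Submodule L V :=
      { U.toAddSubmonoid with smul_mem' := fun a x hx => U.smul_mem ⟨a, hLE a.2⟩ hx }
    have h1 := Subalgebra.finrank_mul_finrank_restrictScalars L U'
    have h2 := Subalgebra.finrank_mul_finrank_restrictScalars E U
    have h4 : U'.restrictScalars F = U.restrictScalars F := rfl
    rw [h4, ← h2, hE2, hL3] at h1
    obtain ⟨x, hxU, hx0, hx⟩ := hnL.exists_isotropic_mem Q U' (by omega)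
    exact ⟨x, hxU, hx0, congrArg Subtype.val hx⟩
  · intro x hx
    let f : V →ₗ[E] E :=
      { toFun := fun y => ⟨T (h y x), mem_centralizer_singleton.2 (hTc _)⟩
        map_add' := fun y z => Subtype.ext (by
          change T (h (y + z) x) = T (h y x) + T (h z x)
          rw [hh.add_left, hTa])
        map_smul' := fun a y => Subtype.ext (by
          change T (h ((a : D) • y) x) = (a : D) * T (h y x)
          rw [hh.smul_left, hTl _ (mem_centralizer_singleton.1 a.2)]) }
    refine ⟨LinearMap.ker f, Subtype.ext hx, (finrank_quotient_ker_le f).trans (by simp), ?_⟩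
    intro y hy hyy a
    have hyx : T (h y x) = 0 := congrArg Subtype.val hy
    have hxy : T (h x y) = 0 := by
      rw [hh.symm y x, ← hTσ]
      exact (congrArg σ hyx).trans hσ.map_zero
    have haθ := mem_centralizer_singleton.1 a.2
    have hσa : θ * σ a = σ a * θ := by
      have := congrArg σ haθ
      rw [hσ.map_mul, hσ.map_mul, hθσ] at this
      exact this.symm
    change T (h ((a : D) • x + y) ((a : D) • x + y)) = 0
    simp only [hh.add_left, hh.add_right hσ, hh.smul_left, hh.smul_right hσ, hTa,
      hTl _ haθ, hTr _ hσa] at hx hyx hxy hyy ⊢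
    rw [hx, hyx, hxy, hyy]
    simp
  · rw [finrank_top]
    rw [hD, hE2, hL3] at hED
    have : finrank E D = 3 := by omega
    rw [this] at hEV
    omega

end Degree3

/-! ### Degree one: the bound `n/2` -/

/-- Hermitian forms over a separable quadratic field extension. -/
theorem IsHermitianForm.finrank_le_of_finrank_eq_two {F D : Type*} [Field F] [DivisionRing D]
    [Algebra F D] (hD : finrank F D = 2) {σ : D → D} (hσ : IsUnitaryInvolution F σ) {n : ℕ}
    (hn : QuadraticUBound F n) {V : Type*} [AddCommGroup V] [Module D V] [FiniteDimensional D V]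
    {h : V → V → D} (hh : IsHermitianForm σ h) (han : ∀ x, h x x = 0 → x = 0) :
    2 * finrank D V ≤ n := by
  by_contra! hlt
  have : FiniteDimensional F D := FiniteDimensional.of_finrank_pos (by omega)
  have h1 : Subring.center D = ⊤ := by
    by_contra h
    have h1 := hσ.finrank_eq_two_mul
    exact h (eq_top_of_finrank_center_eq_one (by omega))
  let _ : Module F V := Module.compHom V (algebraMap F D)
  have : IsScalarTower F D V := ⟨fun a x v => by
    rw [Algebra.smul_def, mul_smul]; rfl⟩
  have : FiniteDimensional F V := Module.Finite.trans D V
  obtain ⟨g, hg⟩ := exists_linearMap_algebraMap_eq (F := F) (D := D)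
  obtain ⟨x, hx0, hx⟩ := hn.exists_isotropic (hh.quadraticForm hσ g) (by
    rw [← finrank_mul_finrank F D V, hD]
    exact hlt)
  obtain ⟨a, ha⟩ := hσ.mem_range (h x x) (h1 ▸ Subring.mem_top _) (hh.symm x x).symm
  rw [IsHermitianForm.quadraticForm_apply, ← ha, hg] at hx
  exact hx0 (han x (by rw [← ha, hx, map_zero]))

/-! ### Assembling the degrees and passing to Brauer classes -/

section Main

variable {F : Type*} {K : Type*} [Field F] [Field K] [Algebra F K] {D : Type*} [DivisionRing D]
  [Algebra K D] [Algebra F D] [IsScalarTower F K D]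

theorem IsUnitaryInvo.isUnitaryInvolution [Algebra.IsCentral K D] {γ : RingInvo D}
    (hγ : IsUnitaryInvo F K γ) (hK : finrank F K = 2) :
    IsUnitaryInvolution F fun x => (γ x).unop := by
  refine ⟨fun x y => ?_, fun x y => ?_, fun x => ?_, fun a => ?_, fun x hx hxf => ?_, ?_⟩
  · rw [map_add, MulOpposite.unop_add]
  · rw [map_mul, MulOpposite.unop_mul]
  · exact γ.involution' x
  · rw [IsScalarTower.algebraMap_apply F K D]
    exact (hγ _).2 ⟨a, rfl⟩
  · obtain ⟨k, rfl⟩ := (Algebra.IsCentral.mem_center_iff K).1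
      (Subalgebra.mem_center_iff.2 (Subring.mem_center_iff.1 hx))
    obtain ⟨a, rfl⟩ := (hγ k).1 hxf
    exact ⟨a, IsScalarTower.algebraMap_apply F K D a⟩
  · by_contra! H
    have hsurj : Function.Surjective (Algebra.linearMap F K) := fun k =>
      (hγ k).1 (H _ (Subring.mem_center_iff.2 fun g => (Algebra.commutes k g).symm))
    have h1 := (LinearEquiv.ofBijective (Algebra.linearMap F K)
      ⟨(algebraMap F K).injective, hsurj⟩).finrank_eq
    rw [finrank_self, hK] at h1
    omega

/-- The bound on the dimensions of anisotropic hermitian forms over a division algebra of degree at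
most `4`. -/
theorem IsHermitianForm.finrank_le_of_degree_le_four [Algebra.IsCentral K D]
    [FiniteDimensional K D] (hK : finrank F K = 2) (hD : Nat.sqrt (finrank K D) ≤ 4) {σ : D → D}
    (hσ : IsUnitaryInvolution F σ) {n : ℕ} (hn : QuadraticUBound F n) {V : Type*} [AddCommGroup V]
    [Module D V] [FiniteDimensional D V] {h : V → V → D} (hh : IsHermitianForm σ h)
    (han : ∀ x, h x x = 0 → x = 0) : 32 * finrank D V ≤ 63 * n := by
  have hFD : finrank F D = 2 * finrank K D := by rw [← hK, finrank_mul_finrank]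
  have hpos : 0 < finrank K D := finrank_pos
  have : FiniteDimensional F D := FiniteDimensional.of_finrank_pos (by omega)
  -- Only the fact that the dimension is a square is used here; it reduces the claim to `d ≤ 4`.
  obtain ⟨d, hd, -⟩ := exists_reducedTrace K D
  rw [hd, Nat.sqrt_eq] at hD
  rw [hd] at hFD hpos
  have hd0 : d ≠ 0 := by
    rintro rfl
    omega
  interval_cases d
  · exact absurd rfl hd0
  · have := hh.finrank_le_of_finrank_eq_two hFD hσ hn han
    omega
  · have := hh.finrank_le_of_finrank_eq_eight hFD hσ hn han
    omega
  · have := hh.finrank_le_of_finrank_eq_eighteen hFD hσ hn han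
    omega
  · exact hh.finrank_le_of_finrank_eq_thirtyTwo hFD hσ hn han

theorem EpsHermitianForm.Anisotropic.length_le [Algebra.IsCentral K D] [FiniteDimensional K D]
    (hK : finrank F K = 2) (hD : Nat.sqrt (finrank K D) ≤ 4) {γ : RingInvo D}
    (hγ : IsUnitaryInvo F K γ) {n : ℕ} (hn : QuadraticUBound F n) {V : Type*} [AddCommGroup V]
    [Module Dᵐᵒᵖ V] [Module.Finite Dᵐᵒᵖ V] {h : EpsHermitianForm γ 1 V} (han : h.Anisotropic) :
    Module.length Dᵐᵒᵖ V ≤ (63 * n / 32 : ℕ) := by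
  have hσ := hγ.isUnitaryInvolution hK
  rw [Module.length_eq_finrank, Nat.cast_le]
  -- The involution turns the right space into a left one by `d x = x γ(d)`; the given form,
  -- semilinear in its first variable, becomes linear there.
  let _ : Module D V := Module.compHom V (γ.toRingEquiv : D →+* Dᵐᵒᵖ)
  have hsmul : ∀ (d : D) (x : V), d • x = MulOpposite.op (γ d).unop • x := fun _ _ => rfl
  have hfin : finrank D V = finrank Dᵐᵒᵖ V :=
    congrArg Cardinal.toNat (rank_eq_of_equiv_equiv γ (AddEquiv.refl V) γ.toRingEquiv.bijective
      fun _ _ => rfl)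
  rcases Nat.eq_zero_or_pos (finrank D V) with h0 | h0
  · rw [← hfin, h0]
    exact Nat.zero_le _
  have : FiniteDimensional D V := FiniteDimensional.of_finrank_pos h0
  have hh : IsHermitianForm (fun x => (γ x).unop) fun x y => h.toFun x y := by
    refine ⟨fun x y z => ?_, fun a x y => ?_, fun x y => ?_⟩
    · rw [map_add, AddMonoidHom.add_apply]
    · have h1 := h.map_smul_smul x y (γ a).unop 1
      rw [MulOpposite.op_one, one_smul, mul_one, hσ.invol] at h1
      rw [hsmul, h1]
    · rw [h.symm x y, Units.val_one, one_smul]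
  have := hh.finrank_le_of_degree_le_four hK hD hσ hn han
  omega

end Main

theorem BrauerGroup.divisionAlgebra_isUnit_or_eq_zero {K : Type u} [Field K]
    (α : BrauerGroup.{u, v} K) (x : α.divisionAlgebra) : IsUnit x ∨ x = 0 :=
  or_iff_not_imp_right.2 (α.exists_division.choose_spec.1 x)

theorem BrauerGroup.unitaryUInv_le {F : Type u} {K : Type v} [Field F] [Field K] [Algebra F K]
    (hK : finrank F K = 2) (α : BrauerGroup.{v, w} K) (hα : α.ind ≤ 4) {n : ℕ}
    (hn : QuadraticUBound F n) : α.unitaryUInv F ≤ (63 * n / 32 : ℕ) := by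
  refine iSup₂_le fun γ hγ => sSup_le ?_
  rintro _ ⟨V, _, _, _, h, han, rfl⟩
  let _ : DivisionRing α.divisionAlgebra :=
    DivisionRing.ofIsUnitOrEqZero α.divisionAlgebra_isUnit_or_eq_zero
  let _ : Algebra F α.divisionAlgebra := Algebra.compHom _ (algebraMap F K)
  have : IsScalarTower F K α.divisionAlgebra := IsScalarTower.of_algebraMap_eq fun _ => rfl
  exact han.length_le hK hα hγ hn

theorem mainTheorem4 {F : Type u} {K : Type v} [Field F] [Field K] [Algebra F K]
    (hF : IsSumSq (-1 : F))
    (hsep : Algebra.IsSeparable F K) (hquad : Module.finrank F K = 2)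
    (α : BrauerGroup.{v, w} K) (hα : α.ind ≤ 4) :
    ((α.unitaryUInv F : ℕ∞) : ℝ≥0∞) ≤ (63 / 32 : ℝ≥0∞) * ((fieldUInv F : ℕ∞) : ℝ≥0∞) := by
  -- For `u(F) = ∞` the right side is infinite; otherwise the bound holds even with `63n/32` rounded
  -- down.
  rcases eq_or_ne (fieldUInv F) ⊤ with htop | htop
  · rw [htop, ENat.toENNReal_top, ENNReal.mul_top (by simp)]
    exact le_top
  · obtain ⟨n, hn⟩ := ENat.ne_top_iff_exists.1 htop
    have h1 := α.unitaryUInv_le hquad hα (QuadraticUBound.of_fieldUInv hn.ge)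
    refine (ENat.toENNReal_le.2 h1).trans ?_
    rw [← hn, ENat.toENNReal_coe, ENat.toENNReal_coe, ← ENNReal.mul_div_right_comm,
      ENNReal.le_div_iff_mul_le (by simp) (by simp)]
    exact_mod_cast Nat.div_mul_le_self (63 * n) 32
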